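/- **Theorem 5.2.** Let $L>4\pi$. For $k\in(0,1)$ let $K(k)=\int_0^{\pi/2}\frac{d\theta}{\sqrt{1-k^2\sin^2\theta}}$ be the complete elliptic integral of the first kind, let $\mathrm{CN}(\cdot,k)$ be the Jacobi cnoidal function, and put $$R(k)=\sqrt{k^4-k^2+1},\qquad \tilde m(k)=L^2-64K^2(k)R(k).$$ There is a unique $k_L\in(0,1)$ with $64K^2(k_L)R(k_L)=L^2$. For $k\in(0,k_L)$ let $$c(k)=\frac{L^2}{\tilde m(k)},\qquad A(k)=-\frac{204800\,K^6(k)}{27\,\tilde m^3(k)}\bigl(R(k)-(2k^2-1)\bigr)^2\bigl(2R(k)+(2k^2-1)\bigr),$$ $$\phi_k(x)=\left[\frac{5}{12}\left(\frac{L^2-64(2k^2-1)K^2(k)}{\tilde m(k)}-1\right)+\frac{80k^2K^2(k)}{\tilde m(k)}\,\mathrm{CN}^2\!\left(\frac{2K(k)}{L}x,k\right)\right]^2 .$$ Let $H^1_{per}=H^1_{per}([0,L])$ be the space of real $L$-periodic functions with finite norm $\|f\|_{H^1_{per}}^2=L\sum_{n\in\mathbb Z}(1+|n|^2)|\widehat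 f(n)|^2$, where $\widehat f(n)=\frac1L\int_0^L f(x)e^{-2\pi i nx/L}\,dx$. For an interval $I=[0,T]$ or $I=[0,\infty)$, a solution on $I$ of $$u_t-u_{xxt}+(u+|u|^{3/2})_x=0,\qquad u(0)=u_0\in H^1_{per},\tag{1}$$ is a function $u\in C(I;H^1_{per})$ with $$u(t)=u_0-\int_0^t(1-\partial_x^2)^{-1}\partial_x\bigl(u+|u|^{3/2}\bigr)(\tau)\,d\tau\qquad(t\in I).$$ Then for every $k\in(0,k_L)$ one has $c(k)>1$, and $\phi_k$ is a smooth, positive, $L$-periodic solution of $$-c(k)\phi''+(c(k)-1)\phi-\phi^{3/2}+A(k)=0$$ (so that $\phi_k(x-c(k)t)$ is a traveling wave of the equation), and $\phi_k$ is orbitally stable in $H^1_{per}$: for every $\varepsilon>0$ there is $\delta>0$ such that, for every $u_0\in H^1_{per}$ with $\|u_0-\phi_k\|_{H^1_{per}}<\delta$, problem (1) has a solution $u\in C([0,\infty);H^1_{per})$, which is its only solution on each interval $[0,T]$, $T>0$, and which satisfies $$\sup_{t\ge0}\,\inf_{r\in\mathbb R}\|u(t)-\phi_k(\cdot+r)\|_{H^1_{per}}<\varepsilon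 .$$ -/

import Mathlib

open Set Filter Topology MeasureTheory
open scoped ContDiff

noncomputable section

/-- Legendre's incomplete elliptic integral of the first kind, as a function of the amplitude. -/
def ellipticF (k φ : ℝ) : ℝ :=
  ∫ θ in (0 : ℝ)..φ, 1 / Real.sqrt (1 - k ^ 2 * Real.sin θ ^ 2)

/-- The complete elliptic integral of the first kind of modulus `k`. -/
def ellipticK (k : ℝ) : ℝ := ellipticF k (Real.pi / 2)

/-- The Jacobi amplitude: for `0 < k < 1` the function `ellipticF k` is an increasing bijection of
the line, and this is its inverse. -/
def jacobiAm (k x : ℝ) : ℝ := Function.invFun (ellipticF k) x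

/-- The Jacobi elliptic function `CN(x, k)`. -/
def jacobiCN (x k : ℝ) : ℝ := Real.cos (jacobiAm k x)

/-- The function `g(k) = 64 K(k)² √(k⁴ - k² + 1)`. -/
def gFun (k : ℝ) : ℝ := 64 * ellipticK k ^ 2 * Real.sqrt (k ^ 4 - k ^ 2 + 1)

/-- `kL` is the critical modulus `k_L` of the period `L`. -/
def IsCriticalModulus (L kL : ℝ) : Prop := kL ∈ Ioo (0 : ℝ) 1 ∧ gFun kL = L ^ 2

/-- `m(k) = L² - 64 K(k)² √(k⁴ - k² + 1)`. -/
def mTilde (L k : ℝ) : ℝ := L ^ 2 - 64 * ellipticK k ^ 2 * Real.sqrt (k ^ 4 - k ^ 2 + 1)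

/-- The wave speed `c(k)`. -/
def waveSpeed (L k : ℝ) : ℝ := L ^ 2 / mTilde L k

/-- The integration constant `A(k)`. -/
def waveConst (L k : ℝ) : ℝ :=
  -204800 * ellipticK k ^ 6 / (27 * mTilde L k ^ 3) *
    ((Real.sqrt (k ^ 4 - k ^ 2 + 1) - (2 * k ^ 2 - 1)) ^ 2 *
      (2 * Real.sqrt (k ^ 4 - k ^ 2 + 1) + (2 * k ^ 2 - 1)))

/-- The cnoidal-type profile `φ_k`. -/
def cnoidalWave (L k x : ℝ) : ℝ :=
  (5 / 12 * ((L ^ 2 - 64 * (2 * k ^ 2 - 1) * ellipticK k ^ 2) / mTilde L k - 1) +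
    80 * k ^ 2 * ellipticK k ^ 2 / mTilde L k * jacobiCN (2 * ellipticK k / L * x) k ^ 2) ^ 2

/-- `φ` is a smooth positive `L`-periodic solution of `-c φ'' + (c - 1) φ - φ^{3/2} + A = 0`, that
is, the profile of a traveling wave `φ(x - c t)` of speed `c > 1`. -/
structure IsPeriodicWaveProfile (L c A : ℝ) (φ : ℝ → ℝ) : Prop where
  one_lt_speed : 1 < c
  smooth : ContDiff ℝ ∞ φ
  periodic : Function.Periodic φ L
  pos : ∀ x, 0 < φ x
  ode : ∀ x, -c * deriv (deriv φ) x + (c - 1) * φ x - φ x ^ (3 / 2 : ℝ) + A = 0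

/-- The `n`-th Fourier coefficient of an `L`-periodic function. -/
def perFourier (L : ℝ) (f : ℝ → ℝ) (n : ℤ) : ℂ :=
  (1 / L : ℂ) * ∫ x in (0 : ℝ)..L,
    (f x : ℂ) * Complex.exp (-(2 * Real.pi * n * x / L : ℂ) * Complex.I)

/-- The norm of `H¹_per([0, L])`, with value `⊤` where the series diverges:
`‖f‖² = L ∑ₙ (1 + |n|²) |f̂(n)|²`. -/
def h1Norm (L : ℝ) (f : ℝ → ℝ) : ENNReal :=
  (ENNReal.ofReal L *
    ∑' n : ℤ, ENNReal.ofReal ((1 + (n : ℝ) ^ 2) * ‖perFourier L f n‖ ^ 2)) ^ (1 / 2 : ℝ)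

/-- The real Sobolev space `H¹_per([0, L])`; each of its elements is represented by its unique
continuous `L`-periodic representative. -/
def H1per (L : ℝ) : Set (ℝ → ℝ) :=
  {f | Continuous f ∧ Function.Periodic f L ∧ h1Norm L f < ⊤}

/-- The operator `-(1 - ∂ₓ²)⁻¹ ∂ₓ` on `L`-periodic functions: the Fourier multiplier with symbol
`-iξ / (1 + ξ²)` at the frequency `ξ = 2πn / L`. -/
def bbmOp (L : ℝ) (w : ℝ → ℝ) (x : ℝ) : ℂ :=
  ∑' n : ℤ, -Complex.I * (2 * Real.pi * n / L) / (1 + (2 * Real.pi * n / L) ^ 2) *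
    perFourier L w n * Complex.exp ((2 * Real.pi * n * x / L : ℂ) * Complex.I)

/-- `u ∈ C(I; H¹_per([0, L]))` solves `u_t - u_xxt + (u + |u|^{3/2})_x = 0` with `u(0) = u₀` on the
time interval `I` (which is `[0, T]` or `[0, ∞)`), in the integrated form
`u(t) = u₀ - ∫₀ᵗ (1 - ∂ₓ²)⁻¹ ∂ₓ (u + |u|^{3/2})(τ) dτ`. -/
structure IsSolution (L : ℝ) (I : Set ℝ) (u₀ : ℝ → ℝ) (u : ℝ → ℝ → ℝ) : Prop where
  mem : ∀ t ∈ I, u t ∈ H1per L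
  continuous : ∀ s ∈ I, Tendsto (fun t => h1Norm L (u t - u s)) (𝓝[I] s) (𝓝 0)
  eqn : ∀ t ∈ I, ∀ x : ℝ, (u t x : ℂ) =
    u₀ x + ∫ τ in (0 : ℝ)..t, bbmOp L (fun y => u τ y + |u τ y| ^ (3 / 2 : ℝ)) x

/-- Orbital stability of `φ` in `H¹_per([0, L])`: for every datum `u₀` that is `δ`-close to `φ` the
solution exists globally, is unique on every time interval `[0, T]`, and stays `ε`-close to the set
of translates of `φ`. -/
def OrbitallyStable (L : ℝ) (φ : ℝ → ℝ) : Prop :=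
  ∀ ε : ℝ, 0 < ε → ∃ δ : ℝ, 0 < δ ∧ ∀ u₀ ∈ H1per L,
    h1Norm L (u₀ - φ) < ENNReal.ofReal δ →
      ∃ u : ℝ → ℝ → ℝ, IsSolution L (Ici 0) u₀ u ∧
        (∀ T : ℝ, 0 < T → ∀ v : ℝ → ℝ → ℝ, IsSolution L (Icc 0 T) u₀ v →
          ∀ t ∈ Icc 0 T, v t = u t) ∧
        (⨆ t ∈ Ici (0 : ℝ), ⨅ r : ℝ, h1Norm L (u t - fun x => φ (x + r))) < ENNReal.ofReal ε

end

/-! The space H¹_per is realized as the real Hilbert space `HSpace` of weighted Fourier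
coefficients. Since (1 - ∂ₓ²)⁻¹∂ₓ gains one derivative, the equation becomes an ordinary
differential equation u' = `field` u with a locally Lipschitz right-hand side (`field_lipschitz`).
It conserves the squared norm ∫ u² + u_x² (`inner_field_self`), the energy (`pair_flux_field`) and
the mass (`mass_field`). Conservation of the norm makes solutions global (`exists_global_solution`),
and the local Lipschitz bound makes them unique (`eq_of_isSolution`).

Put σ = c - 1 and φ = (σv)². The profile equation says that φ is a critical point of `lyapunov`,
which is built from the three invariants. Suppose that on f orthogonal to φ' the second variation
`hessian` is bounded below by δ‖f‖² up to the square of a combination of ⟨φ, f⟩ and ∫ f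
(`IsCoercive`). Nearby data have nearly the same norm and mass as φ, so that square is of fourth
order in the distance to the orbit. Hence the distance cannot take a prescribed small value
(`infDist_ne_of_isCoercive`), and continuity in time traps the solution
(`orbitallyStable_of_isCoercive`).

Coercivity is proved without spectral theory. Up to the factor σ the linearized operator is M f =
-f''/lam + (1 - 3v/2) f, where lam = σ/(σ + 1), and M annihilates (v²)'. The functions `psi` solve M
f = const explicitly. Two of them, used as sub- and supersolutions on complementary arcs, show that
the form is positive on functions vanishing at two points ±x₀ (`exists_node`,
`exists_form_lower_bound`). This subspace has codimension two and is complemented by the odd kernel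
element φ' and any even P not vanishing at x₀. If P has negative Hessian, and its Hessian pairing is
a combination of the two linearized constraints, completing a square gives coercivity
(`isCoercive_of_test`). Such a P is an explicit polynomial in v plus a multiple of the periodic
`psi` (`WaveProfile.isCoercive`). The sign of its Hessian reduces, through the moments of v, to the
inequality `quadratic_coefficient_neg`.

Finally, the cnoidal functions are shown to be profiles of this kind (`waveProfile_cnProfile`). The
modulus k_L exists and is unique because `gFun` is continuous and strictly increasing, equals 16π²
at 0 and is unbounded (`gFun_strictMonoOn`, `exists_lt_gFun`). -/

noncomputable section

namespace PeriodicBBM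

/-! ### Fourier coefficients of continuous periodic functions. -/

section

/-- A continuous `L`-periodic real function. -/
structure ContPer (L : ℝ) (f : ℝ → ℝ) : Prop where
  cont : Continuous f
  per : Function.Periodic f L

/-- The `n`-th exponential of period `L`. -/
def expo (L : ℝ) (n : ℤ) (x : ℝ) : ℂ := Complex.exp ((2 * Real.pi * n * x / L : ℂ) * Complex.I)

/-- The `n`-th frequency `2πn / L`. -/
def freq (L : ℝ) (n : ℤ) : ℝ := 2 * Real.pi * n / L

section Fourier

variable {L : ℝ} {f g : ℝ → ℝ}

namespace ContPer

theorem add (hf : ContPer L f) (hg : ContPer L g) : ContPer L (fun x => f x + g x) :=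
  ⟨hf.cont.add hg.cont, fun x => by simp only [hf.per x, hg.per x]⟩

theorem sub (hf : ContPer L f) (hg : ContPer L g) : ContPer L (fun x => f x - g x) :=
  ⟨hf.cont.sub hg.cont, fun x => by simp only [hf.per x, hg.per x]⟩

theorem mul (hf : ContPer L f) (hg : ContPer L g) : ContPer L (fun x => f x * g x) :=
  ⟨hf.cont.mul hg.cont, fun x => by simp only [hf.per x, hg.per x]⟩

theorem const_mul (c : ℝ) (hf : ContPer L f) : ContPer L (fun x => c * f x) :=
  ⟨continuous_const.mul hf.cont, fun x => by simp only [hf.per x]⟩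

theorem const (c : ℝ) : ContPer L (fun _ => c) := ⟨continuous_const, fun _ => rfl⟩

theorem comp {G : ℝ → ℝ} (hG : Continuous G) (hf : ContPer L f) : ContPer L (fun x => G (f x)) :=
  ⟨hG.comp hf.cont, fun x => by simp only [hf.per x]⟩

theorem shift (hf : ContPer L f) (r : ℝ) : ContPer L (fun x => f (x + r)) :=
  ⟨hf.cont.comp (continuous_id.add continuous_const), fun x => by
    show f (x + L + r) = f (x + r)
    rw [add_right_comm, hf.per]⟩

end ContPer

theorem norm_expo (L : ℝ) (n : ℤ) (x : ℝ) : ‖expo L n x‖ = 1 := by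
  rw [expo, show (2 * Real.pi * n * x / L : ℂ) = ((2 * Real.pi * n * x / L : ℝ) : ℂ) by push_cast; rfl,
    Complex.norm_exp_ofReal_mul_I]

theorem continuous_expo (L : ℝ) (n : ℤ) : Continuous (expo L n) := by
  unfold expo; fun_prop

theorem expo_add (L : ℝ) (n : ℤ) (x y : ℝ) : expo L n (x + y) = expo L n x * expo L n y := by
  rw [expo, expo, expo, ← Complex.exp_add]; push_cast; ring_nf

theorem expo_neg (L : ℝ) (n : ℤ) (x : ℝ) : expo L (-n) x = (starRingEnd ℂ) (expo L n x) := by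
  rw [expo, expo, ← Complex.exp_conj]
  congr 1
  simp [map_ofNat]
  ring

theorem expo_period (hL : 0 < L) (n : ℤ) : expo L n L = 1 := by
  have : (L : ℂ) ≠ 0 := by exact_mod_cast hL.ne'
  rw [expo, Complex.exp_eq_one_iff]
  exact ⟨n, by field_simp⟩

theorem perFourier_expo (L : ℝ) (f : ℝ → ℝ) (n : ℤ) :
    perFourier L f n = (1 / L : ℂ) * ∫ x in (0 : ℝ)..L, (f x : ℂ) * expo L (-n) x := by
  unfold perFourier expo
  congr 2
  funext x
  congr 2
  push_cast
  ring

theorem fourier_eq_expo (L : ℝ) (n : ℤ) (x : ℝ) :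
    (fourier n (x : AddCircle L) : ℂ) = expo L n x := by
  rw [fourier_coe_apply, expo]; congr 1; ring

theorem perFourier_eq_on (hL : 0 < L) (f : ℝ → ℝ) (n : ℤ) :
    perFourier L f n = fourierCoeffOn hL (fun x => (f x : ℂ)) n := by
  rw [fourierCoeffOn_eq_integral, perFourier_expo, Complex.real_smul]
  simp only [smul_eq_mul, sub_zero, fourier_eq_expo]
  push_cast
  congr 2
  funext x
  ring

theorem perFourier_add (hf : Continuous f) (hg : Continuous g) (n : ℤ) :
    perFourier L (fun x => f x + g x) n = perFourier L f n + perFourier L g n := by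
  simp only [perFourier_expo]
  rw [← mul_add, ← intervalIntegral.integral_add]
  · congr 2; funext x; push_cast; ring
  · exact ((Complex.continuous_ofReal.comp hf).mul (continuous_expo L _)).intervalIntegrable _ _
  · exact ((Complex.continuous_ofReal.comp hg).mul (continuous_expo L _)).intervalIntegrable _ _

theorem perFourier_const_mul (c : ℝ) (f : ℝ → ℝ) (n : ℤ) :
    perFourier L (fun x => c * f x) n = c * perFourier L f n := by
  simp only [perFourier_expo]
  rw [mul_left_comm (c : ℂ), ← intervalIntegral.integral_const_mul (c : ℂ)]
  congr 2; funext x; push_cast; ring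

theorem perFourier_sub (hf : Continuous f) (hg : Continuous g) (n : ℤ) :
    perFourier L (fun x => f x - g x) n = perFourier L f n - perFourier L g n := by
  have := perFourier_add (L := L) hf (g := fun x => (-1) * g x) (continuous_const.mul hg) n
  rw [perFourier_const_mul] at this
  simp only [neg_mul, one_mul, ← sub_eq_add_neg] at this
  rw [this]; push_cast; ring

theorem perFourier_neg (f : ℝ → ℝ) (n : ℤ) :
    perFourier L f (-n) = (starRingEnd ℂ) (perFourier L f n) := by
  simp only [perFourier_expo, map_mul, neg_neg]
  congr 1
  · simp
  · rw [← intervalIntegral.intervalIntegral_conj]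
    congr 1; funext x
    rw [expo_neg]; simp

theorem hasSum_sq_perFourier (hL : 0 < L) (hf : Continuous f) :
    HasSum (fun n => L * ‖perFourier L f n‖ ^ 2) (∫ x in (0 : ℝ)..L, f x ^ 2) := by
  have hc : Continuous fun x => (f x : ℂ) := Complex.continuous_ofReal.comp hf
  have hm : MemLp (fun x => (f x : ℂ)) 2 (volume.restrict (Ioc 0 L)) := by
    obtain ⟨C, hC⟩ := (isCompact_Icc (a := (0 : ℝ)) (b := L)).exists_bound_of_continuousOn
      hc.continuousOn
    refine MemLp.of_bound hc.aestronglyMeasurable C ?_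
    filter_upwards [ae_restrict_mem measurableSet_Ioc] with x hx
    exact hC x ⟨hx.1.le, hx.2⟩
  have h := (hasSum_sq_fourierCoeffOn hL hm).mul_left L
  simp only [← perFourier_eq_on, sub_zero, smul_eq_mul, Complex.norm_real, Real.norm_eq_abs,
    sq_abs] at h
  rwa [mul_inv_cancel_left₀ hL.ne'] at h

/-- Parseval's identity for the pairing of two continuous functions. -/
theorem hasSum_perFourier_mul (hL : 0 < L) (hf : Continuous f) (hg : Continuous g) :
    HasSum (fun n => L * ((starRingEnd ℂ) (perFourier L f n) * perFourier L g n).re)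
      (∫ x in (0 : ℝ)..L, f x * g x) := by
  have h1 := hasSum_sq_perFourier hL (hf.add hg)
  have h2 := hasSum_sq_perFourier hL (hf.sub hg)
  -- Polarization: fg = ((f + g)² - (f - g)²)/4 reduces the pairing to the quadratic identity.
  have h := (h1.sub h2).div_const 4
  have ha : (fun n => L * ((starRingEnd ℂ) (perFourier L f n) * perFourier L g n).re) =
      fun n => (L * ‖perFourier L (f + g) n‖ ^ 2 - L * ‖perFourier L (f - g) n‖ ^ 2) / 4 := by
    funext n
    rw [show (f + g) = fun x => f x + g x from rfl, show (f - g) = fun x => f x - g x from rfl,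
      perFourier_add hf hg, perFourier_sub hf hg, ← Complex.normSq_eq_norm_sq,
      ← Complex.normSq_eq_norm_sq]
    simp [Complex.normSq_apply]
    ring
  have hb : ∫ x in (0 : ℝ)..L, f x * g x = ((∫ x in (0 : ℝ)..L, (f + g) x ^ 2) -
      ∫ x in (0 : ℝ)..L, (f - g) x ^ 2) / 4 := by
    have e1 : Continuous fun x => (f + g) x ^ 2 := (hf.add hg).pow 2
    have e2 : Continuous fun x => (f - g) x ^ 2 := (hf.sub hg).pow 2
    rw [← intervalIntegral.integral_sub (e1.intervalIntegrable _ _) (e2.intervalIntegrable _ _),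
      ← intervalIntegral.integral_div]
    congr 1; funext x; simp; ring
  rw [ha, hb]
  exact h

theorem perFourier_deriv (hL : 0 < L) {f' : ℝ → ℝ} (hf : Function.Periodic f L)
    (hd : ∀ x, HasDerivAt f (f' x) x) (hf' : Continuous f') (n : ℤ) :
    perFourier L f' n = Complex.I * freq L n * perFourier L f n := by
  have hLc : (L : ℂ) ≠ 0 := by exact_mod_cast hL.ne'
  have hu : ∀ x ∈ Set.uIcc 0 L, HasDerivAt (fun x => (f x : ℂ)) (f' x : ℂ) x := fun x _ =>
    (hd x).ofReal_comp
  have hv : ∀ x ∈ Set.uIcc 0 L, HasDerivAt (fun x => expo L (-n) x)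
      (-(Complex.I * freq L n) * expo L (-n) x) x := fun x _ => by
    have h1 : HasDerivAt (fun y : ℝ => (2 * Real.pi * ((-n : ℤ) : ℂ) / L * Complex.I) * (y : ℂ))
        (2 * Real.pi * ((-n : ℤ) : ℂ) / L * Complex.I) x := by
      simpa using (Complex.ofRealCLM.hasDerivAt (x := x)).const_mul
        (2 * Real.pi * ((-n : ℤ) : ℂ) / L * Complex.I)
    have h2 := h1.cexp
    convert h2 using 1
    · funext y; rw [expo]; congr 1; ring
    · rw [mul_comm]; congr 1
      · rw [expo]; congr 1; ring
      · unfold freq; push_cast; ring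
  have hci : Continuous fun x => (f' x : ℂ) := Complex.continuous_ofReal.comp hf'
  have h := intervalIntegral.integral_deriv_mul_eq_sub hu hv (hci.intervalIntegrable _ _)
    ((continuous_const.mul (continuous_expo L (-n))).intervalIntegrable _ _)
  have h0 : f L = f 0 := by simpa using hf 0
  rw [expo_period hL, h0, show expo L (-n) 0 = 1 by simp [expo], sub_self,
    intervalIntegral.integral_add] at h
  · rw [perFourier_expo, perFourier_expo]
    have h3 : ∫ x in (0:ℝ)..L, (f x : ℂ) * (-(Complex.I * freq L n) * expo L (-n) x) =
        -(Complex.I * freq L n) * ∫ x in (0:ℝ)..L, (f x : ℂ) * expo L (-n) x := by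
      rw [← intervalIntegral.integral_const_mul]; congr 1; funext x; ring
    rw [h3] at h
    linear_combination (1 / (L : ℂ)) * h
  · exact (hci.mul (continuous_expo L _)).intervalIntegrable _ _
  · have hfc : Continuous f := continuous_iff_continuousAt.2 fun x => (hd x).continuousAt
    exact ((Complex.continuous_ofReal.comp hfc).mul
      (continuous_const.mul (continuous_expo L _))).intervalIntegrable _ _

theorem hasSum_perFourier_of_summable (hL : 0 < L) (hf : ContPer L f)
    (hs : Summable (perFourier L f)) (x : ℝ) :
    HasSum (fun n => perFourier L f n * expo L n x) (f x : ℂ) := by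
  have : Fact (0 < L) := ⟨hL⟩
  have hper : Function.Periodic (fun x => (f x : ℂ)) L := fun x => by simp only [hf.per x]
  let F : C(AddCircle L, ℂ) := ⟨hper.lift, by
    refine continuous_coinduced_dom.2 ?_
    exact Complex.continuous_ofReal.comp hf.cont⟩
  have hF : ∀ y : ℝ, F (y : AddCircle L) = (f y : ℂ) := fun y => hper.lift_coe y
  have hc : fourierCoeff F = perFourier L f := by
    funext n
    rw [fourierCoeff_eq_intervalIntegral _ _ 0, perFourier_expo, Complex.real_smul, zero_add]
    push_cast
    congr 2
    funext y
    rw [hF, fourier_eq_expo, smul_eq_mul, mul_comm]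
  have h := has_pointwise_sum_fourier_series_of_summable (f := F) (by rw [hc]; exact hs)
    (x : AddCircle L)
  rw [hc, hF] at h
  simpa only [smul_eq_mul, fourier_eq_expo] using h

end Fourier

end

/-! ### H¹_per as a Hilbert space of Fourier coefficients. -/

section

/-- The real Hilbert space of square summable sequences with `a (-n) = conj (a n)`. -/
def symSeq : Submodule ℝ (lp (fun _ : ℤ => ℂ) 2) where
  carrier := {a | ∀ n, a (-n) = (starRingEnd ℂ) (a n)}
  zero_mem' := fun n => by simp
  add_mem' := fun {a b} ha hb n => by
    have h1 := ha n
    have h2 := hb n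
    simp only [lp.coeFn_add, Pi.add_apply, map_add, h1, h2]
  smul_mem' := fun c a ha n => by
    have h1 := ha n
    simp only [lp.coeFn_smul, Pi.smul_apply, h1]
    simp

/-- The space `H¹_per` in Fourier coordinates, with the norm `(∫ u² + u_x²)^{1/2}`. -/
abbrev HSpace := ↥symSeq

theorem isClosed_symSeq : IsClosed (symSeq : Set (lp (fun _ : ℤ => ℂ) 2)) := by
  have hc : ∀ n : ℤ, Continuous fun a : lp (fun _ : ℤ => ℂ) 2 => a n := fun n => by
    have : LipschitzWith 1 fun a : lp (fun _ : ℤ => ℂ) 2 => a n := by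
      refine LipschitzWith.of_dist_le_mul fun a b => ?_
      rw [dist_eq_norm, dist_eq_norm, NNReal.coe_one, one_mul]
      exact lp.norm_apply_le_norm (by norm_num) (a - b) n
    exact this.continuous
  have : (symSeq : Set (lp (fun _ : ℤ => ℂ) 2)) =
      ⋂ n : ℤ, {a | a (-n) = (starRingEnd ℂ) (a n)} := by
    ext a; simp only [mem_iInter, mem_ofPred_eq]; rfl
  rw [this]
  exact isClosed_iInter fun n => isClosed_eq (hc _) (Complex.continuous_conj.comp (hc n))

instance : CompleteSpace HSpace := isClosed_symSeq.completeSpace_coe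

/-- The weights of the norm of `HSpace`. -/
def wt (L : ℝ) (n : ℤ) : ℝ := L * (1 + freq L n ^ 2)

/-- The Fourier coefficients of an element of `HSpace`. -/
def coef (L : ℝ) (a : HSpace) (n : ℤ) : ℂ := (a : lp (fun _ : ℤ => ℂ) 2) n / (√(wt L n) : ℝ)

/-- The `L`-periodic function represented by an element of `HSpace`. -/
def fn (L : ℝ) (a : HSpace) (x : ℝ) : ℝ := (∑' n, coef L a n * expo L n x).re

variable {L : ℝ}

theorem wt_pos (hL : 0 < L) (n : ℤ) : 0 < wt L n := by unfold wt; positivity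

theorem wt_neg (n : ℤ) : wt L (-n) = wt L n := by unfold wt freq; push_cast; ring

theorem coef_neg (a : HSpace) (n : ℤ) : coef L a (-n) = (starRingEnd ℂ) (coef L a n) := by
  unfold coef
  rw [wt_neg, a.2 n]; simp

theorem hasSum_inner (hL : 0 < L) (a b : HSpace) :
    HasSum (fun n => wt L n * ((starRingEnd ℂ) (coef L a n) * coef L b n).re) (inner ℝ a b) := by
  have h := lp.hasSum_inner (𝕜 := ℝ) (a : lp (fun _ : ℤ => ℂ) 2) (b : lp (fun _ : ℤ => ℂ) 2)
  rw [Submodule.coe_inner]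
  have he : (fun n => wt L n * ((starRingEnd ℂ) (coef L a n) * coef L b n).re) =
      fun n => inner ℝ ((a : lp (fun _ : ℤ => ℂ) 2) n) ((b : lp (fun _ : ℤ => ℂ) 2) n) := by
    funext n
    have hs : √(wt L n) ≠ 0 := (Real.sqrt_pos.2 (wt_pos hL n)).ne'
    have hw : wt L n = √(wt L n) * √(wt L n) := (Real.mul_self_sqrt (wt_pos hL n).le).symm
    rw [Complex.inner]
    simp only [coef, map_div₀, Complex.conj_ofReal]
    rw [div_mul_div_comm, ← Complex.ofReal_mul, ← hw, Complex.div_ofReal_re,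
      mul_div_cancel₀ _ (wt_pos hL n).ne', mul_comm]
  rw [he]
  exact h

theorem hasSum_norm_sq (hL : 0 < L) (a : HSpace) :
    HasSum (fun n => wt L n * ‖coef L a n‖ ^ 2) (‖a‖ ^ 2) := by
  rw [← real_inner_self_eq_norm_sq]
  convert hasSum_inner hL a a using 3 with n
  rw [mul_comm, Complex.mul_conj, Complex.ofReal_re, Complex.normSq_eq_norm_sq]

theorem coef_ext (hL : 0 < L) {a b : HSpace} (h : ∀ n, coef L a n = coef L b n) : a = b := by
  apply Subtype.ext
  apply lp.ext
  funext n
  have hs : ((√(wt L n) : ℝ) : ℂ) ≠ 0 := by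
    exact_mod_cast (Real.sqrt_pos.2 (wt_pos hL n)).ne'
  have := h n
  unfold coef at this
  field_simp at this
  exact this

theorem coef_add (a b : HSpace) (n : ℤ) : coef L (a + b) n = coef L a n + coef L b n := by
  simp [coef, add_div]

theorem coef_sub (a b : HSpace) (n : ℤ) : coef L (a - b) n = coef L a n - coef L b n := by
  simp [coef, sub_div]

theorem coef_smul (c : ℝ) (a : HSpace) (n : ℤ) : coef L (c • a) n = c * coef L a n := by
  simp [coef, mul_div_assoc]

theorem summable_inv_wt (hL : 0 < L) : Summable fun n => (wt L n)⁻¹ := by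
  have h : Summable fun n : ℤ => (L / (2 * Real.pi) ^ 2) * (1 / (n : ℝ) ^ 2) :=
    (Real.summable_one_div_int_pow.2 (by norm_num)).mul_left _
  refine h.of_norm_bounded_eventually ?_
  have : {(0 : ℤ)}ᶜ ∈ (cofinite : Filter ℤ) := (Set.finite_singleton 0).compl_mem_cofinite
  filter_upwards [this] with n hn
  have hn : (n : ℝ) ≠ 0 := by exact_mod_cast hn
  rw [Real.norm_of_nonneg (inv_nonneg.2 (wt_pos hL n).le), div_mul_div_comm, mul_one,
    inv_eq_one_div, div_le_div_iff₀ (wt_pos hL n) (by positivity)]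
  unfold wt freq
  have : L * (L * (1 + (2 * Real.pi * n / L) ^ 2)) = L ^ 2 + (2 * Real.pi) ^ 2 * n ^ 2 := by
    field_simp
  nlinarith [sq_nonneg L]

/-- A constant of the embedding of `HSpace` into the continuous functions. -/
def supConst (L : ℝ) : ℝ := (1 + ∑' n, (wt L n)⁻¹) / 2

theorem supConst_pos (hL : 0 < L) : 0 < supConst L := by
  have : 0 ≤ ∑' n, (wt L n)⁻¹ := tsum_nonneg fun n => inv_nonneg.2 (wt_pos hL n).le
  unfold supConst; linarith

/-- Young's inequality with a free parameter. Summed over n with t = ‖a‖⁻¹ it gives the embedding of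
H¹ into absolutely convergent Fourier series. -/
theorem norm_coef_le (hL : 0 < L) (a : HSpace) (n : ℤ) {t : ℝ} (ht : 0 < t) :
    ‖coef L a n‖ ≤ (t * (wt L n * ‖coef L a n‖ ^ 2) + t⁻¹ * (wt L n)⁻¹) / 2 := by
  have hw := wt_pos hL n
  have h : t * (wt L n * ‖coef L a n‖ ^ 2) + t⁻¹ * (wt L n)⁻¹ - 2 * ‖coef L a n‖ =
      (t * wt L n * ‖coef L a n‖ - 1) ^ 2 * (t⁻¹ * (wt L n)⁻¹) := by
    field_simp
    ring
  have h2 : 0 ≤ (t * wt L n * ‖coef L a n‖ - 1) ^ 2 * (t⁻¹ * (wt L n)⁻¹) := by positivity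
  linarith

theorem summable_norm_coef (hL : 0 < L) (a : HSpace) : Summable fun n => ‖coef L a n‖ := by
  refine Summable.of_nonneg_of_le (fun _ => norm_nonneg _)
    (fun n => norm_coef_le hL a n one_pos) ?_
  exact (((hasSum_norm_sq hL a).summable.mul_left 1).add
    ((summable_inv_wt hL).mul_left _)).div_const 2

theorem tsum_norm_coef_le (hL : 0 < L) (a : HSpace) :
    ∑' n, ‖coef L a n‖ ≤ supConst L * ‖a‖ := by
  by_cases ha : a = 0
  · simp [ha, coef]
  have hn : 0 < ‖a‖ := norm_pos_iff.2 ha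
  have hs := (((hasSum_norm_sq hL a).mul_left ‖a‖⁻¹).add
    ((summable_inv_wt hL).hasSum.mul_left (‖a‖⁻¹)⁻¹)).div_const 2
  have := hasSum_le (fun n => norm_coef_le hL a n (inv_pos.2 hn))
    (summable_norm_coef hL a).hasSum hs
  refine this.trans (le_of_eq ?_)
  unfold supConst
  field_simp

theorem summable_coef_mul_expo (hL : 0 < L) (a : HSpace) (x : ℝ) :
    Summable fun n => coef L a n * expo L n x := by
  refine Summable.of_norm ?_
  simpa only [norm_mul, norm_expo, mul_one] using summable_norm_coef hL a

theorem hasSum_fn (hL : 0 < L) (a : HSpace) (x : ℝ) :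
    HasSum (fun n => coef L a n * expo L n x) (fn L a x : ℂ) := by
  have h := (summable_coef_mul_expo hL a x).hasSum
  have hr : (starRingEnd ℂ) (∑' n, coef L a n * expo L n x) = ∑' n, coef L a n * expo L n x := by
    rw [Complex.conj_tsum, ← (Equiv.neg ℤ).tsum_eq]
    refine tsum_congr fun n => ?_
    rw [Equiv.neg_apply, coef_neg, expo_neg]
    simp
  rw [fn, Complex.conj_eq_iff_re.1 hr]
  exact h

theorem fn_eq_of_hasSum (hL : 0 < L) {a : HSpace} {x y : ℝ}
    (h : HasSum (fun n => coef L a n * expo L n x) (y : ℂ)) : fn L a x = y := by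
  exact_mod_cast (hasSum_fn hL a x).unique h

theorem abs_fn_le (hL : 0 < L) (a : HSpace) (x : ℝ) : |fn L a x| ≤ supConst L * ‖a‖ := by
  refine le_trans ?_ (tsum_norm_coef_le hL a)
  refine (Complex.abs_re_le_norm _).trans ?_
  refine (norm_tsum_le_tsum_norm ?_).trans (le_of_eq ?_)
  · simpa only [norm_mul, norm_expo, mul_one] using summable_norm_coef hL a
  · simp only [norm_mul, norm_expo, mul_one]

theorem fn_add (hL : 0 < L) (a b : HSpace) (x : ℝ) : fn L (a + b) x = fn L a x + fn L b x := by
  refine fn_eq_of_hasSum hL ?_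
  push_cast
  simpa only [coef_add, add_mul] using (hasSum_fn hL a x).add (hasSum_fn hL b x)

theorem fn_smul (hL : 0 < L) (c : ℝ) (a : HSpace) (x : ℝ) : fn L (c • a) x = c * fn L a x := by
  refine fn_eq_of_hasSum hL ?_
  push_cast
  simpa only [coef_smul, mul_assoc] using (hasSum_fn hL a x).mul_left (c : ℂ)

theorem fn_sub (hL : 0 < L) (a b : HSpace) (x : ℝ) : fn L (a - b) x = fn L a x - fn L b x := by
  refine fn_eq_of_hasSum hL ?_
  push_cast
  simpa only [coef_sub, sub_mul] using (hasSum_fn hL a x).sub (hasSum_fn hL b x)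

/-- Evaluation at a point, as a bounded functional on `HSpace`. -/
def evalCLM (hL : 0 < L) (x : ℝ) : HSpace →L[ℝ] ℝ :=
  LinearMap.mkContinuous
    { toFun := fun a => fn L a x
      map_add' := fun a b => fn_add hL a b x
      map_smul' := fun c a => fn_smul hL c a x } (supConst L) fun a => abs_fn_le hL a x

theorem evalCLM_apply (hL : 0 < L) (x : ℝ) (a : HSpace) : evalCLM hL x a = fn L a x := rfl

theorem contPer_fn (hL : 0 < L) (a : HSpace) : ContPer L (fn L a) := by
  constructor
  · refine Complex.continuous_re.comp (continuous_tsum (u := fun n => ‖coef L a n‖)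
      (fun n => continuous_const.mul (continuous_expo L n)) (summable_norm_coef hL a) fun n x => ?_)
    rw [norm_mul, norm_expo, mul_one]
  · intro x
    simp only [fn, expo_add, expo_period hL, mul_one]

theorem integral_expo (hL : 0 < L) (n : ℤ) :
    ∫ x in (0 : ℝ)..L, expo L n x = if n = 0 then (L : ℂ) else 0 := by
  split_ifs with h
  · subst h; simp [expo]
  · have hLc : (L : ℂ) ≠ 0 := by exact_mod_cast hL.ne'
    have hn : (n : ℂ) ≠ 0 := by exact_mod_cast h
    have hc : (2 * Real.pi * n / L * Complex.I : ℂ) ≠ 0 := by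
      have : (Real.pi : ℂ) ≠ 0 := by exact_mod_cast Real.pi_ne_zero
      simp [hLc, hn, this]
    have := integral_exp_mul_complex (a := 0) (b := L) hc
    have he : ∀ x : ℝ, expo L n x = Complex.exp (2 * Real.pi * n / L * Complex.I * x) := fun x => by
      rw [expo]; congr 1; ring
    simp only [he, this]
    rw [← he L, expo_period hL]
    simp

theorem perFourier_fn (hL : 0 < L) (a : HSpace) (n : ℤ) : perFourier L (fn L a) n = coef L a n := by
  have hLc : (L : ℂ) ≠ 0 := by exact_mod_cast hL.ne'
  have h : HasSum (fun m => ∫ x in (0 : ℝ)..L, coef L a m * expo L m x * expo L (-n) x)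
      (∫ x in (0 : ℝ)..L, (fn L a x : ℂ) * expo L (-n) x) := by
    refine intervalIntegral.hasSum_integral_of_dominated_convergence
      (fun m _ => ‖coef L a m‖) (fun m => ?_) (fun m => ?_) ?_ ?_ ?_
    · exact ((continuous_const.mul (continuous_expo L m)).mul
        (continuous_expo L _)).aestronglyMeasurable
    · exact Eventually.of_forall fun x _ => by simp [norm_expo]
    · exact Eventually.of_forall fun x _ => summable_norm_coef hL a
    · exact intervalIntegrable_const
    · exact Eventually.of_forall fun x _ => (hasSum_fn hL a x).mul_right _
  have he : ∀ m, ∫ x in (0 : ℝ)..L, coef L a m * expo L m x * expo L (-n) x =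
      if m = n then coef L a n * L else 0 := fun m => by
    have h1 : ∀ x, coef L a m * expo L m x * expo L (-n) x = coef L a m * expo L (m - n) x :=
      fun x => by
        rw [mul_assoc, expo, expo, expo, ← Complex.exp_add]; congr 2; push_cast; ring
    simp only [h1, intervalIntegral.integral_const_mul, integral_expo hL, sub_eq_zero]
    split_ifs with hmn
    · rw [hmn]
    · simp
  simp only [he] at h
  have h2 := (hasSum_ite_eq n (coef L a n * L)).unique h
  rw [perFourier_expo, ← h2]
  field_simp

theorem fn_injective (hL : 0 < L) {a b : HSpace} (h : fn L a = fn L b) : a = b :=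
  coef_ext hL fun n => by rw [← perFourier_fn hL, ← perFourier_fn hL, h]

/-- The element of `HSpace` with given Fourier coefficients. -/
def ofCoef (L : ℝ) (b : ℤ → ℂ) : HSpace :=
  open Classical in
  if h : Memℓp (fun n => ((√(wt L n) : ℝ) : ℂ) * b n) 2 ∧ ∀ n, b (-n) = (starRingEnd ℂ) (b n) then
    ⟨⟨fun n => ((√(wt L n) : ℝ) : ℂ) * b n, h.1⟩, fun n => by
      show ((√(wt L (-n)) : ℝ) : ℂ) * b (-n) = (starRingEnd ℂ) (((√(wt L n) : ℝ) : ℂ) * b n)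
      rw [wt_neg, h.2 n]; simp⟩
  -- The default value makes `toH`, `bbmH` and `shift` total. Both conditions are discharged once,
  -- in `coef_ofCoef`.
  else 0

theorem coef_ofCoef (hL : 0 < L) {b : ℤ → ℂ} (hs : Summable fun n => wt L n * ‖b n‖ ^ 2)
    (hb : ∀ n, b (-n) = (starRingEnd ℂ) (b n)) (n : ℤ) : coef L (ofCoef L b) n = b n := by
  have hm : Memℓp (fun n => ((√(wt L n) : ℝ) : ℂ) * b n) 2 := by
    refine memℓp_gen ?_
    convert hs using 2 with n
    rw [norm_mul, Complex.norm_real, Real.norm_of_nonneg (Real.sqrt_nonneg _)]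
    simp only [ENNReal.toReal_ofNat, Real.rpow_ofNat]
    rw [mul_pow, Real.sq_sqrt (wt_pos hL _).le]
  have hw : ((√(wt L n) : ℝ) : ℂ) ≠ 0 := by
    exact_mod_cast (Real.sqrt_pos.2 (wt_pos hL n)).ne'
  rw [ofCoef, dif_pos ⟨hm, hb⟩]
  simp only [coef]
  field_simp

/-- Continuous periodic functions with square integrable weak derivative. -/
structure HasH1 (L : ℝ) (f : ℝ → ℝ) : Prop extends ContPer L f where
  summable : Summable fun n => wt L n * ‖perFourier L f n‖ ^ 2

/-- The element of `HSpace` that represents a function. -/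
def toH (L : ℝ) (f : ℝ → ℝ) : HSpace := ofCoef L (perFourier L f)

theorem coef_toH (hL : 0 < L) {f : ℝ → ℝ} (hf : HasH1 L f) (n : ℤ) :
    coef L (toH L f) n = perFourier L f n :=
  coef_ofCoef hL hf.summable (perFourier_neg f) n

theorem hasH1_fn (hL : 0 < L) (a : HSpace) : HasH1 L (fn L a) :=
  ⟨contPer_fn hL a, by simpa only [perFourier_fn hL] using (hasSum_norm_sq hL a).summable⟩

/-- Finite H¹ norm makes the Fourier coefficients absolutely summable, so the series converges at
every point to the continuous function f. The identification with `HSpace` is therefore pointwise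
and not only almost everywhere. -/
theorem fn_toH (hL : 0 < L) {f : ℝ → ℝ} (hf : HasH1 L f) : fn L (toH L f) = f := by
  funext x
  refine fn_eq_of_hasSum hL ?_
  have hs : Summable (perFourier L f) := by
    refine Summable.of_norm ?_
    simpa only [coef_toH hL hf] using summable_norm_coef hL (toH L f)
  simpa only [coef_toH hL hf] using hasSum_perFourier_of_summable hL hf.toContPer hs x

theorem toH_fn (hL : 0 < L) (a : HSpace) : toH L (fn L a) = a :=
  fn_injective hL (fn_toH hL (hasH1_fn hL a))

/-- A continuously differentiable periodic function with derivative `f'`. -/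
structure C1Per (L : ℝ) (f f' : ℝ → ℝ) : Prop where
  per : Function.Periodic f L
  deriv : ∀ x, HasDerivAt f (f' x) x
  cont_deriv : Continuous f'

namespace C1Per

variable {f f' g g' : ℝ → ℝ}

theorem contPer (h : C1Per L f f') : ContPer L f :=
  ⟨continuous_iff_continuousAt.2 fun x => (h.deriv x).continuousAt, h.per⟩

theorem per_deriv (h : C1Per L f f') : Function.Periodic f' L := fun x => by
  have h1 := (h.deriv (x + L)).comp_add_const x L
  have h2 : (fun y => f (y + L)) = f := funext h.per
  rw [h2] at h1
  exact h1.unique (h.deriv x)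

theorem contPer_deriv (h : C1Per L f f') : ContPer L f' := ⟨h.cont_deriv, h.per_deriv⟩

theorem wt_mul (hL : 0 < L) (h : C1Per L f f') (n : ℤ) :
    wt L n * ‖perFourier L f n‖ ^ 2 =
      L * ‖perFourier L f n‖ ^ 2 + L * ‖perFourier L f' n‖ ^ 2 := by
  rw [perFourier_deriv hL h.per h.deriv h.cont_deriv, norm_mul, norm_mul, Complex.norm_I,
    Complex.norm_real, wt, Real.norm_eq_abs]
  rw [one_mul, mul_pow, sq_abs]; ring

theorem hasSum (hL : 0 < L) (h : C1Per L f f') :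
    HasSum (fun n => wt L n * ‖perFourier L f n‖ ^ 2)
      ((∫ x in (0 : ℝ)..L, f x ^ 2) + ∫ x in (0 : ℝ)..L, f' x ^ 2) := by
  simp only [h.wt_mul hL]
  exact (hasSum_sq_perFourier hL h.contPer.cont).add (hasSum_sq_perFourier hL h.cont_deriv)

theorem hasH1 (hL : 0 < L) (h : C1Per L f f') : HasH1 L f := ⟨h.contPer, (h.hasSum hL).summable⟩

theorem norm_sq (hL : 0 < L) (h : C1Per L f f') :
    ‖toH L f‖ ^ 2 = (∫ x in (0 : ℝ)..L, f x ^ 2) + ∫ x in (0 : ℝ)..L, f' x ^ 2 := by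
  refine (hasSum_norm_sq hL _).unique ?_
  simpa only [coef_toH hL (h.hasH1 hL)] using h.hasSum hL

/-- The inner product of `HSpace` against a function of class `C²`. -/
theorem inner_toH (hL : 0 < L) {f'' : ℝ → ℝ} (h : C1Per L f f') (h' : C1Per L f' f'')
    (a : HSpace) :
    inner ℝ a (toH L f) = ∫ x in (0 : ℝ)..L, fn L a x * (f x - f'' x) := by
  refine (hasSum_inner hL _ _).unique ?_
  have := hasSum_perFourier_mul hL (contPer_fn hL a).cont
    (h.contPer.cont.sub h'.cont_deriv)
  rw [show (f - f'') = fun x => f x - f'' x from rfl] at this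
  convert this using 2 with n
  rw [perFourier_sub h.contPer.cont h'.cont_deriv,
    perFourier_deriv hL h'.per h'.deriv h'.cont_deriv,
    perFourier_deriv hL h.per h.deriv h.cont_deriv, coef_toH hL (h.hasH1 hL), perFourier_fn hL, wt]
  -- On the Fourier side 1 - ∂ₓ² is multiplication by 1 + ξ², which is the weight of the norm
  -- divided by L.
  have : (starRingEnd ℂ) (coef L a n) * (perFourier L f n -
      Complex.I * freq L n * (Complex.I * freq L n * perFourier L f n)) =
      ((1 + freq L n ^ 2 : ℝ) : ℂ) * ((starRingEnd ℂ) (coef L a n) * perFourier L f n) := by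
    push_cast
    linear_combination (-(starRingEnd ℂ) (coef L a n) * freq L n ^ 2 * perFourier L f n) *
      Complex.I_sq
  rw [this, Complex.re_ofReal_mul]; ring

end C1Per

end

section

variable {L : ℝ} {f g w : ℝ → ℝ}

/-! ### The operator `-(1 - ∂ₓ²)⁻¹ ∂ₓ` -/

/-- The symbol of `-(1 - ∂ₓ²)⁻¹ ∂ₓ`. -/
def bbmSymbol (L : ℝ) (n : ℤ) : ℂ :=
  -Complex.I * (2 * Real.pi * n / L) / (1 + (2 * Real.pi * n / L) ^ 2)

theorem bbmSymbol_eq (L : ℝ) (n : ℤ) :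
    bbmSymbol L n = ((freq L n / (1 + freq L n ^ 2) : ℝ) : ℂ) * -Complex.I := by
  unfold bbmSymbol freq; push_cast; ring

/-- The bound is ξ²/(1 + ξ²) ≤ 1: the operator maps L² into H¹, which is why the equation is an
ordinary differential equation in H¹. -/
theorem norm_bbmSymbol_sq_mul_wt (hL : 0 < L) (n : ℤ) : wt L n * ‖bbmSymbol L n‖ ^ 2 ≤ L := by
  rw [bbmSymbol_eq, norm_mul, Complex.norm_real, norm_neg, Complex.norm_I, mul_one,
    Real.norm_eq_abs, sq_abs, div_pow, wt]
  have h : 0 < 1 + freq L n ^ 2 := by positivity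
  rw [mul_div_assoc', div_le_iff₀ (by positivity)]
  nlinarith [mul_pos hL h]

/-- The element `-(1 - ∂ₓ²)⁻¹ ∂ₓ w` of `HSpace`. -/
def bbmH (L : ℝ) (w : ℝ → ℝ) : HSpace := ofCoef L fun n => bbmSymbol L n * perFourier L w n

theorem wt_mul_bbm_le (hL : 0 < L) (w : ℝ → ℝ) (n : ℤ) :
    wt L n * ‖bbmSymbol L n * perFourier L w n‖ ^ 2 ≤ L * ‖perFourier L w n‖ ^ 2 := by
  rw [norm_mul, mul_pow, ← mul_assoc]
  exact mul_le_mul_of_nonneg_right (norm_bbmSymbol_sq_mul_wt hL n) (sq_nonneg _)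

theorem coef_bbmH (hL : 0 < L) (hw : Continuous w) (n : ℤ) :
    coef L (bbmH L w) n = bbmSymbol L n * perFourier L w n := by
  refine coef_ofCoef hL (b := fun n => bbmSymbol L n * perFourier L w n) ?_ (fun n => ?_) n
  · exact Summable.of_nonneg_of_le (fun n => mul_nonneg (wt_pos hL n).le (sq_nonneg _))
      (wt_mul_bbm_le hL w) (hasSum_sq_perFourier hL hw).summable
  · rw [perFourier_neg, bbmSymbol_eq, bbmSymbol_eq]
    simp only [map_mul, Complex.conj_ofReal, map_neg, Complex.conj_I, freq]
    push_cast
    ring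

theorem norm_bbmH_sq_le (hL : 0 < L) (hw : Continuous w) :
    ‖bbmH L w‖ ^ 2 ≤ ∫ x in (0 : ℝ)..L, w x ^ 2 := by
  have h := hasSum_norm_sq hL (bbmH L w)
  simp only [coef_bbmH hL hw] at h
  exact hasSum_le (wt_mul_bbm_le hL w) h (hasSum_sq_perFourier hL hw)

theorem bbmH_sub (hL : 0 < L) (hf : Continuous f) (hg : Continuous g) :
    bbmH L (fun x => f x - g x) = bbmH L f - bbmH L g := by
  refine coef_ext hL fun n => ?_
  rw [coef_sub, coef_bbmH hL (w := fun x => f x - g x) (hf.sub hg), coef_bbmH hL hf, coef_bbmH hL hg,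
    perFourier_sub hf hg]
  ring

theorem norm_bbmH_le (hL : 0 < L) (hw : Continuous w) {C : ℝ} (hC : ∀ x, |w x| ≤ C) :
    ‖bbmH L w‖ ≤ √L * C := by
  have hC0 : 0 ≤ C := (abs_nonneg _).trans (hC 0)
  have h : ∫ x in (0 : ℝ)..L, w x ^ 2 ≤ ∫ _ in (0 : ℝ)..L, C ^ 2 := by
    refine intervalIntegral.integral_mono_on hL.le ((hw.pow 2).intervalIntegrable _ _)
      intervalIntegrable_const fun x _ => ?_
    rw [← sq_abs]
    exact pow_le_pow_left₀ (abs_nonneg _) (hC x) 2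
  rw [intervalIntegral.integral_const, sub_zero, smul_eq_mul] at h
  refine abs_le_of_sq_le_sq' ?_ (by positivity) |>.2
  rw [mul_pow, Real.sq_sqrt hL.le]
  exact (norm_bbmH_sq_le hL hw).trans h

theorem fn_bbmH (hL : 0 < L) (hw : Continuous w) (x : ℝ) :
    (fn L (bbmH L w) x : ℂ) = bbmOp L w x := by
  rw [← (hasSum_fn hL (bbmH L w) x).tsum_eq]
  simp only [coef_bbmH hL hw]
  rfl

/-- The factor (1 + ξ²)⁻¹ of the symbol cancels the weight of the inner product. What remains is
-∂ₓ, which moves to the second argument with a change of sign. -/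
theorem inner_bbmH_toH (hL : 0 < L) (hw : Continuous w) {f' : ℝ → ℝ} (hf : C1Per L f f') :
    inner ℝ (bbmH L w) (toH L f) = ∫ x in (0 : ℝ)..L, w x * f' x := by
  refine (hasSum_inner hL _ _).unique ?_
  convert hasSum_perFourier_mul hL hw hf.cont_deriv using 2 with n
  rw [coef_bbmH hL hw, coef_toH hL (hf.hasH1 hL),
    perFourier_deriv hL hf.per hf.deriv hf.cont_deriv, bbmSymbol_eq, wt]
  have h : (1 + freq L n ^ 2) ≠ 0 := by positivity
  have : (starRingEnd ℂ) (((freq L n / (1 + freq L n ^ 2) : ℝ) : ℂ) * -Complex.I *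
      perFourier L w n) * perFourier L f n = (((1 + freq L n ^ 2)⁻¹ : ℝ) : ℂ) *
      ((starRingEnd ℂ) (perFourier L w n) * (Complex.I * freq L n * perFourier L f n)) := by
    simp only [map_mul, Complex.conj_ofReal, map_neg, Complex.conj_I]
    push_cast
    ring
  rw [this, Complex.re_ofReal_mul]
  field_simp

/-- The symbol is purely imaginary, so every term of Parseval's series has zero real part. Applied
to the flux, this is conservation of energy. -/
theorem integral_mul_bbmH (hL : 0 < L) (hw : Continuous w) :
    ∫ x in (0 : ℝ)..L, w x * fn L (bbmH L w) x = 0 := by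
  refine (hasSum_perFourier_mul hL hw (contPer_fn hL _).cont).unique ?_
  convert hasSum_zero using 1
  funext n
  rw [perFourier_fn hL, coef_bbmH hL hw, bbmSymbol_eq]
  have : (starRingEnd ℂ) (perFourier L w n) *
      (((freq L n / (1 + freq L n ^ 2) : ℝ) : ℂ) * -Complex.I * perFourier L w n) =
      ((freq L n / (1 + freq L n ^ 2) * Complex.normSq (perFourier L w n) : ℝ) : ℂ) *
        -Complex.I := by
    push_cast
    rw [← Complex.mul_conj]; ring
  rw [this, Complex.re_ofReal_mul]
  simp

theorem integral_eq_perFourier (hL : 0 < L) (f : ℝ → ℝ) :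
    ((∫ x in (0 : ℝ)..L, f x : ℝ) : ℂ) = L * perFourier L f 0 := by
  have hLc : (L : ℂ) ≠ 0 := by exact_mod_cast hL.ne'
  rw [perFourier_expo, ← intervalIntegral.integral_ofReal]
  simp [expo]
  field_simp

/-- The symbol vanishes at frequency zero. This is conservation of mass. -/
theorem integral_bbmH (hL : 0 < L) (hw : Continuous w) :
    ∫ x in (0 : ℝ)..L, fn L (bbmH L w) x = 0 := by
  have h := integral_eq_perFourier hL (fn L (bbmH L w))
  rw [perFourier_fn hL, coef_bbmH hL hw, bbmSymbol_eq, freq] at h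
  have h2 : ((∫ x in (0 : ℝ)..L, fn L (bbmH L w) x : ℝ) : ℂ) = 0 := by rw [h]; simp
  exact_mod_cast h2

/-! ### Translations -/

/-- The translation `u ↦ u (· + r)` on `HSpace`. -/
def shift (L : ℝ) (r : ℝ) (a : HSpace) : HSpace := ofCoef L fun n => expo L n r * coef L a n

theorem coef_shift (hL : 0 < L) (r : ℝ) (a : HSpace) (n : ℤ) :
    coef L (shift L r a) n = expo L n r * coef L a n := by
  refine coef_ofCoef hL (b := fun n => expo L n r * coef L a n) ?_ (fun n => ?_) n
  · simpa only [norm_mul, norm_expo, one_mul] using (hasSum_norm_sq hL a).summable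
  · rw [coef_neg, expo_neg, map_mul]

theorem fn_shift (hL : 0 < L) (r : ℝ) (a : HSpace) (x : ℝ) :
    fn L (shift L r a) x = fn L a (x + r) := by
  refine fn_eq_of_hasSum hL ?_
  convert hasSum_fn hL a (x + r) using 2 with n
  rw [coef_shift hL, expo_add]; ring

theorem norm_shift (hL : 0 < L) (r : ℝ) (a : HSpace) : ‖shift L r a‖ = ‖a‖ := by
  have h := hasSum_norm_sq hL (shift L r a)
  simp only [coef_shift hL, norm_mul, norm_expo, one_mul] at h
  exact (pow_left_inj₀ (norm_nonneg _) (norm_nonneg _) two_ne_zero).1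
    (h.unique (hasSum_norm_sq hL a))

theorem shift_sub (hL : 0 < L) (r : ℝ) (a b : HSpace) :
    shift L r (a - b) = shift L r a - shift L r b := by
  refine coef_ext hL fun n => ?_
  simp only [coef_shift hL, coef_sub]; ring

theorem shift_shift (hL : 0 < L) (r s : ℝ) (a : HSpace) :
    shift L r (shift L s a) = shift L (r + s) a := by
  refine fn_injective hL (funext fun x => ?_)
  simp only [fn_shift hL, add_assoc]

theorem shift_zero (hL : 0 < L) (a : HSpace) : shift L 0 a = a := by
  refine fn_injective hL (funext fun x => ?_)
  simp only [fn_shift hL, add_zero]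

/-! ### Comparison with the norm of the frozen definitions -/

theorem h1Norm_of_summable (hL : 0 < L)
    (hs : Summable fun n : ℤ => (1 + (n : ℝ) ^ 2) * ‖perFourier L f n‖ ^ 2) :
    h1Norm L f =
      ENNReal.ofReal √(L * ∑' n : ℤ, (1 + (n : ℝ) ^ 2) * ‖perFourier L f n‖ ^ 2) := by
  rw [h1Norm, ← ENNReal.ofReal_tsum_of_nonneg (fun n => by positivity) hs,
    ← ENNReal.ofReal_mul hL.le, ENNReal.ofReal_rpow_of_nonneg _ (by norm_num), Real.sqrt_eq_rpow]
  exact mul_nonneg hL.le (tsum_nonneg fun n => by positivity)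

/-- The constant of the comparison of the two norms of `H¹_per`. -/
def normConst (L : ℝ) : ℝ := 1 + (2 * Real.pi / L) ^ 2 + (L / (2 * Real.pi)) ^ 2

theorem normConst_pos (L : ℝ) : 0 < normConst L := by unfold normConst; positivity

theorem wt_le (hL : 0 < L) (n : ℤ) : wt L n ≤ normConst L * (L * (1 + (n : ℝ) ^ 2)) := by
  have : freq L n ^ 2 = (2 * Real.pi / L) ^ 2 * n ^ 2 := by unfold freq; ring
  rw [wt, this, normConst]
  have h1 : 0 ≤ (2 * Real.pi / L) ^ 2 := sq_nonneg _
  have h2 : 0 ≤ (L / (2 * Real.pi)) ^ 2 := sq_nonneg _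
  have h3 : 0 ≤ (n : ℝ) ^ 2 := sq_nonneg _
  rw [mul_left_comm]
  refine mul_le_mul_of_nonneg_left ?_ hL.le
  nlinarith [mul_nonneg h1 h3, mul_nonneg h2 h3]

theorem le_wt (hL : 0 < L) (n : ℤ) : L * (1 + (n : ℝ) ^ 2) ≤ normConst L * wt L n := by
  have hpi := Real.pi_pos
  have : (L / (2 * Real.pi)) ^ 2 * freq L n ^ 2 = n ^ 2 := by unfold freq; field_simp
  rw [wt, normConst]
  have h1 : 0 ≤ (2 * Real.pi / L) ^ 2 := sq_nonneg _
  have h2 : 0 ≤ (L / (2 * Real.pi)) ^ 2 := sq_nonneg _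
  have h3 : 0 ≤ freq L n ^ 2 := sq_nonneg _
  rw [mul_left_comm]
  refine mul_le_mul_of_nonneg_left ?_ hL.le
  nlinarith [mul_nonneg h1 h3, mul_nonneg h2 h3]

theorem summable_sobolev (hL : 0 < L) (hf : HasH1 L f) :
    Summable fun n : ℤ => (1 + (n : ℝ) ^ 2) * ‖perFourier L f n‖ ^ 2 := by
  refine Summable.of_nonneg_of_le (fun n => by positivity) (fun n => ?_)
    (hf.summable.mul_left (normConst L / L))
  have := mul_le_mul_of_nonneg_right (le_wt hL n) (sq_nonneg ‖perFourier L f n‖)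
  rw [div_mul_eq_mul_div, le_div_iff₀ hL]
  linarith

theorem h1Norm_fn_le (hL : 0 < L) (a : HSpace) :
    h1Norm L (fn L a) ≤ ENNReal.ofReal (√(normConst L) * ‖a‖) := by
  have hs := summable_sobolev hL (hasH1_fn hL a)
  rw [h1Norm_of_summable hL hs]
  refine ENNReal.ofReal_le_ofReal ?_
  rw [← Real.sqrt_sq (norm_nonneg a), ← Real.sqrt_mul (normConst_pos L).le]
  refine Real.sqrt_le_sqrt ?_
  have h := (hasSum_norm_sq hL a).mul_left (normConst L)
  refine hasSum_le (fun n => ?_) (hs.hasSum.mul_left L) h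
  have := mul_le_mul_of_nonneg_right (le_wt hL n) (sq_nonneg ‖perFourier L (fn L a) n‖)
  rw [← perFourier_fn hL]
  linarith

theorem ofReal_norm_le (hL : 0 < L) (a : HSpace) :
    ENNReal.ofReal ‖a‖ ≤ ENNReal.ofReal √(normConst L) * h1Norm L (fn L a) := by
  have hs := summable_sobolev hL (hasH1_fn hL a)
  rw [h1Norm_of_summable hL hs, ← ENNReal.ofReal_mul (Real.sqrt_nonneg _)]
  refine ENNReal.ofReal_le_ofReal ?_
  rw [← Real.sqrt_sq (norm_nonneg a), ← Real.sqrt_mul (normConst_pos L).le]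
  refine Real.sqrt_le_sqrt ?_
  refine hasSum_le (fun n => ?_) (hasSum_norm_sq hL a)
    ((hs.hasSum.mul_left L).mul_left (normConst L))
  have := mul_le_mul_of_nonneg_right (wt_le hL n) (sq_nonneg ‖perFourier L (fn L a) n‖)
  rw [← perFourier_fn hL]
  linarith

theorem hasH1_of_mem (hL : 0 < L) (hf : f ∈ H1per L) : HasH1 L f := by
  obtain ⟨hc, hp, hn⟩ := hf
  refine ⟨⟨hc, hp⟩, ?_⟩
  have h1 : ∑' n : ℤ, ENNReal.ofReal ((1 + (n : ℝ) ^ 2) * ‖perFourier L f n‖ ^ 2) ≠ ⊤ := by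
    intro h
    rw [h1Norm, h, ENNReal.mul_top (by simpa using hL), ENNReal.top_rpow_of_pos (by norm_num)] at hn
    exact lt_irrefl _ hn
  have h2 := ENNReal.summable_toReal h1
  refine Summable.of_nonneg_of_le (fun n => mul_nonneg (wt_pos hL n).le (sq_nonneg _))
    (fun n => ?_) (h2.mul_left (normConst L * L))
  rw [ENNReal.toReal_ofReal (by positivity)]
  have := mul_le_mul_of_nonneg_right (wt_le hL n) (sq_nonneg ‖perFourier L f n‖)
  linarith

theorem fn_mem_H1per (hL : 0 < L) (a : HSpace) : fn L a ∈ H1per L :=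
  ⟨(contPer_fn hL a).cont, (contPer_fn hL a).per,
    (h1Norm_fn_le hL a).trans_lt ENNReal.ofReal_lt_top⟩

/-! ### Density of smooth functions -/

theorem C1Per.const_smul {f' : ℝ → ℝ} (h : C1Per L f f') (c : ℝ) :
    C1Per L (fun x => c * f x) fun x => c * f' x :=
  ⟨(h.contPer.const_mul c).per, fun x => (h.deriv x).const_mul c, continuous_const.mul h.cont_deriv⟩

/-- The elements of `HSpace` that represent functions of class `C¹`. -/
def smoothH (hL : 0 < L) : Submodule ℝ HSpace where
  carrier := {a | ∃ f', C1Per L (fn L a) f'}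
  zero_mem' := ⟨fun _ => 0, by
    have : fn L 0 = fun _ => 0 := by funext x; simpa using fn_smul hL 0 0 x
    rw [this]
    exact ⟨fun _ => rfl, fun x => hasDerivAt_const x 0, continuous_const⟩⟩
  add_mem' := fun {a b} ⟨f', hf⟩ ⟨g', hg⟩ => ⟨fun x => f' x + g' x, by
    have : fn L (a + b) = fun x => fn L a x + fn L b x := funext (fn_add hL a b)
    rw [this]
    exact ⟨(hf.contPer.add hg.contPer).per, fun x => (hf.deriv x).add (hg.deriv x),
      hf.cont_deriv.add hg.cont_deriv⟩⟩
  smul_mem' := fun c a ⟨f', hf⟩ => ⟨fun x => c * f' x, by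
    have : fn L (c • a) = fun x => c * fn L a x := funext (fn_smul hL c a)
    rw [this]
    exact hf.const_smul c⟩

theorem C1Per.toH_mem (hL : 0 < L) {f' : ℝ → ℝ} (h : C1Per L f f') : toH L f ∈ smoothH hL :=
  ⟨f', by rw [fn_toH hL (h.hasH1 hL)]; exact h⟩

theorem c1Per_cos (hL : 0 < L) (n : ℤ) :
    C1Per L (fun x => Real.cos (freq L n * x)) fun x => -(freq L n * Real.sin (freq L n * x)) := by
  refine ⟨fun x => ?_, fun x => ?_, by fun_prop⟩
  · have : freq L n * (x + L) = freq L n * x + n * (2 * Real.pi) := by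
      unfold freq; field_simp
    simp only [this, Real.cos_add_int_mul_two_pi]
  · have := ((hasDerivAt_id' x).const_mul (freq L n)).cos
    convert this using 1
    ring

theorem c1Per_sin (hL : 0 < L) (n : ℤ) :
    C1Per L (fun x => Real.sin (freq L n * x)) fun x => freq L n * Real.cos (freq L n * x) := by
  refine ⟨fun x => ?_, fun x => ?_, by fun_prop⟩
  · have : freq L n * (x + L) = freq L n * x + n * (2 * Real.pi) := by
      unfold freq; field_simp
    simp only [this, Real.sin_add_int_mul_two_pi]
  · have := ((hasDerivAt_id' x).const_mul (freq L n)).sin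
    convert this using 1
    ring

/-- An element orthogonal to all cosines and sines in H¹ is orthogonal to them in L², because 1 -
∂ₓ² multiplies each of them by a nonzero constant. All its Fourier coefficients then vanish. -/
theorem smoothH_dense (hL : 0 < L) : Dense (smoothH hL : Set HSpace) := by
  rw [Submodule.dense_iff_topologicalClosure_eq_top, Submodule.topologicalClosure_eq_top_iff,
    Submodule.eq_bot_iff]
  intro a ha
  rw [Submodule.mem_orthogonal'] at ha
  have hc : ∀ n, ∫ x in (0 : ℝ)..L, fn L a x * Real.cos (freq L n * x) = 0 := fun n => by
    have h := ha _ ((c1Per_cos hL n).toH_mem hL)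
    rw [(c1Per_cos hL n).inner_toH hL (f'' := fun x => (-freq L n) *
      (freq L n * Real.cos (freq L n * x)))] at h
    · have e : ∀ x, fn L a x * (Real.cos (freq L n * x) -
          (-freq L n) * (freq L n * Real.cos (freq L n * x))) =
          (1 + freq L n ^ 2) * (fn L a x * Real.cos (freq L n * x)) := fun x => by ring
      simp only [e, intervalIntegral.integral_const_mul] at h
      exact (mul_eq_zero.1 h).resolve_left (by positivity)
    · convert (c1Per_sin hL n).const_smul (-freq L n) using 2
      ring
  have hs : ∀ n, ∫ x in (0 : ℝ)..L, fn L a x * Real.sin (freq L n * x) = 0 := fun n => by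
    have h := ha _ ((c1Per_sin hL n).toH_mem hL)
    rw [(c1Per_sin hL n).inner_toH hL (f'' := fun x => (freq L n) *
      (-(freq L n * Real.sin (freq L n * x))))] at h
    · have e : ∀ x, fn L a x * (Real.sin (freq L n * x) -
          (freq L n) * (-(freq L n * Real.sin (freq L n * x)))) =
          (1 + freq L n ^ 2) * (fn L a x * Real.sin (freq L n * x)) := fun x => by ring
      simp only [e, intervalIntegral.integral_const_mul] at h
      exact (mul_eq_zero.1 h).resolve_left (by positivity)
    · exact (c1Per_cos hL n).const_smul (freq L n)
  refine coef_ext hL fun n => ?_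
  rw [← perFourier_fn hL, perFourier_expo]
  have hcont := (contPer_fn hL a).cont
  have e : ∀ x : ℝ, (fn L a x : ℂ) * expo L (-n) x = ((fn L a x * Real.cos (freq L n * x) : ℝ) : ℂ) -
      ((fn L a x * Real.sin (freq L n * x) : ℝ) : ℂ) * Complex.I := fun x => by
    have : expo L (-n) x = Complex.exp (((-(freq L n * x) : ℝ) : ℂ) * Complex.I) := by
      unfold expo freq; congr 1; push_cast; ring
    rw [this, Complex.exp_mul_I, ← Complex.ofReal_cos, ← Complex.ofReal_sin, Real.cos_neg,
      Real.sin_neg]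
    push_cast; ring
  simp only [e]
  rw [intervalIntegral.integral_sub, intervalIntegral.integral_mul_const,
    intervalIntegral.integral_ofReal, intervalIntegral.integral_ofReal, hc, hs]
  · simp [coef]
  · exact (Complex.continuous_ofReal.comp (by fun_prop)).intervalIntegrable _ _
  · exact ((Complex.continuous_ofReal.comp (by fun_prop)).mul continuous_const).intervalIntegrable _ _

end

/-! ### The flux, the vector field and the conserved functionals. -/

section

variable {L : ℝ}

/-! ### The nonlinearity -/

/-- The flux `u + |u|^{3/2}`. -/
def flux (s : ℝ) : ℝ := s + |s| ^ (3 / 2 : ℝ)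

/-- The primitive of the flux. -/
def fluxPrim (s : ℝ) : ℝ := s ^ 2 / 2 + 2 / 5 * (s * |s| ^ (3 / 2 : ℝ))

theorem hasDerivAt_flux (s : ℝ) :
    HasDerivAt flux (1 + 3 / 2 * |s| ^ (3 / 2 - 2 : ℝ) * s) s :=
  (hasDerivAt_id s).add (hasDerivAt_abs_rpow s (by norm_num))

theorem abs_rpow_mul_sq (s : ℝ) : |s| ^ (3 / 2 - 2 : ℝ) * s * s = |s| ^ (3 / 2 : ℝ) := by
  rcases eq_or_ne s 0 with rfl | h
  · simp [Real.zero_rpow (by norm_num : (3 / 2 : ℝ) ≠ 0)]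
  · have h0 : 0 < |s| := abs_pos.2 h
    rw [mul_assoc, ← pow_two, ← sq_abs, ← Real.rpow_natCast, ← Real.rpow_add h0]
    norm_num

theorem hasDerivAt_fluxPrim (s : ℝ) : HasDerivAt fluxPrim (flux s) s := by
  have h1 := (hasDerivAt_id' s).mul (hasDerivAt_abs_rpow s (by norm_num : (1 : ℝ) < 3 / 2))
  have h2 := (((hasDerivAt_id' s).pow 2).div_const 2).add (h1.const_mul (2 / 5))
  refine h2.congr_deriv ?_
  have := abs_rpow_mul_sq s
  unfold flux
  push_cast
  linear_combination (3 / 5 : ℝ) * this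

theorem continuous_flux : Continuous flux :=
  continuous_iff_continuousAt.2 fun s => (hasDerivAt_flux s).continuousAt

theorem continuous_fluxPrim : Continuous fluxPrim :=
  continuous_iff_continuousAt.2 fun s => (hasDerivAt_fluxPrim s).continuousAt

/-- A Lipschitz constant of the flux on `[-M, M]`. -/
def fluxLip (M : ℝ) : ℝ := 1 + 3 / 2 * √M

theorem fluxLip_pos (M : ℝ) : 0 < fluxLip M := by unfold fluxLip; positivity

theorem abs_flux_sub_le {M s t : ℝ} (hs : |s| ≤ M) (ht : |t| ≤ M) :
    |flux s - flux t| ≤ fluxLip M * |s - t| := by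
  have hconv : Convex ℝ (Icc (-M) M) := convex_Icc _ _
  refine hconv.norm_image_sub_le_of_norm_hasDerivWithin_le
    (fun x _ => (hasDerivAt_flux x).hasDerivWithinAt) (fun x hx => ?_) (abs_le.1 ht) (abs_le.1 hs)
  have hx' : |x| ≤ M := abs_le.2 hx
  have h1 : |(|x| ^ (3 / 2 - 2 : ℝ) * x)| = √|x| := by
    rcases eq_or_ne x 0 with rfl | h
    · simp
    · have h0 : 0 < |x| := abs_pos.2 h
      rw [abs_mul, abs_of_nonneg (Real.rpow_nonneg (abs_nonneg _) _), Real.sqrt_eq_rpow]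
      nth_rewrite 2 [← Real.rpow_one |x|]
      rw [← Real.rpow_add h0]; norm_num
  rw [mul_assoc, Real.norm_eq_abs]
  refine (abs_add_le _ _).trans ?_
  rw [abs_mul, h1, abs_one, abs_of_pos (by norm_num : (0 : ℝ) < 3 / 2)]
  have := Real.sqrt_le_sqrt hx'
  unfold fluxLip
  linarith

theorem abs_fluxPrim_sub_le {M s t : ℝ} (hs : |s| ≤ M) (ht : |t| ≤ M) :
    |fluxPrim t - fluxPrim s - flux s * (t - s)| ≤ fluxLip M * (t - s) ^ 2 := by
  have hd : ∀ x ∈ uIcc s t, HasDerivWithinAt (fun y => fluxPrim y - flux s * y)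
      (flux x - flux s * 1) (uIcc s t) x := fun x _ =>
    ((hasDerivAt_fluxPrim x).sub ((hasDerivAt_id' x).const_mul (flux s))).hasDerivWithinAt
  have h := (convex_uIcc s t).norm_image_sub_le_of_norm_hasDerivWithin_le hd
    (C := fluxLip M * |t - s|) (fun x hx => ?_) left_mem_uIcc right_mem_uIcc
  · rw [Real.norm_eq_abs, Real.norm_eq_abs, mul_assoc, abs_mul_abs_self, ← pow_two] at h
    convert h using 2
    ring
  · have hxM : |x| ≤ M := by
      have := uIcc_subset_Icc (abs_le.1 hs) (abs_le.1 ht) hx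
      exact abs_le.2 this
    rw [mul_one, Real.norm_eq_abs]
    refine (abs_flux_sub_le hxM hs).trans ?_
    exact mul_le_mul_of_nonneg_left (abs_sub_left_of_mem_uIcc hx) (fluxLip_pos M).le

theorem rpow_three_halves {y : ℝ} (hy : 0 ≤ y) : (y ^ 2) ^ (3 / 2 : ℝ) = y ^ 3 := by
  rw [← Real.rpow_natCast, ← Real.rpow_mul hy, ← Real.rpow_natCast]; norm_num

theorem abs_sq_rpow {y : ℝ} (hy : 0 ≤ y) : |y ^ 2| ^ (3 / 2 : ℝ) = y ^ 3 := by
  rw [abs_of_nonneg (sq_nonneg y), rpow_three_halves hy]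

/-- The second order Taylor expansion of the primitive of the flux at `z²`. -/
theorem abs_fluxPrim_taylor_le {z h : ℝ} (hz : 0 < z) (hh : |h| ≤ z ^ 2) :
    |fluxPrim (z ^ 2 + h) - fluxPrim (z ^ 2) - flux (z ^ 2) * h - (1 + 3 / 2 * z) * h ^ 2 / 2| ≤
      |h| ^ 3 / z := by
  have h0 : 0 ≤ z ^ 2 + h := by linarith [(abs_le.1 hh).1]
  -- With the perturbed value written as y², the powers 3/2 become cubes. The remainder is then a
  -- polynomial that factors as (y - z)³ times a quadratic form with positive coefficients.
  obtain ⟨y, hy, hyh⟩ : ∃ y, 0 ≤ y ∧ z ^ 2 + h = y ^ 2 :=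
    ⟨√(z ^ 2 + h), Real.sqrt_nonneg _, (Real.sq_sqrt h0).symm⟩
  have he : h = (y - z) * (y + z) := by linarith [hyh]
  rw [hyh]
  unfold fluxPrim flux
  rw [abs_sq_rpow hy, abs_sq_rpow hz.le]
  have e : (y ^ 2) ^ 2 / 2 + 2 / 5 * (y ^ 2 * y ^ 3) - ((z ^ 2) ^ 2 / 2 + 2 / 5 * (z ^ 2 * z ^ 3)) -
      (z ^ 2 + z ^ 3) * h - (1 + 3 / 2 * z) * h ^ 2 / 2 =
      2 / 5 * (y - z) ^ 3 * (y ^ 2 + 9 / 8 * y * z + 3 / 8 * z ^ 2) := by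
    rw [he]; ring
  have hq : 0 ≤ y ^ 2 + 9 / 8 * y * z + 3 / 8 * z ^ 2 := by positivity
  rw [e, abs_mul, abs_mul, abs_of_nonneg hq, abs_pow, he, abs_mul,
    abs_of_pos (by norm_num : (0 : ℝ) < 2 / 5), abs_of_nonneg (by positivity : 0 ≤ y + z), mul_pow,
    le_div_iff₀ hz]
  have hd : 0 ≤ |y - z| ^ 3 := by positivity
  have hp : 2 / 5 * (y ^ 2 + 9 / 8 * y * z + 3 / 8 * z ^ 2) * z ≤ (y + z) ^ 3 := by
    have h1 : 0 ≤ y * z * z := by positivity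
    have h2 : 0 ≤ y * y * z := by positivity
    have h3 : 0 ≤ y * y * y := by positivity
    have h4 : 0 ≤ z * z * z := by positivity
    nlinarith
  nlinarith [mul_le_mul_of_nonneg_left hp hd]

/-- A quadratic remainder estimate gives the derivative. -/
theorem hasFDerivAt_of_norm_sub_le_sq {E F : Type*} [NormedAddCommGroup E] [NormedSpace ℝ E]
    [NormedAddCommGroup F] [NormedSpace ℝ F] {f : E → F} {f' : E →L[ℝ] F} {a : E} {K : ℝ}
    (hK0 : 0 ≤ K) (hK : ∀ b, ‖b - a‖ ≤ 1 → ‖f b - f a - f' (b - a)‖ ≤ K * ‖b - a‖ ^ 2) :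
    HasFDerivAt f f' a := by
  rw [hasFDerivAt_iff_isLittleO, Asymptotics.isLittleO_iff]
  intro ε hε
  have hpos : 0 < min 1 (ε / (K + 1)) := lt_min one_pos (by positivity)
  filter_upwards [Metric.ball_mem_nhds a hpos] with b hb
  rw [mem_ball_iff_norm] at hb
  refine (hK b (hb.le.trans (min_le_left _ _))).trans ?_
  have h1 : ‖b - a‖ ≤ ε / (K + 1) := hb.le.trans (min_le_right _ _)
  rw [le_div_iff₀ (by positivity)] at h1
  rw [pow_two, ← mul_assoc]
  refine mul_le_mul_of_nonneg_right ?_ (norm_nonneg _)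
  nlinarith [norm_nonneg (b - a)]

/-! ### The vector field -/

/-- The vector field of the evolution equation. -/
def field (L : ℝ) (a : HSpace) : HSpace := bbmH L fun x => flux (fn L a x)

theorem contPer_flux (hL : 0 < L) (a : HSpace) : ContPer L fun x => flux (fn L a x) :=
  ContPer.comp continuous_flux (contPer_fn hL a)

theorem field_lipschitz (hL : 0 < L) (M : ℝ) :
    ∃ K : ℝ, 0 ≤ K ∧ ∀ a b : HSpace, ‖a‖ ≤ M → ‖b‖ ≤ M → ‖field L a - field L b‖ ≤ K * ‖a - b‖ := by
  have hC := supConst_pos hL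
  have hF := fluxLip_pos (supConst L * M)
  refine ⟨√L * (fluxLip (supConst L * M) * supConst L), by positivity, fun a b ha hb => ?_⟩
  unfold field
  rw [← bbmH_sub hL (contPer_flux hL a).cont (contPer_flux hL b).cont, mul_assoc]
  refine norm_bbmH_le hL ((contPer_flux hL a).cont.sub (contPer_flux hL b).cont) fun x => ?_
  refine (abs_flux_sub_le (M := supConst L * M) ?_ ?_).trans ?_
  · exact (abs_fn_le hL a x).trans (mul_le_mul_of_nonneg_left ha hC.le)
  · exact (abs_fn_le hL b x).trans (mul_le_mul_of_nonneg_left hb hC.le)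
  · rw [← fn_sub hL, mul_assoc]
    exact mul_le_mul_of_nonneg_left (abs_fn_le hL _ x) hF.le

theorem continuous_field (hL : 0 < L) : Continuous (field L) := by
  refine continuous_iff_continuousAt.2 fun a => ?_
  obtain ⟨K, hK0, hK⟩ := field_lipschitz hL (‖a‖ + 1)
  have hlip : LipschitzOnWith K.toNNReal (field L) (Metric.ball a 1) := by
    refine LipschitzOnWith.of_dist_le_mul fun x hx y hy => ?_
    rw [dist_eq_norm, dist_eq_norm, Real.coe_toNNReal _ hK0]
    have hb : ∀ z ∈ Metric.ball a 1, ‖z‖ ≤ ‖a‖ + 1 := fun z hz => by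
      have := norm_sub_norm_le z a
      rw [mem_ball_iff_norm] at hz
      linarith
    exact hK x y (hb x hx) (hb y hy)
  exact hlip.continuousOn.continuousAt (Metric.ball_mem_nhds a one_pos)

/-- For b of class C¹ the pairing is ∫ flux(b) b', the integral of the derivative of the periodic
function fluxPrim(b). Density and continuity of `field` extend this to all of H¹. -/
theorem inner_field_self (hL : 0 < L) (a : HSpace) : inner ℝ (field L a) a = 0 := by
  have hcl : IsClosed {a : HSpace | inner ℝ (field L a) a = 0} :=
    isClosed_eq ((continuous_field hL).inner continuous_id) continuous_const
  refine closure_minimal (t := {a : HSpace | inner ℝ (field L a) a = 0}) ?_ hcl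
    (smoothH_dense hL a)
  rintro b ⟨f', hf⟩
  show inner ℝ (field L b) b = 0
  have hi := inner_bbmH_toH hL (contPer_flux hL b).cont hf
  rw [toH_fn hL b] at hi
  rw [field, hi]
  have h : ∀ x ∈ uIcc 0 L, HasDerivAt (fun x => fluxPrim (fn L b x)) (flux (fn L b x) * f' x) x :=
    fun x _ => (hasDerivAt_fluxPrim _).comp x (hf.deriv x)
  rw [intervalIntegral.integral_eq_sub_of_hasDerivAt h
    (((contPer_flux hL b).cont.mul hf.cont_deriv).intervalIntegrable _ _)]
  have : fn L b L = fn L b 0 := by simpa using hf.per 0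
  rw [this, sub_self]

/-! ### Conserved functionals -/

theorem integral_le_of_abs_le (hL : 0 < L) {w : ℝ → ℝ} {C : ℝ}
    (hC : ∀ x, |w x| ≤ C) : |∫ x in (0 : ℝ)..L, w x| ≤ L * C := by
  have := intervalIntegral.norm_integral_le_of_norm_le_const (a := 0) (b := L) (f := w) (C := C)
    fun x _ => hC x
  rwa [Real.norm_eq_abs, sub_zero, abs_of_pos hL, mul_comm] at this

theorem ContPer.exists_bound (hL : 0 < L) {w : ℝ → ℝ} (hw : ContPer L w) :
    ∃ C, 0 ≤ C ∧ ∀ x, |w x| ≤ C := by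
  obtain ⟨C, hC⟩ := (isCompact_Icc (a := (0 : ℝ)) (b := L)).exists_bound_of_continuousOn
    hw.cont.continuousOn
  have : ∀ x, |w x| ≤ C := fun x => by
    obtain ⟨y, hy, hxy⟩ := hw.per.exists_mem_Ico₀ hL x
    rw [hxy]
    exact hC y ⟨hy.1, hy.2.le⟩
  exact ⟨C, (abs_nonneg _).trans (this 0), this⟩

/-- The functional `u ↦ ∫ w u`. -/
def pairCLM (hL : 0 < L) (w : ℝ → ℝ) (hw : ContPer L w) : HSpace →L[ℝ] ℝ :=
  LinearMap.mkContinuousOfExistsBound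
    { toFun := fun a => ∫ x in (0 : ℝ)..L, w x * fn L a x
      map_add' := fun a b => by
        rw [← intervalIntegral.integral_add]
        · simp only [fn_add hL, mul_add]
        · exact (hw.cont.mul (contPer_fn hL a).cont).intervalIntegrable _ _
        · exact (hw.cont.mul (contPer_fn hL b).cont).intervalIntegrable _ _
      map_smul' := fun c a => by
        rw [smul_eq_mul, ← intervalIntegral.integral_const_mul]
        simp only [fn_smul hL, RingHom.id_apply]
        congr 1; funext x; ring } (by
    obtain ⟨C, hC0, hC⟩ := hw.exists_bound hL
    refine ⟨L * (C * supConst L), fun a => ?_⟩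
    rw [mul_assoc]
    refine integral_le_of_abs_le hL fun x => ?_
    rw [abs_mul, mul_assoc]
    exact mul_le_mul (hC x) (abs_fn_le hL a x) (abs_nonneg _) hC0)

theorem pairCLM_apply (hL : 0 < L) (w : ℝ → ℝ) (hw : ContPer L w) (a : HSpace) :
    pairCLM hL w hw a = ∫ x in (0 : ℝ)..L, w x * fn L a x := rfl

/-- The mass `∫ u`. -/
def mass (L : ℝ) (a : HSpace) : ℝ := ∫ x in (0 : ℝ)..L, fn L a x

/-- The energy `∫ u² / 2 + (2/5) u |u|^{3/2}`. -/
def energy (L : ℝ) (a : HSpace) : ℝ := ∫ x in (0 : ℝ)..L, fluxPrim (fn L a x)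

theorem mass_eq_pair (hL : 0 < L) (a : HSpace) :
    mass L a = pairCLM hL (fun _ => 1) (ContPer.const 1) a := by
  simp only [mass, pairCLM_apply, one_mul]

theorem integral_shift {w : ℝ → ℝ} (hw : Function.Periodic w L) (r : ℝ) :
    ∫ x in (0 : ℝ)..L, w (x + r) = ∫ x in (0 : ℝ)..L, w x := by
  rw [intervalIntegral.integral_comp_add_right, zero_add, add_comm L r,
    hw.intervalIntegral_add_eq r 0, zero_add]

theorem mass_shift (hL : 0 < L) (r : ℝ) (a : HSpace) : mass L (shift L r a) = mass L a := by
  simp only [mass, fn_shift hL]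
  exact integral_shift (contPer_fn hL a).per r

theorem energy_shift (hL : 0 < L) (r : ℝ) (a : HSpace) : energy L (shift L r a) = energy L a := by
  simp only [energy, fn_shift hL]
  exact integral_shift (w := fun x => fluxPrim (fn L a x))
    (ContPer.comp continuous_fluxPrim (contPer_fn hL a)).per r

theorem continuous_int_fluxPrim (hL : 0 < L) (a : HSpace) :
    Continuous fun x => fluxPrim (fn L a x) := continuous_fluxPrim.comp (contPer_fn hL a).cont

theorem hasFDerivAt_energy (hL : 0 < L) (a : HSpace) :
    HasFDerivAt (energy L) (pairCLM hL _ (contPer_flux hL a)) a := by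
  have hC := supConst_pos hL
  set M := supConst L * (‖a‖ + 1) with hM
  set K := L * (fluxLip M * supConst L ^ 2) with hK
  have hF := fluxLip_pos M
  have hK0 : 0 ≤ K := by positivity
  have key : ∀ b, ‖b - a‖ ≤ 1 →
      ‖energy L b - energy L a - pairCLM hL _ (contPer_flux hL a) (b - a)‖ ≤ K * ‖b - a‖ ^ 2 := by
    intro b hb
    have hb' : ‖b‖ ≤ ‖a‖ + 1 := by linarith [norm_sub_norm_le b a]
    have e : energy L b - energy L a - pairCLM hL _ (contPer_flux hL a) (b - a) =
        ∫ x in (0 : ℝ)..L, (fluxPrim (fn L b x) - fluxPrim (fn L a x) -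
          flux (fn L a x) * (fn L b x - fn L a x)) := by
      rw [energy, energy, pairCLM_apply, ← intervalIntegral.integral_sub,
        ← intervalIntegral.integral_sub]
      · simp only [fn_sub hL]
      · exact ((continuous_int_fluxPrim hL b).sub
          (continuous_int_fluxPrim hL a)).intervalIntegrable _ _
      · exact ((contPer_flux hL a).cont.mul (contPer_fn hL _).cont).intervalIntegrable _ _
      · exact (continuous_int_fluxPrim hL b).intervalIntegrable _ _
      · exact (continuous_int_fluxPrim hL a).intervalIntegrable _ _
    rw [e, hK, mul_assoc, Real.norm_eq_abs]
    refine integral_le_of_abs_le hL fun x => ?_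
    refine (abs_fluxPrim_sub_le (M := M) ?_ ?_).trans ?_
    · exact (abs_fn_le hL a x).trans (mul_le_mul_of_nonneg_left (by linarith) hC.le)
    · exact (abs_fn_le hL b x).trans (mul_le_mul_of_nonneg_left hb' hC.le)
    · rw [← fn_sub hL, mul_assoc, ← mul_pow, ← sq_abs]
      exact mul_le_mul_of_nonneg_left
        (pow_le_pow_left₀ (abs_nonneg _) (abs_fn_le hL _ x) 2) hF.le
  exact hasFDerivAt_of_norm_sub_le_sq hK0 key

theorem pair_flux_field (hL : 0 < L) (a : HSpace) :
    pairCLM hL _ (contPer_flux hL a) (field L a) = 0 :=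
  integral_mul_bbmH hL (contPer_flux hL a).cont

theorem mass_field (hL : 0 < L) (a : HSpace) : mass L (field L a) = 0 :=
  integral_bbmH hL (contPer_flux hL a).cont

end

/-! ### Global existence and uniqueness. -/

section

section AbstractODE

variable {E : Type*} [NormedAddCommGroup E]

/-- A Lipschitz cutoff equal to `1` on the ball of radius `M`. -/
def cutoff (M : ℝ) (a : E) : ℝ := max 0 (min 1 (M + 1 - ‖a‖))

theorem cutoff_nonneg (M : ℝ) (a : E) : 0 ≤ cutoff M a := le_max_left _ _

theorem cutoff_le_one (M : ℝ) (a : E) : cutoff M a ≤ 1 :=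
  max_le zero_le_one (min_le_left _ _)

theorem cutoff_eq_one {M : ℝ} {a : E} (h : ‖a‖ ≤ M) : cutoff M a = 1 := by
  rw [cutoff, min_eq_left (by linarith), max_eq_right zero_le_one]

theorem cutoff_eq_zero {M : ℝ} {a : E} (h : M + 1 ≤ ‖a‖) : cutoff M a = 0 := by
  rw [cutoff, max_eq_left]
  exact (min_le_right _ _).trans (by linarith)

theorem abs_cutoff_sub_le (M : ℝ) (a b : E) : |cutoff M a - cutoff M b| ≤ ‖a - b‖ := by
  have h1 : |cutoff M a - cutoff M b| ≤
      |min 1 (M + 1 - ‖a‖) - min 1 (M + 1 - ‖b‖)| := by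
    have := abs_max_sub_max_le_abs (min 1 (M + 1 - ‖a‖)) (min 1 (M + 1 - ‖b‖)) 0
    simpa only [cutoff, max_comm] using this
  have h2 : |min 1 (M + 1 - ‖a‖) - min 1 (M + 1 - ‖b‖)| ≤
      |(M + 1 - ‖a‖) - (M + 1 - ‖b‖)| := by
    have := abs_min_sub_min_le_max 1 (M + 1 - ‖a‖) 1 (M + 1 - ‖b‖)
    simpa using this
  refine h1.trans (h2.trans ?_)
  rw [show (M + 1 - ‖a‖) - (M + 1 - ‖b‖) = ‖b‖ - ‖a‖ by ring, ← norm_sub_rev]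
  exact abs_norm_sub_norm_le b a

theorem bound_of_lipschitz {B : E → E}
    (hB : ∀ M : ℝ, ∃ K : ℝ, 0 ≤ K ∧ ∀ a b, ‖a‖ ≤ M → ‖b‖ ≤ M → ‖B a - B b‖ ≤ K * ‖a - b‖)
    (M : ℝ) : ∃ N : ℝ, 0 ≤ N ∧ ∀ a, ‖a‖ ≤ M → ‖B a‖ ≤ N := by
  by_cases hM : 0 ≤ M
  · obtain ⟨K, hK0, hK⟩ := hB M
    refine ⟨‖B 0‖ + K * M, by positivity, fun a ha => ?_⟩
    have h1 := hK a 0 ha (by simpa using hM)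
    rw [sub_zero] at h1
    have h2 := norm_sub_norm_le (B a) (B 0)
    nlinarith [mul_le_mul_of_nonneg_left ha hK0]
  · exact ⟨0, le_rfl, fun a ha => absurd ((norm_nonneg a).trans ha) hM⟩

theorem lipschitzOnWith_closedBall {B : E → E}
    (hB : ∀ M : ℝ, ∃ K : ℝ, 0 ≤ K ∧ ∀ a b, ‖a‖ ≤ M → ‖b‖ ≤ M → ‖B a - B b‖ ≤ K * ‖a - b‖)
    (M : ℝ) : ∃ K : NNReal, LipschitzOnWith K B (Metric.closedBall 0 M) := by
  obtain ⟨K, hK0, hK⟩ := hB M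
  refine ⟨K.toNNReal, LipschitzOnWith.of_dist_le_mul fun a ha b hb => ?_⟩
  rw [mem_closedBall_zero_iff] at ha hb
  rw [dist_eq_norm, dist_eq_norm, Real.coe_toNNReal _ hK0]
  exact hK a b ha hb

variable [InnerProductSpace ℝ E]

/-- The cut-off field is still orthogonal to the position, so its solutions keep the norm ‖u₀‖. The
cutoff therefore equals 1 along them and they solve the original equation. -/
theorem exists_solution_Icc [CompleteSpace E] {B : E → E}
    (hB : ∀ M : ℝ, ∃ K : ℝ, 0 ≤ K ∧ ∀ a b, ‖a‖ ≤ M → ‖b‖ ≤ M → ‖B a - B b‖ ≤ K * ‖a - b‖)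
    (hin : ∀ a, inner ℝ (B a) a = 0) (u₀ : E) {T : ℝ} (hT : 0 < T) :
    ∃ u : ℝ → E, u 0 = u₀ ∧ (∀ t ∈ Icc (-T) T, ‖u t‖ = ‖u₀‖) ∧
      ∀ t ∈ Icc (-T) T, HasDerivWithinAt u (B (u t)) (Icc (-T) T) t := by
  set M := ‖u₀‖ with hM
  obtain ⟨N, hN0, hN⟩ := bound_of_lipschitz hB (M + 1)
  obtain ⟨K, hK0, hK⟩ := hB (M + N * T)
  obtain ⟨N', hN0', hN'⟩ := bound_of_lipschitz hB (M + N * T)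
  have h0 : (0 : ℝ) ∈ Icc (-T) T := ⟨by linarith, hT.le⟩
  have hball : ∀ x ∈ Metric.closedBall u₀ (N * T), ‖x‖ ≤ M + N * T := fun x hx => by
    rw [mem_closedBall_iff_norm] at hx
    linarith [norm_sub_norm_le x u₀]
  -- After the cutoff the field is bounded by N everywhere. A ball of radius N T therefore suffices
  -- for the whole interval, and T may be arbitrary.
  have hPL : IsPicardLindelof (fun _ a => cutoff M a • B a) (⟨0, h0⟩ : Icc (-T) T) u₀
      (N * T).toNNReal 0 N.toNNReal (K + N').toNNReal := by
    constructor
    · intro t _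
      refine LipschitzOnWith.of_dist_le_mul fun a ha b hb => ?_
      rw [Real.coe_toNNReal _ (by positivity)] at ha hb
      rw [dist_eq_norm, dist_eq_norm, Real.coe_toNNReal _ (by positivity)]
      have e : cutoff M a • B a - cutoff M b • B b =
          cutoff M a • (B a - B b) + (cutoff M a - cutoff M b) • B b := by
        rw [smul_sub, sub_smul]; abel
      rw [e]
      refine (norm_add_le _ _).trans ?_
      rw [norm_smul, norm_smul, Real.norm_eq_abs, Real.norm_eq_abs,
        abs_of_nonneg (cutoff_nonneg M a)]
      have h1 := hK a b (hball a ha) (hball b hb)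
      have h2 := hN' b (hball b hb)
      have h3 := abs_cutoff_sub_le M a b
      have h4 := mul_le_mul (cutoff_le_one M a) h1 (norm_nonneg _) zero_le_one
      have h5 := mul_le_mul h3 h2 (norm_nonneg _) (norm_nonneg _)
      linarith
    · exact fun x _ => continuousOn_const
    · intro t _ a _
      rw [Real.coe_toNNReal _ hN0, norm_smul, Real.norm_eq_abs, abs_of_nonneg (cutoff_nonneg M a)]
      by_cases ha : ‖a‖ ≤ M + 1
      · have := mul_le_mul (cutoff_le_one M a) (hN a ha) (norm_nonneg _) zero_le_one
        linarith
      · rw [cutoff_eq_zero (not_le.1 ha).le]; simpa using hN0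
    · simp only [Real.coe_toNNReal _ hN0, sub_zero, zero_sub, neg_neg, max_self, NNReal.coe_zero]
      rw [Real.coe_toNNReal _ (by positivity)]
  obtain ⟨u, hu0, hu⟩ := hPL.exists_eq_forall_mem_Icc_hasDerivWithinAt₀
  have hn : ∀ t ∈ Icc (-T) T, ‖u t‖ = ‖u₀‖ := by
    intro t ht
    have hd : ∀ s ∈ Icc (-T) T, HasDerivWithinAt (fun s => ‖u s‖ ^ 2)
        (2 * inner ℝ (u s) (cutoff M (u s) • B (u s))) (Icc (-T) T) s := fun s hs =>
      (hu s hs).norm_sq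
    have hc := (convex_Icc (-T) T).norm_image_sub_le_of_norm_hasDerivWithin_le hd (C := 0)
      (fun s _ => by rw [inner_smul_right, real_inner_comm, hin]; simp) h0 ht
    rw [zero_mul, norm_le_zero_iff, sub_eq_zero] at hc
    have hu0' : u 0 = u₀ := hu0
    rw [hu0'] at hc
    exact (pow_left_inj₀ (norm_nonneg _) (norm_nonneg _) two_ne_zero).1 hc
  refine ⟨u, hu0, hn, fun t ht => ?_⟩
  have := hu t ht
  rwa [cutoff_eq_one (hn t ht).le, one_smul] at this

/-- Global existence for a locally Lipschitz vector field that is orthogonal to the position. -/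
theorem exists_global_solution [CompleteSpace E] {B : E → E}
    (hB : ∀ M : ℝ, ∃ K : ℝ, 0 ≤ K ∧ ∀ a b, ‖a‖ ≤ M → ‖b‖ ≤ M → ‖B a - B b‖ ≤ K * ‖a - b‖)
    (hin : ∀ a, inner ℝ (B a) a = 0) (u₀ : E) :
    ∃ u : ℝ → E, u 0 = u₀ ∧ (∀ t, ‖u t‖ = ‖u₀‖) ∧ ∀ t, HasDerivAt u (B (u t)) t := by
  have hex : ∀ n : ℕ, ∃ u : ℝ → E, u 0 = u₀ ∧ ∀ t ∈ Ioo (-(n + 1 : ℝ)) (n + 1),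
      HasDerivAt u (B (u t)) t ∧ u t ∈ Metric.closedBall (0 : E) ‖u₀‖ := fun n => by
    obtain ⟨u, h0, hn, hd⟩ := exists_solution_Icc hB hin u₀ (T := n + 1) (by positivity)
    exact ⟨u, h0, fun t ht => ⟨(hd t (Ioo_subset_Icc_self ht)).hasDerivAt (Icc_mem_nhds ht.1 ht.2),
      by rw [mem_closedBall_zero_iff, hn t (Ioo_subset_Icc_self ht)]⟩⟩
  choose U hU0 hU using hex
  obtain ⟨K, hK⟩ := lipschitzOnWith_closedBall hB ‖u₀‖
  have hagree : ∀ m n : ℕ, m ≤ n → EqOn (U m) (U n) (Ioo (-(m + 1 : ℝ)) (m + 1)) := by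
    intro m n hmn
    have hmn' : (m : ℝ) ≤ n := by exact_mod_cast hmn
    refine ODE_solution_unique_of_mem_Ioo (v := fun _ => B) (K := K)
      (s := fun _ => Metric.closedBall 0 ‖u₀‖) (t₀ := 0) (fun _ _ => hK)
      ⟨by have : (0 : ℝ) ≤ m := by positivity
          linarith, by positivity⟩ (hU m) (fun t ht => hU n t ⟨by linarith [ht.1], by linarith [ht.2]⟩)
      (by rw [hU0, hU0])
  -- The solution of index n lives on |t| < n + 1, and |t| < ⌊|t|⌋₊ + 1.
  set u : ℝ → E := fun t => U ⌊|t|⌋₊ t with hu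
  have hlocal : ∀ (N : ℕ) (t : ℝ), |t| < N → u t = U N t := fun N t ht => by
    refine hagree _ _ (Nat.floor_le_of_le ht.le) ?_
    exact abs_lt.1 (Nat.lt_floor_add_one |t|)
  have hd : ∀ t, HasDerivAt u (B (u t)) t := fun t => by
    obtain ⟨N, hN⟩ := exists_nat_gt |t|
    have hev : u =ᶠ[𝓝 t] U N := by
      filter_upwards [(continuous_abs.isOpen_preimage _ isOpen_Iio).mem_nhds hN] with s hs
      exact hlocal N s hs
    have h1 := (hU N t (abs_lt.1 (hN.trans (lt_add_one _)))).1
    rw [hlocal N t hN]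
    exact h1.congr_of_eventuallyEq hev
  refine ⟨u, by simp [hu, hU0], fun t => ?_, hd⟩
  have hds : ∀ s, HasDerivAt (fun s => ‖u s‖ ^ 2) (2 * inner ℝ (u s) (B (u s))) s := fun s =>
    (hd s).norm_sq
  have hc := is_const_of_deriv_eq_zero (fun s => (hds s).differentiableAt)
    (fun s => by rw [(hds s).deriv, real_inner_comm, hin, mul_zero]) t 0
  rw [show u 0 = u₀ by simp [hu, hU0]] at hc
  exact (pow_left_inj₀ (norm_nonneg _) (norm_nonneg _) two_ne_zero).1 hc

/-- Uniqueness of continuous solutions of the integral equation. -/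
theorem eqOn_of_integral_eq [CompleteSpace E] {B : E → E}
    (hB : ∀ M : ℝ, ∃ K : ℝ, 0 ≤ K ∧ ∀ a b, ‖a‖ ≤ M → ‖b‖ ≤ M → ‖B a - B b‖ ≤ K * ‖a - b‖)
    (hBc : Continuous B) {u v : ℝ → E} {T : ℝ} (hT : 0 < T)
    (hu : ∀ t, HasDerivAt u (B (u t)) t) (hv : ContinuousOn v (Icc 0 T))
    (hint : ∀ t ∈ Icc 0 T, v t = u 0 + ∫ τ in (0 : ℝ)..t, B (v τ)) : EqOn u v (Icc 0 T) := by
  have huc : Continuous u := continuous_iff_continuousAt.2 fun t => (hu t).continuousAt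
  obtain ⟨M₁, hM₁⟩ := isCompact_Icc.exists_bound_of_continuousOn (huc.continuousOn (s := Icc 0 T))
  obtain ⟨M₂, hM₂⟩ := isCompact_Icc.exists_bound_of_continuousOn hv
  obtain ⟨K, hK⟩ := lipschitzOnWith_closedBall hB (max M₁ M₂)
  have h0 : (0 : ℝ) ∈ Icc 0 T := ⟨le_rfl, hT.le⟩
  have hvd : ∀ t ∈ Icc 0 T, HasDerivWithinAt v (B (v t)) (Icc 0 T) t := fun t ht => by
    have := ODE.hasDerivWithinAt_picard_Icc (f := fun _ => B) (u := univ) h0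
      (hBc.comp continuous_snd).continuousOn hv (fun _ _ => trivial) (u 0) ht
    refine this.congr (fun s hs => ?_) ?_
    · rw [ODE.picard_apply]; exact hint s hs
    · rw [ODE.picard_apply]; exact hint t ht
  refine ODE_solution_unique_of_mem_Icc_right (v := fun _ => B) (K := K)
    (s := fun _ => Metric.closedBall 0 (max M₁ M₂)) (fun _ _ => hK) huc.continuousOn
    (fun t _ => (hu t).hasDerivWithinAt) (fun t ht => ?_) hv (fun t ht => ?_) (fun t ht => ?_) ?_
  · rw [mem_closedBall_zero_iff]
    exact (hM₁ t (Ico_subset_Icc_self ht)).trans (le_max_left _ _)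
  · exact (hvd t (Ico_subset_Icc_self ht)).mono_of_mem_nhdsWithin
      (Icc_mem_nhdsGE_of_mem ht)
  · rw [mem_closedBall_zero_iff]
    exact (hM₂ t (Ico_subset_Icc_self ht)).trans (le_max_right _ _)
  · rw [hint 0 h0, intervalIntegral.integral_same, add_zero]

end AbstractODE

variable {L : ℝ}

theorem fn_sub_fun (hL : 0 < L) (a b : HSpace) : fn L a - fn L b = fn L (a - b) :=
  funext fun x => (fn_sub hL a b x).symm

theorem isSolution_of_hasDerivAt (hL : 0 < L) {u₀ : ℝ → ℝ} (hu₀ : u₀ ∈ H1per L) {u : ℝ → HSpace}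
    (h0 : u 0 = toH L u₀) (hd : ∀ t, HasDerivAt u (field L (u t)) t) :
    IsSolution L (Ici 0) u₀ fun t => fn L (u t) := by
  have huc : Continuous u := continuous_iff_continuousAt.2 fun t => (hd t).continuousAt
  refine ⟨fun t _ => fn_mem_H1per hL _, fun s _ => ?_, fun t _ x => ?_⟩
  · have h1 : Tendsto (fun t => ENNReal.ofReal (√(normConst L) * ‖u t - u s‖)) (𝓝[Ici 0] s) (𝓝 0) := by
      have : Continuous fun t => ENNReal.ofReal (√(normConst L) * ‖u t - u s‖) :=
        ENNReal.continuous_ofReal.comp (by fun_prop)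
      have h2 := (this.tendsto s).mono_left (nhdsWithin_le_nhds (s := Ici 0))
      simpa using h2
    refine tendsto_of_tendsto_of_tendsto_of_le_of_le tendsto_const_nhds h1
      (fun _ => zero_le) fun t => ?_
    show h1Norm L (fn L (u t) - fn L (u s)) ≤ _
    rw [fn_sub_fun hL]
    exact h1Norm_fn_le hL _
  · have hx : ∀ τ, HasDerivAt (fun τ => fn L (u τ) x) (fn L (field L (u τ)) x) τ := fun τ =>
      (evalCLM hL x).hasFDerivAt.comp_hasDerivAt τ (hd τ)
    have hcont : Continuous fun τ => fn L (field L (u τ)) x :=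
      (evalCLM hL x).continuous.comp ((continuous_field hL).comp huc)
    have hi := intervalIntegral.integral_eq_sub_of_hasDerivAt (a := 0) (b := t)
      (fun τ _ => hx τ) (hcont.intervalIntegrable _ _)
    have he : ∀ τ, bbmOp L (fun y => fn L (u τ) y + |fn L (u τ) y| ^ (3 / 2 : ℝ)) x =
        (fn L (field L (u τ)) x : ℂ) := fun τ => (fn_bbmH hL (contPer_flux hL _).cont x).symm
    simp only [he]
    rw [intervalIntegral.integral_ofReal, hi, h0, fn_toH hL (hasH1_of_mem hL hu₀)]
    push_cast; ring

/-- The competitor satisfies its integral equation only pointwise in x. Point evaluations are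
bounded, commute with the integral and separate elements, so the equation lifts to `HSpace`, where
uniqueness for locally Lipschitz fields applies. -/
theorem eq_of_isSolution (hL : 0 < L) {u₀ : ℝ → ℝ} (hu₀ : u₀ ∈ H1per L) {u : ℝ → HSpace}
    (h0 : u 0 = toH L u₀) (hd : ∀ t, HasDerivAt u (field L (u t)) t) {T : ℝ} (hT : 0 < T)
    {v : ℝ → ℝ → ℝ} (hv : IsSolution L (Icc 0 T) u₀ v) : ∀ t ∈ Icc 0 T, v t = fn L (u t) := by
  have hfn : ∀ t ∈ Icc 0 T, fn L (toH L (v t)) = v t := fun t ht =>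
    fn_toH hL (hasH1_of_mem hL (hv.mem t ht))
  have hcont : ContinuousOn (fun t => toH L (v t)) (Icc 0 T) := by
    intro s hs
    have h1 := ENNReal.Tendsto.const_mul (a := ENNReal.ofReal √(normConst L))
      (hv.continuous s hs) (Or.inr ENNReal.ofReal_ne_top)
    rw [mul_zero] at h1
    have h2 : Tendsto (fun t => ENNReal.ofReal ‖toH L (v t) - toH L (v s)‖) (𝓝[Icc 0 T] s) (𝓝 0) := by
      refine tendsto_of_tendsto_of_tendsto_of_le_of_le' tendsto_const_nhds h1
        (Eventually.of_forall fun _ => zero_le) ?_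
      filter_upwards [self_mem_nhdsWithin] with t ht
      have := ofReal_norm_le hL (toH L (v t) - toH L (v s))
      rwa [← fn_sub_fun hL, hfn t ht, hfn s hs] at this
    have h3 := (ENNReal.tendsto_toReal ENNReal.zero_ne_top).comp h2
    simp only [Function.comp_def, ENNReal.toReal_ofReal (norm_nonneg _), ENNReal.toReal_zero] at h3
    exact tendsto_iff_norm_sub_tendsto_zero.2 h3
  have heq := eqOn_of_integral_eq (field_lipschitz hL) (continuous_field hL) hT hd hcont ?_
  · intro t ht
    rw [heq ht, hfn t ht]
  · intro t ht
    have hsub : uIcc 0 t ⊆ Icc 0 T := by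
      rw [uIcc_of_le ht.1]; exact Icc_subset_Icc_right ht.2
    have hcf : ContinuousOn (fun τ => field L (toH L (v τ))) (uIcc 0 t) :=
      (continuous_field hL).comp_continuousOn (hcont.mono hsub)
    refine fn_injective hL (funext fun x => ?_)
    rw [hfn t ht, fn_add hL, h0, fn_toH hL (hasH1_of_mem hL hu₀)]
    have h1 := hv.eqn t ht x
    have h2 : ∫ τ in (0 : ℝ)..t, bbmOp L (fun y => v τ y + |v τ y| ^ (3 / 2 : ℝ)) x =
        ∫ τ in (0 : ℝ)..t, ((fn L (field L (toH L (v τ))) x : ℝ) : ℂ) := by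
      refine intervalIntegral.integral_congr fun τ hτ => ?_
      have := fn_bbmH hL (contPer_flux hL (toH L (v τ))).cont x
      simp only [hfn τ (hsub hτ)] at this
      simp only [field, hfn τ (hsub hτ)]
      rw [this]
      rfl
    have h3 := (evalCLM hL x).intervalIntegral_comp_comm (hcf.intervalIntegrable (μ := volume))
    simp only [evalCLM_apply] at h3
    rw [h2, intervalIntegral.integral_ofReal, h3] at h1
    exact_mod_cast h1

end

/-! ### Orbital stability from coercivity. -/

section

variable {L : ℝ}

/-! ### Translates of a smooth profile -/

theorem abs_sub_le_of_deriv_bound {f f' : ℝ → ℝ} (hf : ∀ x, HasDerivAt f (f' x) x) {C : ℝ}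
    (hC : ∀ x, |f' x| ≤ C) (x y : ℝ) : |f y - f x| ≤ C * |y - x| :=
  convex_univ.norm_image_sub_le_of_norm_hasDerivWithin_le (fun z _ => (hf z).hasDerivWithinAt)
    (fun z _ => hC z) (mem_univ x) (mem_univ y)

theorem abs_taylor_le {f f' f'' : ℝ → ℝ} (hf : ∀ x, HasDerivAt f (f' x) x)
    (hf' : ∀ x, HasDerivAt f' (f'' x) x) {C : ℝ} (hC : ∀ x, |f'' x| ≤ C) (x r : ℝ) :
    |f (x + r) - f x - r * f' x| ≤ C * r ^ 2 := by
  have hC0 : 0 ≤ C := (abs_nonneg _).trans (hC 0)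
  have hd : ∀ z ∈ uIcc x (x + r), HasDerivWithinAt (fun y => f y - f' x * y)
      (f' z - f' x * 1) (uIcc x (x + r)) z := fun z _ =>
    ((hf z).sub ((hasDerivAt_id' z).const_mul (f' x))).hasDerivWithinAt
  have h := (convex_uIcc x (x + r)).norm_image_sub_le_of_norm_hasDerivWithin_le hd
    (C := C * |r|) (fun z hz => ?_) left_mem_uIcc right_mem_uIcc
  · rw [Real.norm_eq_abs, Real.norm_eq_abs, add_sub_cancel_left, mul_assoc, abs_mul_abs_self,
      ← pow_two] at h
    convert h using 2
    ring
  · rw [mul_one, Real.norm_eq_abs]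
    refine (abs_sub_le_of_deriv_bound hf' hC x z).trans (mul_le_mul_of_nonneg_left ?_ hC0)
    simpa using abs_sub_left_of_mem_uIcc hz

theorem C1Per.shift {f f' : ℝ → ℝ} (h : C1Per L f f') (r : ℝ) :
    C1Per L (fun x => f (x + r)) fun x => f' (x + r) :=
  ⟨(h.contPer.shift r).per, fun x => (h.deriv (x + r)).comp_add_const x r,
    (h.contPer_deriv.shift r).cont⟩

theorem C1Per.sub {f f' g g' : ℝ → ℝ} (h : C1Per L f f') (hg : C1Per L g g') :
    C1Per L (fun x => f x - g x) fun x => f' x - g' x :=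
  ⟨(h.contPer.sub hg.contPer).per, fun x => (h.deriv x).sub (hg.deriv x),
    h.cont_deriv.sub hg.cont_deriv⟩

theorem C1Per.norm_le (hL : 0 < L) {f f' : ℝ → ℝ} (h : C1Per L f f') {C D : ℝ}
    (hC : ∀ x, |f x| ≤ C) (hD : ∀ x, |f' x| ≤ D) : ‖toH L f‖ ^ 2 ≤ L * (C ^ 2 + D ^ 2) := by
  rw [h.norm_sq hL, mul_add]
  refine add_le_add ((le_abs_self _).trans (integral_le_of_abs_le hL fun x => ?_))
    ((le_abs_self _).trans (integral_le_of_abs_le hL fun x => ?_))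
  · rw [abs_pow]; exact pow_le_pow_left₀ (abs_nonneg _) (hC x) 2
  · rw [abs_pow]; exact pow_le_pow_left₀ (abs_nonneg _) (hD x) 2

variable {φ φ' φ'' φ''' : ℝ → ℝ}

/-- Taylor's formula is applied to φ and to φ', which makes the remainder O(r²) in H¹. This is where
a third derivative of the profile is needed. -/
theorem hasDerivAt_shift_zero (hL : 0 < L) (h1 : C1Per L φ φ') (h2 : C1Per L φ' φ'')
    (h3 : C1Per L φ'' φ''') : HasDerivAt (fun r => shift L r (toH L φ)) (toH L φ') 0 := by
  obtain ⟨C, hC0, hC⟩ := h3.contPer.exists_bound hL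
  obtain ⟨D, hD0, hD⟩ := h3.contPer_deriv.exists_bound hL
  rw [hasDerivAt_iff_hasFDerivAt]
  refine hasFDerivAt_of_norm_sub_le_sq (K := √(L * (C ^ 2 + D ^ 2))) (Real.sqrt_nonneg _)
    fun r _ => ?_
  have hc := (h1.shift r).sub h1 |>.sub (h2.const_smul r)
  have e : shift L r (toH L φ) - shift L 0 (toH L φ) -
      (ContinuousLinearMap.toSpanSingleton ℝ (toH L φ')) (r - 0) =
      toH L fun x => φ (x + r) - φ x - r * φ' x := by
    refine fn_injective hL (funext fun x => ?_)
    rw [fn_toH hL (hc.hasH1 hL)]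
    simp only [fn_sub hL, fn_shift hL, sub_zero, ContinuousLinearMap.toSpanSingleton_apply,
      fn_smul hL, fn_toH hL (h1.hasH1 hL), fn_toH hL (h2.hasH1 hL), add_zero]
  rw [e, sub_zero]
  refine abs_le_of_sq_le_sq' ?_ (by positivity) |>.2
  rw [mul_pow, Real.sq_sqrt (by positivity), Real.norm_eq_abs, sq_abs]
  refine (hc.norm_le hL (abs_taylor_le h1.deriv h2.deriv hC · r)
    (abs_taylor_le h2.deriv h3.deriv hD · r)).trans (le_of_eq ?_)
  ring

theorem continuous_shift (hL : 0 < L) (h1 : C1Per L φ φ') (h2 : C1Per L φ' φ'')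
    (h3 : C1Per L φ'' φ''') : Continuous fun r => shift L r (toH L φ) := by
  refine continuous_iff_continuousAt.2 fun s => ?_
  have h0 := (hasDerivAt_shift_zero hL h1 h2 h3).continuousAt
  have h4 : Tendsto (fun r => ‖shift L (r - s) (toH L φ) - shift L 0 (toH L φ)‖) (𝓝 s) (𝓝 0) := by
    have h5 : Tendsto (fun r : ℝ => r - s) (𝓝 s) (𝓝 0) := by
      have : Continuous fun r : ℝ => r - s := by fun_prop
      simpa using this.tendsto s
    exact tendsto_iff_norm_sub_tendsto_zero.1 (h0.tendsto.comp h5)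
  refine tendsto_iff_norm_sub_tendsto_zero.2 (h4.congr fun r => ?_)
  rw [← norm_shift hL s, shift_sub hL, shift_shift hL, shift_shift hL]
  simp

theorem shift_add_period (hL : 0 < L) (r : ℝ) (a : HSpace) :
    shift L (r + L) a = shift L r a := by
  refine fn_injective hL (funext fun x => ?_)
  rw [fn_shift hL, fn_shift hL, ← add_assoc, (contPer_fn hL a).per]

/-- The orbit of a function under translations. -/
def orbit (L : ℝ) (a : HSpace) : Set HSpace := range fun r => shift L r a

theorem isCompact_orbit (hL : 0 < L) (h1 : C1Per L φ φ') (h2 : C1Per L φ' φ'')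
    (h3 : C1Per L φ'' φ''') : IsCompact (orbit L (toH L φ)) := by
  have hper : Function.Periodic (fun r => shift L r (toH L φ)) L := fun r =>
    shift_add_period hL r _
  rw [orbit, ← hper.image_Icc hL 0]
  exact isCompact_Icc.image (continuous_shift hL h1 h2 h3)

/-- The point of the orbit that is closest to `a` is characterized by an orthogonality relation. -/
theorem exists_shift_inner_eq_zero (hL : 0 < L) (h1 : C1Per L φ φ') (h2 : C1Per L φ' φ'')
    (h3 : C1Per L φ'' φ''') (a : HSpace) :
    ∃ r, ‖a - shift L r (toH L φ)‖ = Metric.infDist a (orbit L (toH L φ)) ∧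
      ‖shift L (-r) a - toH L φ‖ = Metric.infDist a (orbit L (toH L φ)) ∧
      inner ℝ (shift L (-r) a - toH L φ) (toH L φ') = 0 := by
  obtain ⟨y, ⟨r, rfl⟩, hr⟩ := (isCompact_orbit hL h1 h2 h3).exists_infDist_eq_dist
    (range_nonempty _) a
  rw [dist_eq_norm] at hr
  have hs : ∀ s, ‖shift L (-r) a - shift L s (toH L φ)‖ = ‖a - shift L (r + s) (toH L φ)‖ :=
    fun s => by
      rw [← norm_shift hL r, shift_sub hL, shift_shift hL, shift_shift hL, add_neg_cancel,
        shift_zero hL]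
  refine ⟨r, hr.symm, ?_, ?_⟩
  · rw [hr, ← add_zero r, ← hs 0, shift_zero hL, add_zero]
  · have hd := ((hasDerivAt_shift_zero hL h1 h2 h3).const_sub (shift L (-r) a)).norm_sq
    have hmin : IsLocalMin (fun s => ‖shift L (-r) a - shift L s (toH L φ)‖ ^ 2) 0 := by
      refine Eventually.of_forall fun s => ?_
      show ‖shift L (-r) a - shift L 0 (toH L φ)‖ ^ 2 ≤ ‖shift L (-r) a - shift L s (toH L φ)‖ ^ 2
      rw [hs, hs, add_zero, ← hr]
      refine pow_le_pow_left₀ Metric.infDist_nonneg ?_ 2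
      rw [← dist_eq_norm]
      exact Metric.infDist_le_dist_of_mem ⟨r + s, rfl⟩
    have := hmin.hasDerivAt_eq_zero hd
    rw [shift_zero hL, inner_neg_right] at this
    linarith

/-! ### The Lyapunov functional -/

/-- The quadratic form of the linearization around `w²`. -/
def hessian (L c : ℝ) (w : ℝ → ℝ) (f : HSpace) : ℝ :=
  c * ‖f‖ ^ 2 - ∫ x in (0 : ℝ)..L, (1 + 3 / 2 * w x) * fn L f x ^ 2

/-- The Lyapunov functional. -/
def lyapunov (L c A : ℝ) (a : HSpace) : ℝ := c / 2 * ‖a‖ ^ 2 - energy L a + A * mass L a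

theorem lyapunov_shift (hL : 0 < L) (c A r : ℝ) (a : HSpace) :
    lyapunov L c A (shift L r a) = lyapunov L c A a := by
  simp only [lyapunov, norm_shift hL, energy_shift hL, mass_shift hL]

theorem flux_sq {y : ℝ} (hy : 0 ≤ y) : flux (y ^ 2) = y ^ 2 + y ^ 3 := by
  rw [flux, abs_sq_rpow hy]

variable {c A : ℝ} {w : ℝ → ℝ}

/-- The profile equation is the Euler–Lagrange equation of the functional, so the linear term drops
out. The lower bound ν keeps φ away from 0, where the primitive of the flux has no third order
Taylor remainder. -/
theorem lyapunov_expansion (hL : 0 < L) (h1 : C1Per L φ φ') (h2 : C1Per L φ' φ'')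
    (hw : ContPer L w) (hφ : ∀ x, φ x = w x ^ 2) {ν : ℝ} (hν : 0 < ν) (hνw : ∀ x, ν ≤ w x)
    (hode : ∀ x, -c * φ'' x + (c - 1) * φ x - w x ^ 3 + A = 0) :
    ∃ K : ℝ, 0 ≤ K ∧ ∃ η : ℝ, 0 < η ∧ ∀ f : HSpace, ‖f‖ ≤ η →
      hessian L c w f / 2 - K * ‖f‖ ^ 3 ≤
        lyapunov L c A (toH L φ + f) - lyapunov L c A (toH L φ) := by
  have hC := supConst_pos hL
  -- The radius forces |f| ≤ ν² ≤ w² pointwise, as the Taylor estimate requires.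
  refine ⟨L * (supConst L ^ 3 / ν), by positivity, ν ^ 2 / supConst L, by positivity,
    fun f hf => ?_⟩
  have hwc := hw.cont
  have hfc := (contPer_fn hL f).cont
  have hφc := h1.contPer.cont
  have hfnφ : fn L (toH L φ) = φ := fn_toH hL (h1.hasH1 hL)
  have hfb : ∀ x, |fn L f x| ≤ supConst L * ‖f‖ := abs_fn_le hL f
  have hsmall : ∀ x, |fn L f x| ≤ w x ^ 2 := fun x => by
    rw [le_div_iff₀ hC] at hf
    have := pow_le_pow_left₀ hν.le (hνw x) 2
    linarith [hfb x]
  have hlin : c * inner ℝ (toH L φ) f + A * mass L f =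
      ∫ x in (0 : ℝ)..L, flux (φ x) * fn L f x := by
    rw [real_inner_comm, h1.inner_toH hL h2, mass, ← intervalIntegral.integral_const_mul,
      ← intervalIntegral.integral_const_mul, ← intervalIntegral.integral_add]
    · congr 1; funext x
      rw [hφ x, flux_sq (hν.le.trans (hνw x)), ← hφ x]
      linear_combination (fn L f x) * hode x
    · exact (continuous_const.mul (hfc.mul (hφc.sub h2.cont_deriv))).intervalIntegrable _ _
    · exact (continuous_const.mul hfc).intervalIntegrable _ _
  have hcont1 : Continuous fun x => fluxPrim (φ x + fn L f x) :=
    continuous_fluxPrim.comp (hφc.add hfc)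
  have hcont2 : Continuous fun x => fluxPrim (φ x) := continuous_fluxPrim.comp hφc
  have hcont3 : Continuous fun x => flux (φ x) * fn L f x := (continuous_flux.comp hφc).mul hfc
  have hcont4 : Continuous fun x => (1 + 3 / 2 * w x) * fn L f x ^ 2 := by fun_prop
  have hrem : (∫ x in (0 : ℝ)..L, (fluxPrim (φ x + fn L f x) - fluxPrim (φ x) -
      flux (φ x) * fn L f x - (1 / 2) * ((1 + 3 / 2 * w x) * fn L f x ^ 2))) ≤
        L * (supConst L ^ 3 / ν) * ‖f‖ ^ 3 := by
    rw [mul_assoc]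
    refine (le_abs_self _).trans (integral_le_of_abs_le hL fun x => ?_)
    have hwp : 0 < w x := hν.trans_le (hνw x)
    have h := abs_fluxPrim_taylor_le hwp (hsmall x)
    rw [← hφ x] at h
    have e : fluxPrim (φ x + fn L f x) - fluxPrim (φ x) - flux (φ x) * fn L f x -
        (1 / 2) * ((1 + 3 / 2 * w x) * fn L f x ^ 2) =
        fluxPrim (φ x + fn L f x) - fluxPrim (φ x) - flux (φ x) * fn L f x -
        (1 + 3 / 2 * w x) * fn L f x ^ 2 / 2 := by ring
    rw [e]
    refine h.trans ?_
    rw [div_mul_eq_mul_div, ← mul_pow]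
    exact div_le_div₀ (by positivity) (pow_le_pow_left₀ (abs_nonneg _) (hfb x) 3) hν (hνw x)
  have hI : (∫ x in (0 : ℝ)..L, (fluxPrim (φ x + fn L f x) - fluxPrim (φ x) -
      flux (φ x) * fn L f x - (1 / 2) * ((1 + 3 / 2 * w x) * fn L f x ^ 2))) =
      energy L (toH L φ + f) - energy L (toH L φ) - (c * inner ℝ (toH L φ) f + A * mass L f) -
        (1 / 2) * ∫ x in (0 : ℝ)..L, (1 + 3 / 2 * w x) * fn L f x ^ 2 := by
    have e1 : energy L (toH L φ + f) = ∫ x in (0 : ℝ)..L, fluxPrim (φ x + fn L f x) := by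
      simp only [energy, fn_add hL, hfnφ]
    have e2 : energy L (toH L φ) = ∫ x in (0 : ℝ)..L, fluxPrim (φ x) := by
      simp only [energy, hfnφ]
    rw [hlin, e1, e2, ← intervalIntegral.integral_const_mul,
      ← intervalIntegral.integral_sub, ← intervalIntegral.integral_sub,
      ← intervalIntegral.integral_sub]
    · exact ((hcont1.sub hcont2).sub hcont3).intervalIntegrable _ _
    · exact (continuous_const.mul hcont4).intervalIntegrable _ _
    · exact (hcont1.sub hcont2).intervalIntegrable _ _
    · exact hcont3.intervalIntegrable _ _
    · exact hcont1.intervalIntegrable _ _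
    · exact hcont2.intervalIntegrable _ _
  have hm : mass L (toH L φ + f) = mass L (toH L φ) + mass L f := by
    simp only [mass_eq_pair hL, map_add]
  have hn : ‖toH L φ + f‖ ^ 2 = ‖toH L φ‖ ^ 2 + 2 * inner ℝ (toH L φ) f + ‖f‖ ^ 2 :=
    norm_add_sq_real _ _
  unfold lyapunov hessian
  rw [hm, hn]
  rw [hI] at hrem
  linarith

/-- Coercivity of the second variation off the conserved quantities and the translations. -/
def IsCoercive (L c : ℝ) (w φ φ' : ℝ → ℝ) : Prop :=
  ∃ δ C α β : ℝ, 0 < δ ∧ 0 ≤ C ∧ ∀ f : HSpace, inner ℝ f (toH L φ') = 0 →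
    δ * ‖f‖ ^ 2 - C * (α * inner ℝ (toH L φ) f + β * mass L f) ^ 2 ≤ hessian L c w f

/-- If a lay at distance ε from the orbit, the translate of a for which φ is the nearest point would
differ from φ by some f orthogonal to φ' with ‖f‖ = ε. The functional would then exceed its value at
φ by about δε²/2, up to O(ε³), while the invariants allow less than δε²/8. -/
theorem infDist_ne_of_isCoercive (hL : 0 < L) (h1 : C1Per L φ φ') (h2 : C1Per L φ' φ'')
    (h3 : C1Per L φ'' φ''') (hw : ContPer L w) (hφ : ∀ x, φ x = w x ^ 2) {ν : ℝ} (hν : 0 < ν)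
    (hνw : ∀ x, ν ≤ w x) (hode : ∀ x, -c * φ'' x + (c - 1) * φ x - w x ^ 3 + A = 0)
    (hco : IsCoercive L c w φ φ') :
    ∃ η : ℝ, 0 < η ∧ ∀ ε : ℝ, 0 < ε → ε ≤ η → ∃ ρ : ℝ, 0 < ρ ∧ ∀ a : HSpace,
      |‖a‖ ^ 2 - ‖toH L φ‖ ^ 2| < ρ → |mass L a - mass L (toH L φ)| < ρ →
      |lyapunov L c A a - lyapunov L c A (toH L φ)| < ρ →
      Metric.infDist a (orbit L (toH L φ)) ≠ ε := by
  obtain ⟨δ, C, α, β, hδ, hC, hcoer⟩ := hco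
  obtain ⟨K, hK, η, hη, hexp⟩ := lyapunov_expansion hL h1 h2 hw hφ hν hνw hode
  set B := |α| + |β| with hB
  have hB0 : 0 ≤ B := by positivity
  have hS : 0 ≤ 2 * C * B ^ 2 + K := by positivity
  -- The bound η admits the expansion, the bound 1 absorbs a spare factor ε, and the last one makes
  -- the errors at most δε²/8.
  refine ⟨min (min η 1) (δ / (8 * (2 * C * B ^ 2 + K + 1))),
    lt_min (lt_min hη one_pos) (by positivity), fun ε hε hεη => ?_⟩
  have hε1 : ε ≤ η := hεη.trans ((min_le_left _ _).trans (min_le_left _ _))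
  have hε2 : ε ≤ 1 := hεη.trans ((min_le_left _ _).trans (min_le_right _ _))
  have hε3 : ε ≤ δ / (8 * (2 * C * B ^ 2 + K + 1)) := hεη.trans (min_le_right _ _)
  rw [le_div_iff₀ (by positivity)] at hε3
  refine ⟨min 1 (δ / 8) * ε ^ 2, by positivity, fun a ha1 ha2 ha3 hD => ?_⟩
  set ρ := min 1 (δ / 8) * ε ^ 2 with hρ
  have hρ1 : ρ ≤ ε ^ 2 := by
    have := mul_le_mul_of_nonneg_right (min_le_left 1 (δ / 8)) (sq_nonneg ε)
    linarith
  have hρ2 : ρ ≤ δ / 8 * ε ^ 2 := mul_le_mul_of_nonneg_right (min_le_right 1 (δ / 8)) (sq_nonneg ε)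
  obtain ⟨r, -, hr2, hr3⟩ := exists_shift_inner_eq_zero hL h1 h2 h3 a
  set f := shift L (-r) a - toH L φ with hf
  have hfa : toH L φ + f = shift L (-r) a := by rw [hf]; abel
  rw [hD] at hr2
  have hq := hcoer f hr3
  have he := hexp f (by rw [hr2]; exact hε1)
  rw [hfa, lyapunov_shift hL] at he
  have hm : mass L f = mass L a - mass L (toH L φ) := by
    rw [hf, mass_eq_pair hL, map_sub, ← mass_eq_pair hL, ← mass_eq_pair hL, mass_shift hL]
  -- Near-equality of the norms makes ⟨φ, f⟩ of second order in ε, so its square is of fourth order.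
  have hi : 2 * inner ℝ (toH L φ) f = ‖a‖ ^ 2 - ‖toH L φ‖ ^ 2 - ε ^ 2 := by
    have := norm_add_sq_real (toH L φ) f
    rw [hfa, norm_shift hL, hr2] at this
    linarith
  have hi2 : |inner ℝ (toH L φ) f| ≤ ε ^ 2 := by
    rw [abs_lt] at ha1
    rw [abs_le]
    constructor <;> linarith only [ha1.1, ha1.2, hi, hρ1, sq_nonneg ε]
  have hl : |α * inner ℝ (toH L φ) f + β * mass L f| ≤ B * ε ^ 2 := by
    refine (abs_add_le _ _).trans ?_
    rw [abs_mul, abs_mul, hB, add_mul]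
    refine add_le_add (mul_le_mul_of_nonneg_left hi2 (abs_nonneg _))
      (mul_le_mul_of_nonneg_left ?_ (abs_nonneg _))
    rw [hm]; exact ha2.le.trans hρ1
  have hl2 : (α * inner ℝ (toH L φ) f + β * mass L f) ^ 2 ≤ (B * ε ^ 2) ^ 2 := by
    rw [← sq_abs]; exact pow_le_pow_left₀ (abs_nonneg _) hl 2
  rw [hr2] at hq he
  have hV := (abs_lt.1 ha3).2
  have h4 : C * (α * inner ℝ (toH L φ) f + β * mass L f) ^ 2 ≤ C * (B * ε ^ 2) ^ 2 :=
    mul_le_mul_of_nonneg_left hl2 hC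
  have hε2' : 0 < ε ^ 2 := by positivity
  have h5 : C * (B * ε ^ 2) ^ 2 ≤ C * B ^ 2 * ε * ε ^ 2 := by
    have : C * (B * ε ^ 2) ^ 2 = C * B ^ 2 * ε * ε ^ 2 * ε := by ring
    rw [this]
    exact mul_le_of_le_one_right (by positivity) hε2
  have h6 : (2 * C * B ^ 2 + K) * ε * ε ^ 2 ≤ δ / 8 * ε ^ 2 := by
    refine mul_le_mul_of_nonneg_right ?_ hε2'.le
    linarith only [hε3, hε]
  have h7 : 0 ≤ C * B ^ 2 * ε * ε ^ 2 := by positivity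
  linarith only [mul_pos hδ hε2', he, hq, hV, hρ2, h4, h5, h6, h7]

theorem continuous_lyapunov (hL : 0 < L) (c A : ℝ) : Continuous (lyapunov L c A) := by
  have h1 : Continuous (energy L) :=
    continuous_iff_continuousAt.2 fun a => (hasFDerivAt_energy hL a).continuousAt
  have h2 : Continuous (mass L) := by
    rw [show mass L = fun a => pairCLM hL (fun _ => 1) (ContPer.const 1) a from
      funext (mass_eq_pair hL)]
    exact (pairCLM hL _ _).continuous
  unfold lyapunov
  fun_prop

theorem orbitallyStable_of_isCoercive (hL : 0 < L) (h1 : C1Per L φ φ') (h2 : C1Per L φ' φ'')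
    (h3 : C1Per L φ'' φ''') (hw : ContPer L w) (hφ : ∀ x, φ x = w x ^ 2) {ν : ℝ} (hν : 0 < ν)
    (hνw : ∀ x, ν ≤ w x) (hode : ∀ x, -c * φ'' x + (c - 1) * φ x - w x ^ 3 + A = 0)
    (hco : IsCoercive L c w φ φ') : OrbitallyStable L φ := by
  obtain ⟨η, hη, hne⟩ := infDist_ne_of_isCoercive hL h1 h2 h3 hw hφ hν hνw hode hco
  have hfnφ : fn L (toH L φ) = φ := fn_toH hL (h1.hasH1 hL)
  intro ε hε
  have hN : 0 < √(normConst L) := Real.sqrt_pos.2 (normConst_pos L)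
  -- The constant compares the two norms of H¹. The factor 2 leaves room for the strict inequality
  -- after the supremum over time.
  set ε' := min η (ε / (2 * √(normConst L))) with hε'
  have hε'0 : 0 < ε' := lt_min hη (by positivity)
  obtain ⟨ρ, hρ, hne⟩ := hne ε' hε'0 (min_le_left _ _)
  have hmass : Continuous (mass L) := by
    rw [show mass L = fun a => pairCLM hL (fun _ => 1) (ContPer.const 1) a from
      funext (mass_eq_pair hL)]
    exact (pairCLM hL _ _).continuous
  have hcn : Continuous fun a : HSpace => ‖a‖ ^ 2 := by fun_prop
  have hev : ∀ᶠ a in 𝓝 (toH L φ), |‖a‖ ^ 2 - ‖toH L φ‖ ^ 2| < ρ ∧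
      |mass L a - mass L (toH L φ)| < ρ ∧
      |lyapunov L c A a - lyapunov L c A (toH L φ)| < ρ := by
    refine (Metric.tendsto_nhds.1 (hcn.tendsto _) ρ hρ).and
      ((Metric.tendsto_nhds.1 (hmass.tendsto _) ρ hρ).and
        (Metric.tendsto_nhds.1 ((continuous_lyapunov hL c A).tendsto _) ρ hρ))
  obtain ⟨d, hd, hball⟩ := Metric.eventually_nhds_iff.1 hev
  refine ⟨min d ε' / √(normConst L), by positivity, fun u₀ hu₀ hclose => ?_⟩
  have hfn0 : fn L (toH L u₀) = u₀ := fn_toH hL (hasH1_of_mem hL hu₀)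
  have hdist : ‖toH L u₀ - toH L φ‖ < min d ε' := by
    have hb := ofReal_norm_le hL (toH L u₀ - toH L φ)
    rw [← fn_sub_fun hL, hfn0, hfnφ] at hb
    have hlt : ENNReal.ofReal √(normConst L) * h1Norm L (u₀ - φ) <
        ENNReal.ofReal √(normConst L) * ENNReal.ofReal (min d ε' / √(normConst L)) :=
      ENNReal.mul_lt_mul_right (by simpa using hN) ENNReal.ofReal_ne_top hclose
    rw [← ENNReal.ofReal_mul hN.le, mul_div_cancel₀ _ hN.ne'] at hlt
    exact (ENNReal.ofReal_lt_ofReal_iff (by positivity)).1 (hb.trans_lt hlt)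
  obtain ⟨u, hu0, hnorm, hder⟩ :=
    exists_global_solution (field_lipschitz hL) (inner_field_self hL) (toH L u₀)
  refine ⟨fun t => fn L (u t), isSolution_of_hasDerivAt hL hu₀ hu0 hder,
    fun T hT v hv => eq_of_isSolution hL hu₀ hu0 hder hT hv, ?_⟩
  have hmass_const : ∀ t, mass L (u t) = mass L (toH L u₀) := fun t => by
    have hdm : ∀ s, HasDerivAt (fun s => mass L (u s)) 0 s := fun s => by
      have := (pairCLM hL (fun _ => 1) (ContPer.const 1)).hasFDerivAt.comp_hasDerivAt s (hder s)
      rw [← mass_eq_pair hL, mass_field hL] at this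
      exact this.congr_of_eventuallyEq (Eventually.of_forall fun s => mass_eq_pair hL _)
    have := is_const_of_deriv_eq_zero (fun s => (hdm s).differentiableAt)
      (fun s => (hdm s).deriv) t 0
    rwa [hu0] at this
  have henergy_const : ∀ t, energy L (u t) = energy L (toH L u₀) := fun t => by
    have hdm : ∀ s, HasDerivAt (fun s => energy L (u s)) 0 s := fun s => by
      have := (hasFDerivAt_energy hL (u s)).comp_hasDerivAt s (hder s)
      rwa [pair_flux_field hL] at this
    have := is_const_of_deriv_eq_zero (fun s => (hdm s).differentiableAt)
      (fun s => (hdm s).deriv) t 0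
    rwa [hu0] at this
  obtain ⟨hb1, hb2, hb3⟩ := hball (y := toH L u₀)
    (by rw [dist_eq_norm]; exact hdist.trans_le (min_le_left _ _))
  have hDne : ∀ t, Metric.infDist (u t) (orbit L (toH L φ)) ≠ ε' := fun t => by
    refine hne (u t) ?_ ?_ ?_
    · rw [hnorm]; exact hb1
    · rw [hmass_const]; exact hb2
    · rw [lyapunov, hnorm, hmass_const, henergy_const]; exact hb3
  have huc : Continuous u := continuous_iff_continuousAt.2 fun t => (hder t).continuousAt
  have hDc : Continuous fun t => Metric.infDist (u t) (orbit L (toH L φ)) :=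
    (Metric.continuous_infDist_pt _).comp huc
  have hD0 : Metric.infDist (u 0) (orbit L (toH L φ)) < ε' := by
    have hmem : toH L φ ∈ orbit L (toH L φ) := ⟨0, shift_zero hL (toH L φ)⟩
    refine (Metric.infDist_le_dist_of_mem hmem).trans_lt ?_
    rw [hu0, dist_eq_norm]
    exact hdist.trans_le (min_le_right _ _)
  -- The distance to the orbit is continuous in time, starts below ε' and never equals ε'.
  have hDlt : ∀ t, Metric.infDist (u t) (orbit L (toH L φ)) < ε' := fun t => by
    by_contra hcon
    obtain ⟨s, hs⟩ := mem_range_of_exists_le_of_exists_ge hDc ⟨0, hD0.le⟩ ⟨t, not_lt.1 hcon⟩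
    exact hDne s hs
  refine lt_of_le_of_lt (b := ENNReal.ofReal (ε / 2)) ?_
    ((ENNReal.ofReal_lt_ofReal_iff hε).2 (by linarith))
  refine iSup₂_le fun t _ => ?_
  obtain ⟨r, hr, -, -⟩ := exists_shift_inner_eq_zero hL h1 h2 h3 (u t)
  refine (iInf_le _ r).trans ?_
  have e : (fun x => φ (x + r)) = fn L (shift L r (toH L φ)) := by
    funext x; rw [fn_shift hL, hfnφ]
  rw [e, fn_sub_fun hL]
  refine (h1Norm_fn_le hL _).trans (ENNReal.ofReal_le_ofReal ?_)
  rw [hr]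
  have h8 : ε' ≤ ε / (2 * √(normConst L)) := min_le_right _ _
  have h9 := mul_le_mul_of_nonneg_left ((hDlt t).le.trans h8) hN.le
  refine h9.trans (le_of_eq ?_)
  field_simp

end

/-! ### Normalized profiles, the explicit functions `psi` and the moments. -/

section

/-- Normalized cnoidal profiles: even periodic solutions of `v'² = (lam/2)(v²/2 - 2v³/5 + a)` that
decrease from the origin to the half period. -/
structure WaveProfile (L lam a : ℝ) (v v' : ℝ → ℝ) : Prop where
  hL : 0 < L
  lam_pos : 0 < lam
  a_neg : a < 0
  per : Function.Periodic v L
  even : ∀ x, v (-x) = v x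
  pos : ∀ x, 0 < v x
  deriv : ∀ x, HasDerivAt v (v' x) x
  deriv2 : ∀ x, HasDerivAt v' (lam / 4 * (v x - 6 / 5 * v x ^ 2)) x
  energy : ∀ x, v' x ^ 2 = lam / 2 * (v x ^ 2 / 2 - 2 / 5 * v x ^ 3 + a)
  neg : ∀ x ∈ Ioo 0 (L / 2), v' x < 0
  top : 5 / 6 < v 0
  bot : v (L / 2) < 5 / 6

/-- The polynomial part of the functions `psi`. -/
def psiPoly (a μ s : ℝ) : ℝ := -4 * s ^ 3 + (5 - 4 * μ) * s ^ 2 + 5 * μ / 3 * s + 6 * a + 5 * μ / 6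

/-- The primitive of `v - μ` with value `-θ` at the origin. -/
def zeta (v : ℝ → ℝ) (μ θ x : ℝ) : ℝ := (∫ y in (0 : ℝ)..x, v y) - μ * x - θ

/-- Solutions of `-f''/lam + (1 - 3v/2) f = a + 6μa + 5μ/6`. -/
def psi (v v' : ℝ → ℝ) (a μ θ x : ℝ) : ℝ :=
  zeta v μ θ x * (2 * v x * v' x) + psiPoly a μ (v x)

/-- The derivative of `psi`. -/
def psiDeriv (lam : ℝ) (v v' : ℝ → ℝ) (a μ θ x : ℝ) : ℝ :=
  (v x - μ) * (2 * v x * v' x) + zeta v μ θ x * (lam * (v x ^ 2 - v x ^ 3 + a)) +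
    (-12 * v x ^ 2 + 2 * (5 - 4 * μ) * v x + 5 * μ / 3) * v' x

/-- The right-hand side of the equation satisfied by `psi`. -/
def kappa (a μ : ℝ) : ℝ := a + 6 * μ * a + 5 * μ / 6

namespace WaveProfile

variable {L lam a : ℝ} {v v' : ℝ → ℝ}

theorem cont (h : WaveProfile L lam a v v') : Continuous v :=
  continuous_iff_continuousAt.2 fun x => (h.deriv x).continuousAt

theorem cont' (h : WaveProfile L lam a v v') : Continuous v' :=
  continuous_iff_continuousAt.2 fun x => (h.deriv2 x).continuousAt

theorem c1Per (h : WaveProfile L lam a v v') : C1Per L v v' := ⟨h.per, h.deriv, h.cont'⟩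

theorem odd (h : WaveProfile L lam a v v') (x : ℝ) : v' (-x) = -v' x := by
  have h1 : HasDerivAt (fun y => v (-y)) (v' (-x) * -1) x :=
    (h.deriv (-x)).comp x (hasDerivAt_neg x)
  have h2 : (fun y => v (-y)) = v := funext h.even
  rw [h2] at h1
  linarith [h1.unique (h.deriv x)]

theorem reflect (h : WaveProfile L lam a v v') (x : ℝ) : v (L - x) = v x := by
  rw [← h.even, neg_sub, h.per.sub_eq]

theorem reflect' (h : WaveProfile L lam a v v') (x : ℝ) : v' (L - x) = -v' x := by
  rw [← h.odd, ← h.c1Per.per_deriv (-x), neg_add_eq_sub]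

theorem deriv_zero (h : WaveProfile L lam a v v') : v' 0 = 0 := by
  have := h.odd 0
  rw [neg_zero] at this
  linarith

theorem deriv_half (h : WaveProfile L lam a v v') : v' (L / 2) = 0 := by
  have := h.reflect' (L / 2)
  rw [sub_half] at this
  linarith

theorem hasDerivAt_zeta (h : WaveProfile L lam a v v') (μ θ x : ℝ) :
    HasDerivAt (zeta v μ θ) (v x - μ) x := by
  have h1 := (h.cont.integral_hasStrictDerivAt 0 x).hasDerivAt
  exact ((h1.sub ((hasDerivAt_id' x).const_mul μ)).sub_const θ).congr_deriv (by ring)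

theorem zeta_neg (h : WaveProfile L lam a v v') (μ x : ℝ) : zeta v μ 0 (-x) = -zeta v μ 0 x := by
  have : ∫ y in (0 : ℝ)..(-x), v y = -∫ y in (0 : ℝ)..x, v y := by
    have h1 := intervalIntegral.integral_comp_neg (a := 0) (b := x) v
    simp only [h.even, neg_zero] at h1
    rw [intervalIntegral.integral_symm, ← h1]
  unfold zeta
  rw [this]; ring

theorem zeta_add_period (h : WaveProfile L lam a v v') (μ θ x : ℝ) :
    zeta v μ θ (x + L) = zeta v μ θ x + ((∫ y in (0 : ℝ)..L, v y) - μ * L) := by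
  have h1 : ∫ y in (0 : ℝ)..(x + L), v y = (∫ y in (0 : ℝ)..x, v y) + ∫ y in x..(x + L), v y :=
    (intervalIntegral.integral_add_adjacent_intervals (h.cont.intervalIntegrable _ _)
      (h.cont.intervalIntegrable _ _)).symm
  have h2 := h.per.intervalIntegral_add_eq x 0
  rw [zero_add] at h2
  unfold zeta
  rw [h1, h2]; ring

theorem hasDerivAt_sq (h : WaveProfile L lam a v v') (x : ℝ) :
    HasDerivAt (fun x => v x ^ 2) (2 * v x * v' x) x := by
  exact ((h.deriv x).pow 2).congr_deriv (by push_cast; ring)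

theorem hasDerivAt_sq_deriv (h : WaveProfile L lam a v v') (x : ℝ) :
    HasDerivAt (fun x => 2 * v x * v' x) (lam * (v x ^ 2 - v x ^ 3 + a)) x := by
  refine (((h.deriv x).const_mul 2).mul (h.deriv2 x)).congr_deriv ?_
  linear_combination 2 * h.energy x

theorem hasDerivAt_psi (h : WaveProfile L lam a v v') (μ θ x : ℝ) :
    HasDerivAt (psi v v' a μ θ) (psiDeriv lam v v' a μ θ x) x := by
  have h1 := (h.hasDerivAt_zeta μ θ x).mul (h.hasDerivAt_sq_deriv x)
  have h2 := ((((h.deriv x).pow 3).const_mul (-4)).add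
    (((h.deriv x).pow 2).const_mul (5 - 4 * μ))).add ((h.deriv x).const_mul (5 * μ / 3))
  have h3 := (h2.add_const (6 * a)).add_const (5 * μ / 6)
  refine (h1.add h3).congr_deriv ?_
  unfold psiDeriv
  push_cast
  ring

/-- Let g = (v²)', which is annihilated by M = -∂²/lam + (1 - 3v/2). Then M(ζ g) = -(2ζ'g' +
ζ''g)/lam with ζ' = v - μ and ζ'' = v', and by the energy identity this is a polynomial in v. The
polynomial `psiPoly` is chosen so that only a constant remains. -/
theorem hasDerivAt_psiDeriv (h : WaveProfile L lam a v v') (μ θ x : ℝ) :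
    HasDerivAt (psiDeriv lam v v' a μ θ)
      (lam * ((1 - 3 / 2 * v x) * psi v v' a μ θ x - kappa a μ)) x := by
  have h1 := ((h.deriv x).sub_const μ).mul (h.hasDerivAt_sq_deriv x)
  have h2 := (h.hasDerivAt_zeta μ θ x).mul
    (((((h.deriv x).pow 2).sub ((h.deriv x).pow 3)).add_const a).const_mul lam)
  have h3 := (((((h.deriv x).pow 2).const_mul (-12)).add
    ((h.deriv x).const_mul (2 * (5 - 4 * μ)))).add_const (5 * μ / 3)).mul (h.deriv2 x)
  refine ((h1.add h2).add h3).congr_deriv ?_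
  unfold psi kappa psiPoly
  push_cast
  simp only [Pi.pow_apply, Pi.sub_apply, Pi.add_apply]
  linear_combination (2 * v x - 24 * v x + 2 * (5 - 4 * μ)) * h.energy x

theorem continuous_psi (h : WaveProfile L lam a v v') (μ θ : ℝ) : Continuous (psi v v' a μ θ) :=
  continuous_iff_continuousAt.2 fun x => (h.hasDerivAt_psi μ θ x).continuousAt

theorem continuous_psiDeriv (h : WaveProfile L lam a v v') (μ θ : ℝ) :
    Continuous (psiDeriv lam v v' a μ θ) :=
  continuous_iff_continuousAt.2 fun x => (h.hasDerivAt_psiDeriv μ θ x).continuousAt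

theorem psi_neg (h : WaveProfile L lam a v v') (μ x : ℝ) :
    psi v v' a μ 0 (-x) = psi v v' a μ 0 x := by
  unfold psi
  rw [h.zeta_neg, h.odd, h.even]; ring

/-- The Wronskian of `psi` and the derivative of `v²`. -/
theorem wronskian (h : WaveProfile L lam a v v') (μ θ x : ℝ) :
    psiDeriv lam v v' a μ θ x * (2 * v x * v' x) -
      psi v v' a μ θ x * (lam * (v x ^ 2 - v x ^ 3 + a)) =
      lam * (-a * (6 * a + 5 * μ / 6) - kappa a μ * v x ^ 2) := by
  unfold psi psiDeriv kappa psiPoly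
  linear_combination ((v x - μ) * 4 * v x ^ 2 +
    2 * v x * (-12 * v x ^ 2 + 2 * (5 - 4 * μ) * v x + 5 * μ / 3)) * h.energy x

theorem a_of_deriv_eq_zero (h : WaveProfile L lam a v v') {x : ℝ} (hx : v' x = 0) :
    a = 2 / 5 * v x ^ 3 - v x ^ 2 / 2 := by
  have := h.energy x
  rw [hx] at this
  have hl := h.lam_pos.ne'
  have h2 : lam * (v x ^ 2 / 2 - 2 / 5 * v x ^ 3 + a) = 0 := by linarith
  have := (mul_eq_zero.1 h2).resolve_left hl
  linarith

theorem sq_deriv_neg (h : WaveProfile L lam a v v') {x : ℝ} (hx : x ∈ Ioo 0 (L / 2)) :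
    2 * v x * v' x < 0 := by
  have := h.neg x hx
  have := h.pos x
  nlinarith

/-! ### Mean values -/

theorem integral_deriv_eq_zero {L : ℝ} {f f' : ℝ → ℝ} (hf : C1Per L f f') :
    ∫ x in (0 : ℝ)..L, f' x = 0 := by
  rw [intervalIntegral.integral_eq_sub_of_hasDerivAt (fun x _ => hf.deriv x)
    (hf.cont_deriv.intervalIntegrable _ _)]
  have := hf.per 0
  rw [zero_add] at this
  rw [this, sub_self]

/-- The integrals of the powers of `v` over a period. -/
def moment (L : ℝ) (v : ℝ → ℝ) (j : ℕ) : ℝ := ∫ x in (0 : ℝ)..L, v x ^ j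

/-- The derivative of vʲ v' integrates to zero over a period, and the profile equations turn it into
a polynomial in v. -/
theorem moment_recursion (h : WaveProfile L lam a v v') (j : ℕ) :
    2 * j * (moment L v (j + 1) / 2 - 2 / 5 * moment L v (j + 2) + a * moment L v (j - 1)) +
      (moment L v (j + 1) - 6 / 5 * moment L v (j + 2)) = 0 := by
  have hc := h.cont
  have hC : C1Per L (fun x => v x ^ j * v' x) (fun x => lam / 4 *
      (2 * j * (v x ^ (j + 1) / 2 - 2 / 5 * v x ^ (j + 2) + a * v x ^ (j - 1)) +
      (v x ^ (j + 1) - 6 / 5 * v x ^ (j + 2)))) := by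
    refine ⟨fun x => ?_, fun x => ?_, by fun_prop⟩
    · simp only [h.per x, h.c1Per.per_deriv x]
    · refine (((h.deriv x).pow j).mul (h.deriv2 x)).congr_deriv ?_
      -- For j = 0 the exponent j - 1 is truncated to 0, but its coefficient 2j vanishes.
      rcases j with _ | j
      · simp
      · simp only [Nat.add_sub_cancel, Pi.pow_apply]
        push_cast
        linear_combination (j + 1 : ℝ) * v x ^ j * h.energy x
  have hi : ∀ n : ℕ, IntervalIntegrable (fun x => v x ^ n) volume 0 L := fun n =>
    (hc.pow n).intervalIntegrable _ _
  have h1 := integral_deriv_eq_zero hC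
  rw [intervalIntegral.integral_const_mul] at h1
  have h2 := (mul_eq_zero.1 h1).resolve_left (by have := h.lam_pos; positivity)
  have e : (fun x => 2 * j * (v x ^ (j + 1) / 2 - 2 / 5 * v x ^ (j + 2) + a * v x ^ (j - 1)) +
      (v x ^ (j + 1) - 6 / 5 * v x ^ (j + 2))) = fun x => (j + 1) * v x ^ (j + 1) -
      (4 * j / 5 + 6 / 5) * v x ^ (j + 2) + 2 * j * a * v x ^ (j - 1) := by
    funext x; ring
  rw [e, intervalIntegral.integral_add (((hi _).const_mul _).sub ((hi _).const_mul _))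
    ((hi _).const_mul _), intervalIntegral.integral_sub ((hi _).const_mul _) ((hi _).const_mul _),
    intervalIntegral.integral_const_mul, intervalIntegral.integral_const_mul,
    intervalIntegral.integral_const_mul] at h2
  unfold moment
  linear_combination h2

theorem moment_zero (L : ℝ) (v : ℝ → ℝ) : moment L v 0 = L := by simp [moment]

theorem moment_two (h : WaveProfile L lam a v v') : moment L v 2 = 5 / 6 * moment L v 1 := by
  have := h.moment_recursion 0
  norm_num at this
  linarith

theorem moment_three (h : WaveProfile L lam a v v') :
    moment L v 3 = 5 / 6 * moment L v 1 + a * L := by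
  have := h.moment_recursion 1
  norm_num [moment_zero] at this
  linarith [h.moment_two]

theorem moment_four (h : WaveProfile L lam a v v') :
    moment L v 4 = 5 / 14 * (5 / 2 * moment L v 1 + 3 * a * L + 4 * a * moment L v 1) := by
  have := h.moment_recursion 2
  norm_num at this
  linarith [h.moment_three]

theorem moment_five (h : WaveProfile L lam a v v') :
    moment L v 5 = 5 / 18 * (4 * moment L v 4 + 5 * a * moment L v 1) := by
  have := h.moment_recursion 3
  norm_num at this
  have h2 := h.moment_two
  rw [h2] at this
  linarith

theorem moment_one_pos (h : WaveProfile L lam a v v') : 0 < moment L v 1 := by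
  unfold moment
  simp only [pow_one]
  exact intervalIntegral.intervalIntegral_pos_of_pos (h.cont.intervalIntegrable _ _) h.pos h.hL

/-- This is ∫ v'² > 0, expressed through the moments. -/
theorem neg_a_lt (h : WaveProfile L lam a v v') : -a * L < 5 / 36 * moment L v 1 := by
  have hL := h.hL
  have hc := h.cont'
  have hpos : 0 < ∫ x in (0 : ℝ)..L, v' x ^ 2 := by
    refine intervalIntegral.integral_pos hL (by fun_prop) (fun x _ => sq_nonneg _)
      ⟨L / 4, ⟨by linarith, by linarith⟩, ?_⟩
    have := (h.neg (L / 4) ⟨by linarith, by linarith⟩).ne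
    positivity
  have hc := h.cont
  have hi : ∀ n : ℕ, IntervalIntegrable (fun x => v x ^ n) volume 0 L := fun n =>
    (hc.pow n).intervalIntegrable _ _
  have e : ∫ x in (0 : ℝ)..L, v' x ^ 2 =
      lam / 2 * (moment L v 2 / 2 - 2 / 5 * moment L v 3 + a * L) := by
    simp only [h.energy]
    rw [intervalIntegral.integral_const_mul, intervalIntegral.integral_add
      (((hi 2).div_const 2).sub ((hi 3).const_mul _)) intervalIntegrable_const,
      intervalIntegral.integral_sub ((hi 2).div_const 2) ((hi 3).const_mul _),
      intervalIntegral.integral_div, intervalIntegral.integral_const_mul]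
    simp only [moment, intervalIntegral.integral_const, smul_eq_mul, sub_zero]; ring
  rw [e] at hpos
  have := (mul_pos_iff_of_pos_left (by have := h.lam_pos; positivity)).1 hpos
  rw [h.moment_two, h.moment_three] at this
  linarith

/-- The variance of v is nonnegative and its second moment is 5/6 of the first. -/
theorem moment_one_le (h : WaveProfile L lam a v v') : moment L v 1 ≤ 5 / 6 * L := by
  have hL := h.hL
  have hc := h.cont
  set m := moment L v 1 / L with hm
  have hi : ∀ n : ℕ, IntervalIntegrable (fun x => v x ^ n) volume 0 L := fun n =>
    (hc.pow n).intervalIntegrable _ _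
  have h0 : 0 ≤ ∫ x in (0 : ℝ)..L, (v x - m) ^ 2 :=
    intervalIntegral.integral_nonneg hL.le fun x _ => sq_nonneg _
  have e : (fun x => (v x - m) ^ 2) = fun x => v x ^ 2 - 2 * m * v x ^ 1 + m ^ 2 := by
    funext x; ring
  rw [e, intervalIntegral.integral_add ((hi 2).sub ((hi 1).const_mul _)) intervalIntegrable_const,
    intervalIntegral.integral_sub (hi 2) ((hi 1).const_mul _),
    intervalIntegral.integral_const_mul, intervalIntegral.integral_const, sub_zero,
    smul_eq_mul] at h0
  have h1 : moment L v 2 - 2 * m * moment L v 1 + L * m ^ 2 ≥ 0 := h0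
  rw [h.moment_two] at h1
  have h2 : moment L v 1 = m * L := by rw [hm]; field_simp
  have hmp : 0 < m := div_pos h.moment_one_pos hL
  rw [h2] at h1 ⊢
  have h3 : 0 ≤ (m * L) * (5 / 6 - m) := by nlinarith
  have h4 : 0 ≤ 5 / 6 - m := nonneg_of_mul_nonneg_right h3 (by positivity)
  nlinarith

end WaveProfile

end

/-! ### Positivity of the quadratic form on functions with two prescribed zeros. -/

section

/-- A positive strict supersolution bounds the Dirichlet form of `-f''/lam + (1 - 3v/2) f` from
below. -/
theorem exists_lower_bound_of_supersolution {lam k α β : ℝ} {v E E' : ℝ → ℝ} (hab : α ≤ β)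
    (hlam : 0 < lam) (hv : Continuous v) (hE : ∀ x, HasDerivAt E (E' x) x)
    (hE' : ∀ x, HasDerivAt E' (lam * ((1 - 3 / 2 * v x) * E x - k)) x) (hk : 0 < k)
    (hpos : ∀ x ∈ Icc α β, 0 < E x) :
    ∃ ε : ℝ, 0 < ε ∧ ∀ f f' : ℝ → ℝ, (∀ x, HasDerivAt f (f' x) x) → Continuous f' → f α = 0 →
      f β = 0 → ε * ∫ x in α..β, f x ^ 2 ≤
        ∫ x in α..β, (f' x ^ 2 / lam + (1 - 3 / 2 * v x) * f x ^ 2) := by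
  have hEc : Continuous E := continuous_iff_continuousAt.2 fun x => (hE x).continuousAt
  have hEc' : Continuous E' := continuous_iff_continuousAt.2 fun x => (hE' x).continuousAt
  obtain ⟨N, hN⟩ := isCompact_Icc.exists_bound_of_continuousOn (hEc.continuousOn (s := Icc α β))
  have hN1 : ∀ x ∈ Icc α β, E x ≤ N := fun x hx => (le_abs_self _).trans (hN x hx)
  have hN0 : 0 < N := (hpos α ⟨le_rfl, hab⟩).trans_le (hN1 α ⟨le_rfl, hab⟩)
  refine ⟨k / N, by positivity, fun f f' hf hf' hα hβ => ?_⟩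
  have hfc : Continuous f := continuous_iff_continuousAt.2 fun x => (hf x).continuousAt
  -- Picone's identity: F' integrates to zero because f vanishes at both ends. After subtracting
  -- F'/lam, the integrand of the form is (f' - (E'/E) f)²/lam + (k/E) f².
  set F : ℝ → ℝ := fun x => E' x / E x * f x ^ 2 with hF
  set F' : ℝ → ℝ := fun x => (lam * ((1 - 3 / 2 * v x) * E x - k) * E x - E' x * E' x) / E x ^ 2 *
    f x ^ 2 + E' x / E x * (2 * f x * f' x) with hF'
  have hd : ∀ x ∈ uIcc α β, HasDerivAt F (F' x) x := fun x hx => by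
    rw [uIcc_of_le hab] at hx
    have h1 := ((hE' x).div (hE x) (hpos x hx).ne').mul ((hf x).pow 2)
    refine h1.congr_deriv ?_
    simp only [hF', Pi.div_apply, Pi.pow_apply]
    push_cast
    ring
  have hne : ∀ x ∈ Icc α β, E x ≠ 0 := fun x hx => (hpos x hx).ne'
  have hne2 : ∀ x ∈ Icc α β, E x ^ 2 ≠ 0 := fun x hx => pow_ne_zero 2 (hne x hx)
  have hFc : ContinuousOn F' (Icc α β) := by
    refine ContinuousOn.add (ContinuousOn.mul (ContinuousOn.div ?_ ?_ hne2) ?_)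
      (ContinuousOn.mul (ContinuousOn.div ?_ ?_ hne) ?_)
    all_goals exact Continuous.continuousOn (by fun_prop)
  have hFi : IntervalIntegrable F' volume α β := hFc.intervalIntegrable_of_Icc hab
  have h0 : ∫ x in α..β, F' x = 0 := by
    rw [intervalIntegral.integral_eq_sub_of_hasDerivAt hd hFi]
    simp [hF, hα, hβ]
  have hfi : IntervalIntegrable (fun x => f x ^ 2) volume α β :=
    (hfc.pow 2).intervalIntegrable _ _
  have hle : ∫ x in α..β, (k / N * f x ^ 2 + 1 / lam * F' x) ≤
      ∫ x in α..β, (f' x ^ 2 / lam + (1 - 3 / 2 * v x) * f x ^ 2) := by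
    refine intervalIntegral.integral_mono_on hab ((hfi.const_mul _).add (hFi.const_mul _))
      (Continuous.intervalIntegrable (by fun_prop) _ _) fun x hx => ?_
    have hEx := hpos x hx
    have e : f' x ^ 2 / lam + (1 - 3 / 2 * v x) * f x ^ 2 -
        (k / N * f x ^ 2 + 1 / lam * F' x) =
        (f' x - E' x / E x * f x) ^ 2 / lam + (k / E x - k / N) * f x ^ 2 := by
      simp only [hF']
      field_simp
      ring
    have h1 : k / N ≤ k / E x := div_le_div_of_nonneg_left hk.le hEx (hN1 x hx)
    have h2 : 0 ≤ (f' x - E' x / E x * f x) ^ 2 / lam + (k / E x - k / N) * f x ^ 2 :=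
      add_nonneg (by positivity) (mul_nonneg (sub_nonneg.2 h1) (sq_nonneg _))
    linarith
  rwa [intervalIntegral.integral_add (hfi.const_mul _) (hFi.const_mul _),
    intervalIntegral.integral_const_mul, intervalIntegral.integral_const_mul, h0, mul_zero,
    add_zero] at hle

theorem exists_pos_perturbation {e g : ℝ → ℝ} (he : Continuous e) (hg : Continuous g) {α β : ℝ}
    (hab : α ≤ β) (hpos : ∀ x ∈ Icc α β, 0 < e x) :
    ∃ τ : ℝ, 0 < τ ∧ ∀ x ∈ Icc α β, 0 < e x + τ * g x := by
  obtain ⟨x₀, hx₀, hmin⟩ := isCompact_Icc.exists_isMinOn ⟨α, le_rfl, hab⟩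
    (he.continuousOn (s := Icc α β))
  obtain ⟨N, hN⟩ := isCompact_Icc.exists_bound_of_continuousOn (hg.continuousOn (s := Icc α β))
  have hN0 : 0 ≤ N := (norm_nonneg _).trans (hN x₀ hx₀)
  have hm := hpos x₀ hx₀
  refine ⟨e x₀ / (2 * (N + 1)), by positivity, fun x hx => ?_⟩
  have h1 : e x₀ ≤ e x := hmin hx
  have h2 := (abs_le.1 (hN x hx)).1
  have h3 : e x₀ / (2 * (N + 1)) * (N + 1) = e x₀ / 2 := by field_simp
  have h4 : 0 < e x₀ / (2 * (N + 1)) := by positivity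
  nlinarith

namespace WaveProfile

variable {L lam a : ℝ} {v v' : ℝ → ℝ}

theorem neg_a_lt_const (h : WaveProfile L lam a v v') : -a < 25 / 216 := by
  have h1 := h.neg_a_lt
  have h2 := h.moment_one_le
  have hL := h.hL
  nlinarith

/-- The value of the parameter for which `psi` solves the homogeneous equation. -/
theorem exists_kappa_eq_zero (h : WaveProfile L lam a v v') :
    ∃ μ : ℝ, kappa a μ = 0 ∧ μ * L < moment L v 1 ∧ -a * (6 * a + 5 * μ / 6) < 0 := by
  have hb := h.neg_a_lt_const
  have ha := h.a_neg
  have hL := h.hL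
  have h1 := h.neg_a_lt
  have hM := h.moment_one_pos
  have hd : 0 < 6 * a + 5 / 6 := by linarith
  -- The parameter κ is affine in μ and this is its root. The other two claims use 6a + 5/6 > 5/36,
  -- which is the bound -a < 25/216.
  refine ⟨-a / (6 * a + 5 / 6), ?_, ?_, ?_⟩
  · have := div_mul_cancel₀ (-a) hd.ne'
    unfold kappa; linarith
  · rw [div_mul_eq_mul_div, div_lt_iff₀ hd]
    nlinarith
  · have : -a / (6 * a + 5 / 6) < -36 / 5 * a := by
      rw [div_lt_iff₀ hd]; nlinarith
    nlinarith

theorem psi_sub_const (μ θ x : ℝ) :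
    psi v v' a μ θ x = psi v v' a μ 0 x - θ * (2 * v x * v' x) := by
  unfold psi zeta; ring

theorem psi_perturb (μ τ θ x : ℝ) : psi v v' a (μ + τ) θ x = psi v v' a μ θ x +
    τ * (-x * (2 * v x * v' x) - 4 * v x ^ 2 + 5 / 3 * v x + 5 / 6) := by
  unfold psi zeta psiPoly; ring

theorem two_mul_integral_half (h : WaveProfile L lam a v v') :
    2 * ∫ x in (0 : ℝ)..L / 2, v x = moment L v 1 := by
  have hi : ∀ α β, IntervalIntegrable v volume α β := fun _ _ => h.cont.intervalIntegrable _ _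
  have h1 := intervalIntegral.integral_add_adjacent_intervals (hi 0 (L / 2)) (hi (L / 2) L)
  have h2 := intervalIntegral.integral_comp_sub_left (a := 0) (b := L / 2) v L
  simp only [h.reflect, sub_zero, sub_half] at h2
  unfold moment
  simp only [pow_one]
  linarith

theorem kappa_perturb (μ τ : ℝ) : kappa a (μ + τ) = kappa a μ + τ * (6 * a + 5 / 6) := by
  unfold kappa; ring

/-- Sign conditions for two members of the family `psi` on complementary arcs of a period. -/
theorem exists_node (h : WaveProfile L lam a v v') :
    ∃ x₀ ∈ Ioo 0 (L / 2), ∃ μ₁ μ₂ θ : ℝ, kappa a μ₁ < 0 ∧ 0 < kappa a μ₂ ∧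
      (∀ x ∈ Icc (-x₀) x₀, psi v v' a μ₁ 0 x < 0) ∧
      ∀ x ∈ Icc x₀ (L - x₀), 0 < psi v v' a μ₂ θ x := by
  have hL := h.hL
  have hlam := h.lam_pos
  obtain ⟨μ, hμ0, hμ1, hμ2⟩ := h.exists_kappa_eq_zero
  set e := psi v v' a μ 0 with he
  set g : ℝ → ℝ := fun x => 2 * v x * v' x with hg
  -- The choice θ = Z moves the zero of `zeta` to L/2 and makes that member of the family symmetric
  -- about L/2. Positivity of Z, that is μ below the mean of v, leaves room for a common node of the
  -- two arcs.
  set Z := zeta v μ 0 (L / 2) with hZ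
  have hZ0 : 0 < Z := by
    have := h.two_mul_integral_half
    rw [hZ, zeta]; linarith
  have hec : Continuous e := h.continuous_psi μ 0
  have hvc := h.cont
  have hvc' := h.cont'
  have hgc : Continuous g := by fun_prop
  -- For κ = 0 both e and g solve the homogeneous equation, so their Wronskian is constant, and it
  -- is negative. It fixes the signs of e at 0 and L/2, where g vanishes, and makes e/g strictly
  -- decreasing between them.
  have hW : ∀ x, psiDeriv lam v v' a μ 0 x * g x - e x * (lam * (v x ^ 2 - v x ^ 3 + a)) < 0 :=
    fun x => by
      have := h.wronskian μ 0 x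
      rw [hμ0, zero_mul, sub_zero] at this
      rw [this]
      exact mul_neg_of_pos_of_neg hlam hμ2
  have he0 : e 0 < 0 := by
    have h1 := hW 0
    have h2 : g 0 = 0 := by simp only [hg, h.deriv_zero, mul_zero]
    have h3 := h.a_of_deriv_eq_zero h.deriv_zero
    have h4 := h.top
    rw [h2, mul_zero, zero_sub, neg_lt_zero] at h1
    have h5 : lam * (v 0 ^ 2 - v 0 ^ 3 + a) < 0 := by
      refine mul_neg_of_pos_of_neg hlam ?_
      have : v 0 ^ 2 - v 0 ^ 3 + a = v 0 ^ 2 * (1 / 2 - 3 / 5 * v 0) := by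
        linear_combination h3
      rw [this]
      exact mul_neg_of_pos_of_neg (by positivity) (by linarith)
    by_contra hcon
    exact absurd h1 (not_lt.2 (mul_nonpos_of_nonneg_of_nonpos (not_lt.1 hcon) h5.le))
  have heL : 0 < e (L / 2) := by
    have h1 := hW (L / 2)
    have h2 : g (L / 2) = 0 := by simp only [hg, h.deriv_half, mul_zero]
    have h3 := h.a_of_deriv_eq_zero h.deriv_half
    have h4 := h.bot
    have h4' := h.pos (L / 2)
    rw [h2, mul_zero, zero_sub, neg_lt_zero] at h1
    have h5 : 0 < lam * (v (L / 2) ^ 2 - v (L / 2) ^ 3 + a) := by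
      refine mul_pos hlam ?_
      have : v (L / 2) ^ 2 - v (L / 2) ^ 3 + a = v (L / 2) ^ 2 * (1 / 2 - 3 / 5 * v (L / 2)) := by
        linear_combination h3
      rw [this]
      exact mul_pos (by positivity) (by linarith)
    exact (mul_pos_iff_of_pos_right h5).1 h1
  have hanti : StrictAntiOn (fun x => e x / g x) (Ioo 0 (L / 2)) := by
    have hd : ∀ x ∈ Ioo 0 (L / 2), HasDerivAt (fun x => e x / g x)
        ((psiDeriv lam v v' a μ 0 x * g x - e x * (lam * (v x ^ 2 - v x ^ 3 + a))) / g x ^ 2) x :=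
      fun x hx => (h.hasDerivAt_psi μ 0 x).div (h.hasDerivAt_sq_deriv x) (h.sq_deriv_neg hx).ne
    refine strictAntiOn_of_deriv_neg (convex_Ioo _ _)
      (fun x hx => (hd x hx).continuousAt.continuousWithinAt) fun x hx => ?_
    rw [interior_Ioo] at hx
    rw [(hd x hx).deriv]
    have := (h.sq_deriv_neg hx).ne
    exact div_neg_of_neg_of_pos (hW x) (by positivity)
  -- The level Z/2 lies strictly between 0 and Z. Since g < 0 on the open half period, e/g ≥ Z/2
  -- gives e < 0 to the left of x₀, and e/g ≤ Z/2 < Z gives e - Z g > 0 to the right.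
  obtain ⟨x₀, hx₀, hroot⟩ : ∃ x₀ ∈ Ioo 0 (L / 2), e x₀ = Z / 2 * g x₀ := by
    have hcont : ContinuousOn (fun x => e x - Z / 2 * g x) (Icc 0 (L / 2)) :=
      Continuous.continuousOn (by fun_prop)
    have h2 : g 0 = 0 := by simp only [hg, h.deriv_zero, mul_zero]
    have h3 : g (L / 2) = 0 := by simp only [hg, h.deriv_half, mul_zero]
    have := intermediate_value_Ioo (by linarith : (0 : ℝ) ≤ L / 2) hcont
    obtain ⟨x, hx, hx0⟩ := this (show (0 : ℝ) ∈ Ioo _ _ by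
      simp only [h2, h3, mul_zero, sub_zero]; exact ⟨he0, heL⟩)
    exact ⟨x, hx, by simp only at hx0; linarith⟩
  have hg0 := h.sq_deriv_neg hx₀
  have hG0 : e x₀ / g x₀ = Z / 2 := by rw [hroot, mul_div_cancel_right₀ _ hg0.ne]
  have hneg1 : ∀ x ∈ Icc 0 x₀, e x < 0 := by
    intro x hx
    rcases hx.1.eq_or_lt with rfl | hx1
    · exact he0
    have hxm : x ∈ Ioo 0 (L / 2) := ⟨hx1, hx.2.trans_lt hx₀.2⟩
    have h1 := hanti.antitoneOn hxm hx₀ hx.2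
    simp only [hG0] at h1
    have h2 : g x < 0 := h.sq_deriv_neg hxm
    by_contra hcon
    have := div_nonpos_of_nonneg_of_nonpos (not_lt.1 hcon) h2.le
    linarith
  have hneg : ∀ x ∈ Icc (-x₀) x₀, e x < 0 := by
    intro x hx
    rcases le_total 0 x with h0 | h0
    · exact hneg1 x ⟨h0, hx.2⟩
    · rw [he, ← h.psi_neg]
      exact hneg1 (-x) ⟨by linarith, by linarith [hx.1]⟩
  have hpos1 : ∀ x ∈ Icc x₀ (L / 2), 0 < e x - Z * g x := by
    intro x hx
    rcases hx.2.eq_or_lt with rfl | hx1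
    · have h3 : g (L / 2) = 0 := by simp only [hg, h.deriv_half, mul_zero]
      rw [h3, mul_zero, sub_zero]; exact heL
    have hxm : x ∈ Ioo 0 (L / 2) := ⟨hx₀.1.trans_le hx.1, hx1⟩
    have h1 := hanti.antitoneOn hx₀ hxm hx.1
    simp only [hG0] at h1
    have h2 : g x < 0 := h.sq_deriv_neg hxm
    rw [div_le_iff_of_neg h2] at h1
    nlinarith
  have hpos : ∀ x ∈ Icc x₀ (L - x₀), 0 < psi v v' a μ Z x := by
    intro x hx
    rw [psi_sub_const]
    rcases le_total x (L / 2) with h0 | h0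
    · exact hpos1 x ⟨hx.1, h0⟩
    · have h1 := hpos1 (L - x) ⟨by linarith [hx.2], by linarith⟩
      have h2 : e (L - x) - Z * g (L - x) = psi v v' a μ 0 x - Z * (2 * v x * v' x) := by
        have hz : zeta v μ 0 (L - x) = 2 * Z - zeta v μ 0 x := by
          have h3 := h.zeta_add_period μ 0 (-x)
          rw [neg_add_eq_sub, h.zeta_neg] at h3
          have h4 := h.two_mul_integral_half
          have h5 : ∫ y in (0 : ℝ)..L, v y = moment L v 1 := by simp [moment]
          rw [h3, h5, hZ]
          have h6 : zeta v μ 0 (L / 2) = (∫ y in (0 : ℝ)..L / 2, v y) - μ * (L / 2) - 0 := rfl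
          rw [h6]; linarith
        simp only [he, hg, psi, h.reflect, h.reflect', hz]
        ring
      rwa [h2] at h1
  have hb : 0 < 6 * a + 5 / 6 := by linarith [h.neg_a_lt_const]
  -- Θ is the derivative of `psi` in μ. Moving μ slightly down or up makes κ strictly negative or
  -- positive and keeps the strict signs on the compact arcs.
  set Θ : ℝ → ℝ := fun x => -x * (2 * v x * v' x) - 4 * v x ^ 2 + 5 / 3 * v x + 5 / 6 with hΘ
  have hΘc : Continuous Θ := by fun_prop
  obtain ⟨τ₁, hτ₁, hp1⟩ := exists_pos_perturbation (e := fun x => -e x) (g := Θ) (by fun_prop) hΘc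
    (by linarith [hx₀.1] : -x₀ ≤ x₀) fun x hx => neg_pos.2 (hneg x hx)
  obtain ⟨τ₂, hτ₂, hp2⟩ := exists_pos_perturbation (h.continuous_psi μ Z) hΘc
    (by linarith [hx₀.2] : x₀ ≤ L - x₀) hpos
  refine ⟨x₀, hx₀, μ + -τ₁, μ + τ₂, Z, ?_, ?_, fun x hx => ?_, fun x hx => ?_⟩
  · rw [kappa_perturb, hμ0]; nlinarith
  · rw [kappa_perturb, hμ0]; nlinarith
  · rw [psi_perturb]
    have := hp1 x hx
    simp only [hΘ] at this
    linarith
  · rw [psi_perturb]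
    exact hp2 x hx

/-- The quadratic form of `-f''/lam + (1 - 3v/2) f` is positive on functions that vanish at two
suitable points. -/
theorem exists_form_lower_bound (h : WaveProfile L lam a v v') :
    ∃ x₀ ∈ Ioo 0 (L / 2), ∃ ε : ℝ, 0 < ε ∧ ∀ f f' : ℝ → ℝ, C1Per L f f' → f x₀ = 0 →
      f (-x₀) = 0 → ε * ∫ x in (0 : ℝ)..L, f x ^ 2 ≤
        ∫ x in (0 : ℝ)..L, (f' x ^ 2 / lam + (1 - 3 / 2 * v x) * f x ^ 2) := by
  obtain ⟨x₀, hx₀, μ₁, μ₂, θ, hk1, hk2, hn, hp⟩ := h.exists_node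
  obtain ⟨ε₁, hε₁, hb1⟩ := exists_lower_bound_of_supersolution (E := fun x => -psi v v' a μ₁ 0 x)
    (by linarith [hx₀.1] : -x₀ ≤ x₀) h.lam_pos h.cont (fun x => (h.hasDerivAt_psi μ₁ 0 x).neg)
    (fun x => ((h.hasDerivAt_psiDeriv μ₁ 0 x).neg).congr_deriv
      (by ring : _ = lam * ((1 - 3 / 2 * v x) * -psi v v' a μ₁ 0 x - -kappa a μ₁)))
    (neg_pos.2 hk1) fun x hx => neg_pos.2 (hn x hx)
  obtain ⟨ε₂, hε₂, hb2⟩ := exists_lower_bound_of_supersolution (E := psi v v' a μ₂ θ)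
    (by linarith [hx₀.2] : x₀ ≤ L - x₀) h.lam_pos h.cont (fun x => h.hasDerivAt_psi μ₂ θ x)
    (fun x => h.hasDerivAt_psiDeriv μ₂ θ x) hk2 hp
  refine ⟨x₀, hx₀, min ε₁ ε₂, lt_min hε₁ hε₂, fun f f' hf h1 h2 => ?_⟩
  have hvc := h.cont
  have hfc := hf.contPer.cont
  have hfc' := hf.cont_deriv
  have h3 : f (L - x₀) = 0 := by rw [← neg_add_eq_sub, hf.per, h2]
  have hsplit : ∀ F : ℝ → ℝ, Continuous F → Function.Periodic F L → ∫ x in (0 : ℝ)..L, F x =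
      (∫ x in (-x₀)..x₀, F x) + ∫ x in x₀..(L - x₀), F x := fun F hF hper => by
    rw [intervalIntegral.integral_add_adjacent_intervals (hF.intervalIntegrable _ _)
      (hF.intervalIntegrable _ _)]
    have := hper.intervalIntegral_add_eq 0 (-x₀)
    rwa [zero_add, neg_add_eq_sub] at this
  rw [hsplit (fun x => f x ^ 2) (by fun_prop) (fun x => by simp only [hf.per x]),
    hsplit _ (by fun_prop) (fun x => by simp only [hf.per x, hf.per_deriv x, h.per x]), mul_add]
  have i1 : 0 ≤ ∫ x in (-x₀)..x₀, f x ^ 2 :=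
    intervalIntegral.integral_nonneg (by linarith [hx₀.1]) fun x _ => sq_nonneg _
  have i2 : 0 ≤ ∫ x in x₀..(L - x₀), f x ^ 2 :=
    intervalIntegral.integral_nonneg (by linarith [hx₀.2]) fun x _ => sq_nonneg _
  refine add_le_add ?_ ?_
  · exact (mul_le_mul_of_nonneg_right (min_le_left _ _) i1).trans
      (hb1 f f' hf.deriv hfc' h2 h1)
  · exact (mul_le_mul_of_nonneg_right (min_le_right _ _) i2).trans
      (hb2 f f' hf.deriv hfc' h1 h3)

end WaveProfile

end

/-! ### The Hessian as a bilinear form and a criterion for coercivity. -/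

section

variable {L c : ℝ} {w : ℝ → ℝ}

/-- The bilinear form of `hessian`, as a functional of its second argument. -/
def hessForm (hL : 0 < L) (c : ℝ) (hw : ContPer L w) (f : HSpace) : HSpace →L[ℝ] ℝ :=
  c • innerSL ℝ f - pairCLM hL (fun x => (1 + 3 / 2 * w x) * fn L f x)
    (((ContPer.const 1).add (hw.const_mul (3 / 2))).mul (contPer_fn hL f))

theorem hessForm_apply (hL : 0 < L) (hw : ContPer L w) (f g : HSpace) :
    hessForm hL c hw f g =
      c * inner ℝ f g - ∫ x in (0 : ℝ)..L, (1 + 3 / 2 * w x) * fn L f x * fn L g x := rfl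

theorem hessForm_comm (hL : 0 < L) (hw : ContPer L w) (f g : HSpace) :
    hessForm hL c hw f g = hessForm hL c hw g f := by
  rw [hessForm_apply, hessForm_apply, real_inner_comm]
  congr 2; funext x; ring

theorem hessForm_self (hL : 0 < L) (hw : ContPer L w) (f : HSpace) :
    hessForm hL c hw f f = hessian L c w f := by
  rw [hessForm_apply, hessian, real_inner_self_eq_norm_sq]
  congr 2; funext x; ring

theorem hessian_add_smul (hL : 0 < L) (hw : ContPer L w) (f g : HSpace) (t : ℝ) :
    hessian L c w (f + t • g) =
      hessian L c w f + 2 * t * hessForm hL c hw g f + t ^ 2 * hessian L c w g := by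
  rw [← hessForm_self hL hw, ← hessForm_self hL hw, ← hessForm_self hL hw, map_add, map_smul,
    hessForm_comm hL hw _ f, hessForm_comm hL hw _ g, map_add, map_add, map_smul, map_smul,
    hessForm_comm hL hw f g]
  simp only [smul_eq_mul]; ring

theorem abs_hessian_le (hL : 0 < L) (c : ℝ) (hw : ContPer L w) :
    ∃ K : ℝ, 0 ≤ K ∧ ∀ f : HSpace, |hessian L c w f| ≤ K * ‖f‖ ^ 2 := by
  obtain ⟨C, hC0, hC⟩ := ((ContPer.const 1).add (hw.const_mul (3 / 2))).exists_bound hL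
  refine ⟨|c| + L * (C * supConst L ^ 2), by positivity, fun f => ?_⟩
  refine (abs_sub _ _).trans ?_
  rw [abs_mul, abs_of_nonneg (sq_nonneg ‖f‖), add_mul]
  refine add_le_add le_rfl ?_
  rw [mul_assoc]
  refine integral_le_of_abs_le hL fun x => ?_
  rw [abs_mul, mul_assoc, ← mul_pow, abs_pow]
  exact mul_le_mul (hC x) (pow_le_pow_left₀ (abs_nonneg _) (abs_fn_le hL f x) 2)
    (by positivity) hC0

theorem continuous_hessian (hL : 0 < L) (c : ℝ) (hw : ContPer L w) :
    Continuous (hessian L c w) := by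
  refine continuous_iff_continuousAt.2 fun a => ?_
  obtain ⟨K, hK0, hK⟩ := abs_hessian_le hL c hw
  have : HasFDerivAt (hessian L c w) ((2 : ℝ) • hessForm hL c hw a) a := by
    refine hasFDerivAt_of_norm_sub_le_sq hK0 fun b _ => ?_
    have h := hessian_add_smul (c := c) hL hw a (b - a) 1
    rw [one_smul, add_sub_cancel, hessForm_comm] at h
    have e : hessian L c w b - hessian L c w a - ((2 : ℝ) • hessForm hL c hw a) (b - a) =
        hessian L c w (b - a) := by
      rw [h, smul_apply, smul_eq_mul]; ring
    rw [e]
    exact hK _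
  exact this.continuousAt

theorem hessForm_toH (hL : 0 < L) (hw : ContPer L w) {ψ ψ' ψ'' : ℝ → ℝ} (h : C1Per L ψ ψ')
    (h' : C1Per L ψ' ψ'') (f : HSpace) : hessForm hL c hw (toH L ψ) f =
      ∫ x in (0 : ℝ)..L, fn L f x * (c * (ψ x - ψ'' x) - (1 + 3 / 2 * w x) * ψ x) := by
  have hf := (contPer_fn hL f).cont
  have hψ := h.contPer.cont
  have hψ'' := h'.cont_deriv
  have hwc := hw.cont
  rw [hessForm_apply, real_inner_comm, h.inner_toH hL h' f, fn_toH hL (h.hasH1 hL),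
    ← intervalIntegral.integral_const_mul, ← intervalIntegral.integral_sub]
  · congr 1; funext x; ring
  · exact Continuous.intervalIntegrable (by fun_prop) _ _
  · exact Continuous.intervalIntegrable (by fun_prop) _ _

/-- A lower bound for the Hessian on `C¹` functions that vanish at two points extends to all of
the space. -/
theorem hessian_lower_bound_of_smooth (hL : 0 < L) (hw : ContPer L w) {x₀ δ : ℝ}
    {g g' : ℝ → ℝ} (hg : C1Per L g g') (hodd : g (-x₀) = -g x₀) (hg0 : g x₀ ≠ 0)
    (hδ : ∀ f f', C1Per L f f' → f x₀ = 0 → f (-x₀) = 0 →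
      δ * ‖toH L f‖ ^ 2 ≤ hessian L c w (toH L f)) (f : HSpace) (hf : fn L f x₀ = 0)
    (hf' : fn L f (-x₀) = 0) : δ * ‖f‖ ^ 2 ≤ hessian L c w f := by
  have h1 : C1Per L (fun _ => 1) fun _ => 0 :=
    ⟨fun _ => rfl, fun x => hasDerivAt_const x 1, continuous_const⟩
  have hfng := fn_toH hL (hg.hasH1 hL)
  have hfn1 := fn_toH hL (h1.hasH1 hL)
  -- R subtracts the multiples of g and of the constant 1 that interpolate b at ±x₀. It is
  -- continuous, preserves smoothness and fixes f, so density applies within the constrained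
  -- subspace.
  set R : HSpace → HSpace := fun b => b -
    ((evalCLM hL x₀ b - evalCLM hL (-x₀) b) / (2 * g x₀)) • toH L g -
    ((evalCLM hL x₀ b + evalCLM hL (-x₀) b) / 2) • toH L fun _ => 1 with hR
  have hRc : Continuous R := by fun_prop
  have hRf : R f = f := by
    simp only [hR, evalCLM_apply, hf, hf']; simp
  have hmem : f ∈ {b | δ * ‖R b‖ ^ 2 ≤ hessian L c w (R b)} := by
    refine closure_minimal (t := {b | δ * ‖R b‖ ^ 2 ≤ hessian L c w (R b)}) ?_
      (isClosed_le (by fun_prop) ((continuous_hessian hL c hw).comp hRc)) (smoothH_dense hL f)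
    intro b hb
    have hRb : R b ∈ smoothH hL :=
      (smoothH hL).sub_mem ((smoothH hL).sub_mem hb ((smoothH hL).smul_mem _ (hg.toH_mem hL)))
        ((smoothH hL).smul_mem _ (h1.toH_mem hL))
    obtain ⟨r', hr⟩ := hRb
    have h2 := hδ _ _ hr (by
      simp only [hR, fn_sub hL, fn_smul hL, hfng, hfn1, evalCLM_apply]; field_simp; ring) (by
      simp only [hR, fn_sub hL, fn_smul hL, hfng, hfn1, evalCLM_apply, hodd]; field_simp; ring)
    rw [toH_fn hL] at h2
    exact h2
  have := hmem
  simp only [mem_ofPred_eq, hRf] at this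
  exact this

/-- Coercivity from a lower bound on functions vanishing at two points and a test function in the
direction of the constraints. -/
theorem isCoercive_of_test (hL : 0 < L) (hw : ContPer L w) {φ φ' : ℝ → ℝ} {x₀ δ α β : ℝ}
    (hδ : 0 < δ) (hZ : ∀ f : HSpace, fn L f x₀ = 0 → fn L f (-x₀) = 0 →
      δ * ‖f‖ ^ 2 ≤ hessian L c w f)
    (hG : ∀ f, hessForm hL c hw (toH L φ') f = 0)
    (hodd : fn L (toH L φ') (-x₀) = -fn L (toH L φ') x₀) (hd : fn L (toH L φ') x₀ ≠ 0)
    {P : HSpace} (heven : fn L P (-x₀) = fn L P x₀)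
    (hP : ∀ f, hessForm hL c hw P f = α * inner ℝ (toH L φ) f + β * mass L f)
    (hneg : hessian L c w P < 0) : IsCoercive L c w φ φ' := by
  -- An even P vanishing at x₀ would also vanish at -x₀, and its Hessian could not be negative.
  have hp : fn L P x₀ ≠ 0 := fun h0 => by
    have := hZ P h0 (by rw [heven, h0])
    have : 0 ≤ δ * ‖P‖ ^ 2 := by positivity
    linarith
  set G := toH L φ'
  set γ := -hessian L c w P with hγ
  have hγ0 : 0 < γ := by linarith
  have hδ' : 0 < min (δ / 2) (γ / (4 * (‖P‖ ^ 2 + 1))) := lt_min (by positivity) (by positivity)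
  -- The constant 2/γ comes from completing the square in γt²/2 + 2tl + 2l²/γ. The minimum in `hδ'`
  -- lets δ‖h‖² + γt²/2 dominate a multiple of ‖f‖².
  refine ⟨_, 2 / γ, α, β, hδ', by positivity, fun f hf => ?_⟩
  set δ' := min (δ / 2) (γ / (4 * (‖P‖ ^ 2 + 1)))
  set s := (fn L f x₀ - fn L f (-x₀)) / (2 * fn L G x₀) with hs
  set t := (fn L f x₀ + fn L f (-x₀)) / (2 * fn L P x₀) with ht
  set h := f - s • G - t • P with hh
  have hh1 : fn L h x₀ = 0 := by
    simp only [hh, fn_sub hL, fn_smul hL, hs, ht]; field_simp; ring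
  have hh2 : fn L h (-x₀) = 0 := by
    simp only [hh, fn_sub hL, fn_smul hL, hodd, heven, hs, ht]; field_simp; ring
  have hb := hZ h hh1 hh2
  have hfe : f = (h + t • P) + s • G := by rw [hh]; abel
  have e1 : hessian L c w f = hessian L c w (h + t • P) := by
    have hGG : hessian L c w G = 0 := by rw [← hessForm_self hL hw, hG]
    conv_lhs => rw [hfe]
    rw [hessian_add_smul hL hw, hG, hGG]; ring
  have e2 := hessian_add_smul (c := c) hL hw h P t
  have e3 : hessForm hL c hw P h = hessForm hL c hw P f + t * γ := by
    have hPG : hessForm hL c hw P G = 0 := by rw [hessForm_comm, hG]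
    rw [hh, map_sub, map_sub, map_smul, map_smul, hPG, hessForm_self hL hw, smul_zero, smul_eq_mul,
      hγ]
    ring
  rw [← hP]
  set l := hessForm hL c hw P f
  have e4 : hessian L c w f = hessian L c w h + 2 * t * l + t ^ 2 * γ := by
    rw [e1, e2, e3]
    have : hessian L c w P = -γ := by rw [hγ, neg_neg]
    rw [this]; ring
  -- Since f is orthogonal to G, subtracting a multiple of G cannot decrease the norm. The component
  -- s therefore needs no control.
  have n1 : ‖f‖ ^ 2 ≤ ‖h + t • P‖ ^ 2 := by
    have : h + t • P = f - s • G := by rw [hh]; abel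
    have hi : inner ℝ f (s • G) = s * inner ℝ f G := (innerSL ℝ f).map_smul s G
    rw [this, norm_sub_sq_real, hi, hf]
    nlinarith [sq_nonneg ‖s • G‖]
  have n2 : ‖h + t • P‖ ^ 2 ≤ 2 * ‖h‖ ^ 2 + 2 * (t ^ 2 * ‖P‖ ^ 2) := by
    have h1 := norm_add_le h (t • P)
    have h2 : ‖t • P‖ ^ 2 = t ^ 2 * ‖P‖ ^ 2 := by
      rw [norm_smul, mul_pow, Real.norm_eq_abs, sq_abs]
    rw [← h2]
    nlinarith [norm_nonneg (h + t • P), sq_nonneg (‖h‖ - ‖t • P‖)]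
  have n3 : δ' * ‖f‖ ^ 2 ≤ δ * ‖h‖ ^ 2 + γ / 2 * t ^ 2 := by
    have h1 := mul_le_mul_of_nonneg_left (n1.trans n2) hδ'.le
    have h2 : δ' * ‖h‖ ^ 2 ≤ δ / 2 * ‖h‖ ^ 2 :=
      mul_le_mul_of_nonneg_right (min_le_left _ _) (sq_nonneg _)
    have h3 : δ' * ‖P‖ ^ 2 ≤ γ / 4 := by
      have h4 : δ' * (4 * (‖P‖ ^ 2 + 1)) ≤ γ := (le_div_iff₀ (by positivity)).1 (min_le_right _ _)
      linarith
    have h5 := mul_le_mul_of_nonneg_right h3 (sq_nonneg t)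
    linarith
  have n4 : 0 ≤ γ / 2 * t ^ 2 + 2 * t * l + 2 / γ * l ^ 2 := by
    have : γ / 2 * t ^ 2 + 2 * t * l + 2 / γ * l ^ 2 = (γ * t + 2 * l) ^ 2 / (2 * γ) := by
      field_simp; ring
    rw [this]; positivity
  rw [e4]
  linarith only [hb, n3, n4]

end

/-! ### Periodicity and mean of `psi`, and the inequality for the negative direction. -/

section

namespace WaveProfile

variable {L lam a : ℝ} {v v' : ℝ → ℝ}

theorem c1Per_sq (h : WaveProfile L lam a v v') : C1Per L (fun x => v x ^ 2) fun x => 2 * v x * v' x := by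
  have h1 := h.cont
  have h2 := h.cont'
  exact ⟨fun x => by simp only [h.per x], h.hasDerivAt_sq, by fun_prop⟩

theorem c1Per_sq_deriv (h : WaveProfile L lam a v v') :
    C1Per L (fun x => 2 * v x * v' x) fun x => lam * (v x ^ 2 - v x ^ 3 + a) := by
  have h1 := h.cont
  exact ⟨h.c1Per_sq.per_deriv, h.hasDerivAt_sq_deriv, by fun_prop⟩

theorem c1Per_sq_deriv_deriv (h : WaveProfile L lam a v v') :
    C1Per L (fun x => lam * (v x ^ 2 - v x ^ 3 + a))
      fun x => lam * ((2 * v x - 3 * v x ^ 2) * v' x) := by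
  have h1 := h.cont
  have h2 := h.cont'
  refine ⟨h.c1Per_sq_deriv.per_deriv, fun x => ?_, by fun_prop⟩
  refine (((((h.deriv x).pow 2).sub ((h.deriv x).pow 3)).add_const a).const_mul lam).congr_deriv ?_
  push_cast; ring

theorem contPer (h : WaveProfile L lam a v v') : ContPer L v := h.c1Per.contPer

/-- Only when μ is the mean of v is `zeta`, the primitive of v - μ, periodic. -/
theorem c1Per_psi (h : WaveProfile L lam a v v') :
    C1Per L (psi v v' a (moment L v 1 / L) 0) (psiDeriv lam v v' a (moment L v 1 / L) 0) := by
  refine ⟨fun x => ?_, h.hasDerivAt_psi _ _, h.continuous_psiDeriv _ _⟩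
  have : moment L v 1 / L * L = moment L v 1 := div_mul_cancel₀ _ h.hL.ne'
  have h2 : ∫ y in (0 : ℝ)..L, v y = moment L v 1 := by simp [moment]
  simp only [psi, h.zeta_add_period, h.per x, h.c1Per.per_deriv x, this, h2, sub_self, add_zero]

/-- Integration by parts replaces ζ(v²)' by -(v - m)v², and the moments do the rest. -/
theorem integral_psi (h : WaveProfile L lam a v v') (m : ℝ) (hm : moment L v 1 = m * L) :
    ∫ x in (0 : ℝ)..L, psi v v' a m 0 x = L * (a + 5 / 6 * (m - m ^ 2)) := by
  have hc := h.cont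
  have hc' := h.cont'
  have hz : Continuous (zeta v m 0) :=
    continuous_iff_continuousAt.2 fun x => (h.hasDerivAt_zeta m 0 x).continuousAt
  have hC : C1Per L (fun x => zeta v m 0 x * v x ^ 2)
      fun x => (v x - m) * v x ^ 2 + zeta v m 0 x * (2 * v x * v' x) := by
    refine ⟨fun x => ?_, fun x => (h.hasDerivAt_zeta m 0 x).mul (h.hasDerivAt_sq x), by fun_prop⟩
    have h2 : ∫ y in (0 : ℝ)..L, v y = m * L := by rw [← hm]; simp [moment]
    simp only [h.zeta_add_period, h.per x, h2, sub_self, add_zero]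
  have h0 := integral_deriv_eq_zero hC
  have hi : ∀ n : ℕ, IntervalIntegrable (fun x => v x ^ n) volume 0 L := fun n =>
    (hc.pow n).intervalIntegrable _ _
  have e : ∀ x, psi v v' a m 0 x = ((v x - m) * v x ^ 2 + zeta v m 0 x * (2 * v x * v' x)) +
      (-5 * v x ^ 3 + (5 - 3 * m) * v x ^ 2 + 5 * m / 3 * v x ^ 1 + (6 * a + 5 * m / 6)) := fun x => by
    unfold psi psiPoly; ring
  simp only [e]
  rw [intervalIntegral.integral_add (Continuous.intervalIntegrable (by fun_prop) _ _)
    (Continuous.intervalIntegrable (by fun_prop) _ _), h0,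
    intervalIntegral.integral_add (Continuous.intervalIntegrable (by fun_prop) _ _)
    (Continuous.intervalIntegrable (by fun_prop) _ _),
    intervalIntegral.integral_add (Continuous.intervalIntegrable (by fun_prop) _ _)
    (Continuous.intervalIntegrable (by fun_prop) _ _),
    intervalIntegral.integral_add (Continuous.intervalIntegrable (by fun_prop) _ _)
    (Continuous.intervalIntegrable (by fun_prop) _ _), intervalIntegral.integral_const_mul,
    intervalIntegral.integral_const_mul, intervalIntegral.integral_const_mul,
    intervalIntegral.integral_const, sub_zero, smul_eq_mul]
  have e1 : ∫ x in (0 : ℝ)..L, v x ^ 3 = moment L v 3 := rfl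
  have e2 : ∫ x in (0 : ℝ)..L, v x ^ 2 = moment L v 2 := rfl
  have e3 : ∫ x in (0 : ℝ)..L, v x ^ 1 = moment L v 1 := rfl
  rw [e1, e2, e3, h.moment_three, h.moment_two, hm]
  ring

/-- The inequality behind the negative direction of the Hessian. -/
theorem quadratic_coefficient_neg {m b σ : ℝ} (hm0 : 0 < m) (hm : m ≤ 5 / 6) (hb0 : 0 < b)
    (hb : b < 5 / 36 * m) (hσ : 0 < σ) :
    let m4 := 5 / 14 * (5 / 2 * m - 3 * b - 4 * b * m)
    let m5 := 5 / 18 * (4 * m4 - 5 * b * m)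
    let q := (5 / 12) * (5 / 48 - 5 / 12 * m + b / 2) +
      (5 / 24 * (5 / 6 * m) - 17 / 24 * m4 - 5 / 48 * (5 / 6 * m - b) + 5 / 12 * b * m +
        5 / 24 * b) * σ + (-m5 / 2 + b * (5 / 6 * m)) * σ ^ 2
    q * (-b + 5 / 6 * (m - m ^ 2)) <
      (-b - 6 * m * b + 5 * m / 6) * (5 / 12 * (m + 1 / 2) + 5 / 6 * m * σ) ^ 2 := by
  intro m4 m5 q
  have hbm : b * m ≤ 5 / 6 * b := by nlinarith
  have hbm0 : 0 < b * m := by positivity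
  have hk : 0 < -b - 6 * m * b + 5 * m / 6 := by nlinarith
  have hn : 0 < -b + 5 / 6 * (m - m ^ 2) := by nlinarith
  -- The coefficients of σ and σ² in q are negative, while the right-hand side of the inequality
  -- grows with σ. It therefore suffices to treat σ = 0 in both.
  have h1 : 5 / 24 * (5 / 6 * m) - 17 / 24 * m4 - 5 / 48 * (5 / 6 * m - b) + 5 / 12 * b * m +
      5 / 24 * b < 0 := by
    simp only [m4]; linarith
  have h2 : -m5 / 2 + b * (5 / 6 * m) < 0 := by
    simp only [m5, m4]; linarith
  have hq : q ≤ (5 / 12) * (5 / 48 - 5 / 12 * m + b / 2) := by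
    have := mul_pos hσ (neg_pos.2 h1)
    have := mul_pos (pow_pos hσ 2) (neg_pos.2 h2)
    simp only [q]; linarith
  have h3 : (5 / 12) * (5 / 48 - 5 / 12 * m + b / 2) * (-b + 5 / 6 * (m - m ^ 2)) <
      (-b - 6 * m * b + 5 * m / 6) * (5 / 12 * (m + 1 / 2)) ^ 2 := by
    obtain ⟨e, he⟩ : ∃ e, b = 5 / 36 * m - e := ⟨5 / 36 * m - b, by ring⟩
    have he0 : 0 < e := by linarith
    have he1 : e < 5 / 36 * m := by linarith
    subst he
    have hX : 0 < 5 / 36 * m * (5 - 6 * m) + e * (1 + 6 * m) := by nlinarith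
    nlinarith [mul_pos hm0 he0, mul_pos hm0 hm0, mul_nonneg hm0.le (by linarith : 0 ≤ 5 / 6 - m),
      mul_pos (mul_pos hm0 he0) hm0]
  have h4 : (5 / 12 * (m + 1 / 2)) ^ 2 ≤ (5 / 12 * (m + 1 / 2) + 5 / 6 * m * σ) ^ 2 := by
    have : 0 ≤ 5 / 6 * m * σ := by positivity
    exact pow_le_pow_left₀ (by positivity) (by linarith) 2
  calc _ ≤ _ := mul_le_mul_of_nonneg_right hq hn.le
    _ < _ := h3
    _ ≤ _ := mul_le_mul_of_nonneg_left h4 hk.le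

end WaveProfile

end

/-! ### Coercivity and orbital stability for normalized profiles. -/

section

namespace WaveProfile

variable {L lam a : ℝ} {v v' : ℝ → ℝ}

theorem hessian_lower_bound (h : WaveProfile L lam a v v') {σ : ℝ} (hσ : 0 < σ)
    (hlam : lam * (σ + 1) = σ) :
    ∃ x₀ ∈ Ioo 0 (L / 2), ∃ δ : ℝ, 0 < δ ∧ ∀ f : HSpace, fn L f x₀ = 0 → fn L f (-x₀) = 0 →
      δ * ‖f‖ ^ 2 ≤ hessian L (σ + 1) (fun x => σ * v x) f := by
  have hL := h.hL
  obtain ⟨x₀, hx₀, ε, hε, hform⟩ := h.exists_form_lower_bound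
  have hw : ContPer L fun x => σ * v x := h.contPer.const_mul σ
  obtain ⟨N, hN0, hN⟩ := ((ContPer.const 1).add (hw.const_mul (3 / 2))).exists_bound hL
  -- A weighted average of two bounds: the Hessian is at least σε∫ f², and at least c‖f‖² - N∫ f².
  -- The weights N and σε cancel the L² terms and leave a bound by the H¹ norm.
  have hδ : 0 < σ * ε * (σ + 1) / (N + σ * ε) := by positivity
  refine ⟨x₀, hx₀, _, hδ, fun f hf hf' => ?_⟩
  refine hessian_lower_bound_of_smooth hL hw h.c1Per_sq_deriv (by rw [h.odd, h.even]; ring)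
    (h.sq_deriv_neg hx₀).ne (fun f f' hf h1 h2 => ?_) f hf hf'
  have hfc := hf.contPer.cont
  have hfc' := hf.cont_deriv
  have hvc := h.cont
  have h3 := hform f f' hf h1 h2
  have h4 := hf.norm_sq hL
  have hfn := fn_toH hL (hf.hasH1 hL)
  have e1 : hessian L (σ + 1) (fun x => σ * v x) (toH L f) =
      σ * ∫ x in (0 : ℝ)..L, (f' x ^ 2 / lam + (1 - 3 / 2 * v x) * f x ^ 2) := by
    rw [hessian, h4, hfn, ← intervalIntegral.integral_add, ← intervalIntegral.integral_const_mul,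
      ← intervalIntegral.integral_const_mul, ← intervalIntegral.integral_sub]
    · congr 1; funext x
      have hl := h.lam_pos.ne'
      field_simp
      linear_combination (2 * f' x ^ 2) * hlam
    all_goals exact Continuous.intervalIntegrable (by fun_prop) _ _
  have e2 : (σ + 1) * ‖toH L f‖ ^ 2 - N * ∫ x in (0 : ℝ)..L, f x ^ 2 ≤
      hessian L (σ + 1) (fun x => σ * v x) (toH L f) := by
    rw [hessian, hfn, ← intervalIntegral.integral_const_mul]
    refine sub_le_sub_left (intervalIntegral.integral_mono_on hL.le ?_ ?_ fun x _ => ?_) _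
    · exact Continuous.intervalIntegrable (by fun_prop) _ _
    · exact Continuous.intervalIntegrable (by fun_prop) _ _
    · exact mul_le_mul_of_nonneg_right ((le_abs_self _).trans (hN x)) (sq_nonneg _)
  have e3 := mul_le_mul_of_nonneg_left h3 hσ.le
  rw [← e1] at e3
  rw [div_mul_eq_mul_div, div_le_iff₀ (by positivity)]
  have := mul_le_mul_of_nonneg_left e3 hN0
  have := mul_le_mul_of_nonneg_left e2 (by positivity : 0 ≤ σ * ε)
  nlinarith

/-- With c = σ + 1 and lam c = σ, the operator of the Hessian is σ times -∂²/lam + (1 - 3v/2). -/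
theorem hessForm_toH_eq (h : WaveProfile L lam a v v') {σ : ℝ} (hlam : lam * (σ + 1) = σ)
    (hw : ContPer L fun x => σ * v x) {ψ ψ' g : ℝ → ℝ} (h1 : C1Per L ψ ψ')
    (h2 : C1Per L ψ' fun x => lam * ((1 - 3 / 2 * v x) * ψ x - g x)) (f : HSpace) :
    hessForm h.hL (σ + 1) hw (toH L ψ) f = σ * ∫ x in (0 : ℝ)..L, fn L f x * g x := by
  rw [hessForm_toH h.hL hw h1 h2, ← intervalIntegral.integral_const_mul]
  congr 1; funext x
  linear_combination (-(fn L f x) * ((1 - 3 / 2 * v x) * ψ x - g x)) * hlam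

theorem isCoercive (h : WaveProfile L lam a v v') {σ : ℝ} (hσ : 0 < σ)
    (hlam : lam * (σ + 1) = σ) :
    IsCoercive L (σ + 1) (fun x => σ * v x) (fun x => σ ^ 2 * v x ^ 2)
      fun x => σ ^ 2 * (2 * v x * v' x) := by
  have hL := h.hL
  have hvc := h.cont
  obtain ⟨x₀, hx₀, δ, hδ, hZ⟩ := h.hessian_lower_bound hσ hlam
  have hw : ContPer L fun x => σ * v x := h.contPer.const_mul σ
  set m := moment L v 1 / L with hm
  have hmL : moment L v 1 = m * L := by rw [hm]; field_simp
  have hm0 : 0 < m := div_pos h.moment_one_pos hL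
  have hm1 : m ≤ 5 / 6 := by rw [hm, div_le_iff₀ hL]; exact h.moment_one_le
  have hb0 : 0 < -a := neg_pos.2 h.a_neg
  have hb : -a < 5 / 36 * m := by
    have := h.neg_a_lt
    rw [hmL] at this
    nlinarith
  have hφ1 := h.c1Per_sq.const_smul (σ ^ 2)
  have hφ2 := h.c1Per_sq_deriv.const_smul (σ ^ 2)
  have hφ3 := h.c1Per_sq_deriv_deriv.const_smul (σ ^ 2)
  have hfnG := fn_toH hL (hφ2.hasH1 hL)
  -- the two parts of the test function
  set Ψ₁ : ℝ → ℝ := fun x => σ * v x ^ 2 + 5 / 12 * (v x + 1 / 2) with hΨ₁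
  set g₁ : ℝ → ℝ := fun x => -1 / 2 * (v x ^ 2 + σ * v x ^ 3) + (5 / 24 - σ * a) with hg₁
  set Ψ₀ := psi v v' a m 0 with hΨ₀
  have hc1 : C1Per L Ψ₁ fun x => σ * (2 * v x * v' x) + 5 / 12 * v' x := by
    refine ⟨fun x => by simp only [hΨ₁, h.per x], fun x => ?_, ?_⟩
    · exact ((h.hasDerivAt_sq x).const_mul σ).add (((h.deriv x).add_const (1 / 2)).const_mul (5 / 12))
    · have := h.cont'
      fun_prop
  -- The normalized operator sends v² to -v³/2 - a and (5/12)(v + 1/2) to 5/24 - v²/2. Their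
  -- combination produces v² + σv³, which is proportional to φ - φ'' up to a constant.
  have hc1' : C1Per L (fun x => σ * (2 * v x * v' x) + 5 / 12 * v' x)
      fun x => lam * ((1 - 3 / 2 * v x) * Ψ₁ x - g₁ x) := by
    refine ⟨hc1.per_deriv, fun x => ?_, by simp only [hΨ₁, hg₁]; fun_prop⟩
    refine (((h.hasDerivAt_sq_deriv x).const_mul σ).add
      ((h.deriv2 x).const_mul (5 / 12))).congr_deriv ?_
    simp only [hΨ₁, hg₁]; ring
  have hc0 : C1Per L Ψ₀ (psiDeriv lam v v' a m 0) := h.c1Per_psi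
  have hc0' : C1Per L (psiDeriv lam v v' a m 0)
      fun x => lam * ((1 - 3 / 2 * v x) * Ψ₀ x - kappa a m) := by
    have := h.continuous_psi m 0
    exact ⟨hc0.per_deriv, h.hasDerivAt_psiDeriv m 0, by fun_prop⟩
  have F1 := h.hessForm_toH_eq hlam hw hc1 hc1'
  have F0 := h.hessForm_toH_eq hlam hw hc0 hc0'
  have fn1 := fn_toH hL (hc1.hasH1 hL)
  have fn0 := fn_toH hL (hc0.hasH1 hL)
  set κ := kappa a m with hκ
  set I₁ := ∫ x in (0 : ℝ)..L, Ψ₁ x with hI₁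
  set I₀ := ∫ x in (0 : ℝ)..L, Ψ₀ x with hI₀
  set q := ∫ x in (0 : ℝ)..L, Ψ₁ x * g₁ x with hq
  -- This minimizes the Hessian of Ψ₁ + τΨ₀ over τ. The minimum is σ(q - κI₁²/I₀).
  set τ := -I₁ / I₀ with hτ
  have H1 : hessian L (σ + 1) (fun x => σ * v x) (toH L Ψ₁) = σ * q := by
    rw [← hessForm_self hL hw, F1, fn1]
  have H0 : hessian L (σ + 1) (fun x => σ * v x) (toH L Ψ₀) = σ * (I₀ * κ) := by
    rw [← hessForm_self hL hw, F0, fn0, intervalIntegral.integral_mul_const]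
  have H01 : hessForm hL (σ + 1) hw (toH L Ψ₀) (toH L Ψ₁) = σ * (I₁ * κ) := by
    rw [F0, fn1, intervalIntegral.integral_mul_const]
  have vI₀ : I₀ = L * (a + 5 / 6 * (m - m ^ 2)) := h.integral_psi m hmL
  have hi : ∀ n : ℕ, IntervalIntegrable (fun x => v x ^ n) volume 0 L := fun n =>
    (hvc.pow n).intervalIntegrable _ _
  have vI₁ : I₁ = L * (5 / 12 * (m + 1 / 2) + 5 / 6 * m * σ) := by
    have e : ∀ x, Ψ₁ x = σ * v x ^ 2 + 5 / 12 * v x ^ 1 + 5 / 24 := fun x => by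
      simp only [hΨ₁]; ring
    simp only [hI₁, e]
    rw [intervalIntegral.integral_add (((hi 2).const_mul _).add ((hi 1).const_mul _))
      intervalIntegrable_const, intervalIntegral.integral_add ((hi 2).const_mul _)
      ((hi 1).const_mul _), intervalIntegral.integral_const_mul,
      intervalIntegral.integral_const_mul, intervalIntegral.integral_const, sub_zero, smul_eq_mul]
    have e2 : ∫ x in (0 : ℝ)..L, v x ^ 2 = moment L v 2 := rfl
    have e3 : ∫ x in (0 : ℝ)..L, v x ^ 1 = moment L v 1 := rfl
    rw [e2, e3, h.moment_two, hmL]; ring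
  have vq : q = -σ ^ 2 / 2 * moment L v 5 - 17 / 24 * σ * moment L v 4 -
      (5 / 24 + 5 / 48 * σ) * moment L v 3 +
      (σ * (5 / 24 - σ * a) - 5 / 48) * moment L v 2 + 5 / 12 * (5 / 24 - σ * a) * moment L v 1 +
      5 / 24 * (5 / 24 - σ * a) * L := by
    have e : ∀ x, Ψ₁ x * g₁ x = -σ ^ 2 / 2 * v x ^ 5 - 17 / 24 * σ * v x ^ 4 -
        (5 / 24 + 5 / 48 * σ) * v x ^ 3 + (σ * (5 / 24 - σ * a) - 5 / 48) * v x ^ 2 +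
        5 / 12 * (5 / 24 - σ * a) * v x ^ 1 + 5 / 24 * (5 / 24 - σ * a) := fun x => by
      simp only [hΨ₁, hg₁]; ring
    simp only [hq, e]
    have j := fun (n : ℕ) (r : ℝ) => (hi n).const_mul r
    rw [intervalIntegral.integral_add (((((j 5 _).sub (j 4 _)).sub (j 3 _)).add (j 2 _)).add (j 1 _))
        intervalIntegrable_const,
      intervalIntegral.integral_add ((((j 5 _).sub (j 4 _)).sub (j 3 _)).add (j 2 _)) (j 1 _),
      intervalIntegral.integral_add (((j 5 _).sub (j 4 _)).sub (j 3 _)) (j 2 _),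
      intervalIntegral.integral_sub ((j 5 _).sub (j 4 _)) (j 3 _),
      intervalIntegral.integral_sub (j 5 _) (j 4 _)]
    simp only [intervalIntegral.integral_const_mul, intervalIntegral.integral_const, sub_zero,
      smul_eq_mul]
    simp only [moment]
    ring
  have hI₀pos : 0 < I₀ := by
    rw [vI₀]
    exact mul_pos hL (by nlinarith)
  have hqI : q * I₀ < κ * I₁ ^ 2 := by
    have h9 := quadratic_coefficient_neg hm0 hm1 hb0 hb hσ
    simp only at h9
    have h8 := mul_lt_mul_of_pos_left h9 (by positivity : 0 < L ^ 2)
    rw [vq, vI₀, vI₁, hκ, kappa, h.moment_five, h.moment_four, h.moment_three, h.moment_two, hmL]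
    linarith only [h8]
  refine isCoercive_of_test (P := toH L Ψ₁ + τ • toH L Ψ₀) (α := -(σ + 1) / (2 * σ ^ 2) * σ)
    (β := σ * (5 / 24 - σ * a - σ * a / 2 + τ * κ)) hL hw hδ hZ
    (fun f => ?_) ?_ ?_ ?_ (fun f => ?_) ?_
  · rw [h.hessForm_toH_eq (g := fun _ => 0) hlam hw hφ2]
    · simp
    · convert hφ3 using 2 with x
      ring
  · simp only [hfnG, h.odd, h.even]; ring
  · rw [hfnG]
    have := (h.sq_deriv_neg hx₀).ne
    positivity
  · rw [fn_add hL, fn_add hL, fn_smul hL, fn_smul hL, fn1, fn0, hΨ₀, h.psi_neg]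
    simp only [hΨ₁, h.even]
  · have hfc := (contPer_fn hL f).cont
    rw [hessForm_comm, map_add, map_smul, hessForm_comm, F1, hessForm_comm, F0, smul_eq_mul,
      real_inner_comm, hφ1.inner_toH hL hφ2, mass]
    -- Since φ - φ'' = σ²(v² + σv³ - σa)/(σ + 1), pairing with g₁ is a combination of ⟨φ, f⟩ and the
    -- mass of f.
    have e : ∫ x in (0 : ℝ)..L, fn L f x * g₁ x = -(σ + 1) / (2 * σ ^ 2) *
        (∫ x in (0 : ℝ)..L, fn L f x * (σ ^ 2 * v x ^ 2 - σ ^ 2 * (lam * (v x ^ 2 - v x ^ 3 + a)))) +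
        (5 / 24 - σ * a - σ * a / 2) * ∫ x in (0 : ℝ)..L, fn L f x := by
      rw [← intervalIntegral.integral_const_mul, ← intervalIntegral.integral_const_mul,
        ← intervalIntegral.integral_add (Continuous.intervalIntegrable (by fun_prop) _ _)
        (Continuous.intervalIntegrable (by fun_prop) _ _)]
      congr 1; funext x
      simp only [hg₁]
      field_simp
      linear_combination (-24 * fn L f x * (v x ^ 2 - v x ^ 3 + a)) * hlam
    rw [e, intervalIntegral.integral_mul_const]
    ring
  · rw [hessian_add_smul hL hw, H1, H0, H01, hτ]
    have : σ * q + 2 * (-I₁ / I₀) * (σ * (I₁ * κ)) + (-I₁ / I₀) ^ 2 * (σ * (I₀ * κ)) =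
        σ * ((q * I₀ - κ * I₁ ^ 2) / I₀) := by field_simp; ring
    rw [this]
    exact mul_neg_of_pos_of_neg hσ (div_neg_of_neg_of_pos (by linarith) hI₀pos)

/-- Orbital stability of the waves built from normalized profiles. -/
theorem orbitallyStable (h : WaveProfile L lam a v v') {σ : ℝ} (hσ : 0 < σ)
    (hlam : lam * (σ + 1) = σ) : OrbitallyStable L fun x => (σ * v x) ^ 2 := by
  have hL := h.hL
  have hw : ContPer L fun x => σ * v x := h.contPer.const_mul σ
  obtain ⟨y, hy, hmin⟩ := (isCompact_Icc (a := (0 : ℝ)) (b := L)).exists_isMinOn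
    ⟨0, by simp [hL.le]⟩ hw.cont.continuousOn
  have e : (fun x => (σ * v x) ^ 2) = fun x => σ ^ 2 * v x ^ 2 := by funext x; ring
  rw [e]
  refine orbitallyStable_of_isCoercive (c := σ + 1) (A := σ ^ 3 * a) (ν := σ * v y) hL
    (h.c1Per_sq.const_smul (σ ^ 2))
    (h.c1Per_sq_deriv.const_smul (σ ^ 2)) (h.c1Per_sq_deriv_deriv.const_smul (σ ^ 2)) hw
    (fun x => by ring) (mul_pos hσ (h.pos y)) (fun x => ?_) (fun x => ?_) (h.isCoercive hσ hlam)
  · obtain ⟨z, hz, hxz⟩ := hw.per.exists_mem_Ico₀ hL x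
    refine le_of_le_of_eq ?_ hxz.symm
    exact hmin ⟨hz.1, hz.2.le⟩
  · linear_combination (-σ ^ 2 * (v x ^ 2 - v x ^ 3 + a)) * hlam

end WaveProfile

end

section

/-! ### Elliptic integrals and elliptic functions -/

section Elliptic

variable {k : ℝ}

theorem one_sub_sq_mul_sin_sq_pos (hk : k ^ 2 < 1) (θ : ℝ) : 0 < 1 - k ^ 2 * Real.sin θ ^ 2 := by
  nlinarith [Real.sin_sq_le_one θ, sq_nonneg k, sq_nonneg (Real.sin θ)]

theorem continuous_ellipticF_integrand (hk : k ^ 2 < 1) :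
    Continuous fun θ => 1 / √(1 - k ^ 2 * Real.sin θ ^ 2) :=
  continuous_const.div (by fun_prop) fun θ =>
    (Real.sqrt_pos.2 (one_sub_sq_mul_sin_sq_pos hk θ)).ne'

theorem hasDerivAt_ellipticF (hk : k ^ 2 < 1) (φ : ℝ) :
    HasDerivAt (ellipticF k) (1 / √(1 - k ^ 2 * Real.sin φ ^ 2)) φ :=
  ((continuous_ellipticF_integrand hk).integral_hasStrictDerivAt 0 φ).hasDerivAt

theorem continuous_ellipticF (hk : k ^ 2 < 1) : Continuous (ellipticF k) :=
  continuous_iff_continuousAt.2 fun φ => (hasDerivAt_ellipticF hk φ).continuousAt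

theorem strictMono_ellipticF (hk : k ^ 2 < 1) : StrictMono (ellipticF k) :=
  strictMono_of_hasDerivAt_pos (hasDerivAt_ellipticF hk) fun φ =>
    one_div_pos.2 (Real.sqrt_pos.2 (one_sub_sq_mul_sin_sq_pos hk φ))

theorem ellipticF_zero : ellipticF k 0 = 0 := by simp [ellipticF]

theorem ellipticF_neg (φ : ℝ) : ellipticF k (-φ) = -ellipticF k φ := by
  have h1 := intervalIntegral.integral_comp_neg (a := 0) (b := φ)
    fun θ => 1 / √(1 - k ^ 2 * Real.sin θ ^ 2)
  simp only [Real.sin_neg, neg_sq, neg_zero] at h1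
  rw [ellipticF, ellipticF, intervalIntegral.integral_symm, ← h1]

theorem ellipticF_add_pi (hk : k ^ 2 < 1) (φ : ℝ) :
    ellipticF k (φ + Real.pi) = ellipticF k φ + 2 * ellipticK k := by
  have hc := continuous_ellipticF_integrand hk
  have hp : Function.Periodic (fun θ => 1 / √(1 - k ^ 2 * Real.sin θ ^ 2)) Real.pi := fun θ => by
    simp only [Real.sin_add_pi, neg_sq]
  have h1 := hp.intervalIntegral_add_eq φ (-(Real.pi / 2))
  have hd : ∀ s t, ∫ θ in s..t, 1 / √(1 - k ^ 2 * Real.sin θ ^ 2) =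
      ellipticF k t - ellipticF k s := fun s t =>
    (intervalIntegral.integral_interval_sub_left (hc.intervalIntegrable _ _)
      (hc.intervalIntegrable _ _)).symm
  rw [hd, hd, ellipticF_neg, show -(Real.pi / 2) + Real.pi = Real.pi / 2 by ring] at h1
  unfold ellipticK
  linarith

theorem le_ellipticF (hk : k ^ 2 < 1) {φ : ℝ} (hφ : 0 ≤ φ) : φ ≤ ellipticF k φ := by
  have h : ∫ _ in (0 : ℝ)..φ, (1 : ℝ) ≤ ellipticF k φ := by
    refine intervalIntegral.integral_mono_on hφ intervalIntegrable_const
      ((continuous_ellipticF_integrand hk).intervalIntegrable _ _) fun θ _ => ?_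
    rw [le_div_iff₀ (Real.sqrt_pos.2 (one_sub_sq_mul_sin_sq_pos hk θ)), one_mul]
    refine Real.sqrt_le_one.2 ?_
    nlinarith [mul_nonneg (sq_nonneg k) (sq_nonneg (Real.sin θ))]
  simpa using h

theorem surjective_ellipticF (hk : k ^ 2 < 1) : Function.Surjective (ellipticF k) := by
  refine (continuous_ellipticF hk).surjective ?_ ?_
  · refine tendsto_atTop_mono' atTop ?_ tendsto_id
    filter_upwards [eventually_ge_atTop 0] with φ hφ
    exact le_ellipticF hk hφ
  · refine tendsto_atBot_mono' atBot ?_ tendsto_id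
    filter_upwards [eventually_le_atBot 0] with φ hφ
    have := le_ellipticF hk (neg_nonneg.2 hφ)
    rw [ellipticF_neg] at this
    simp only [id]
    linarith

theorem ellipticF_jacobiAm (hk : k ^ 2 < 1) (x : ℝ) : ellipticF k (jacobiAm k x) = x :=
  Function.rightInverse_invFun (surjective_ellipticF hk) x

theorem jacobiAm_ellipticF (hk : k ^ 2 < 1) (φ : ℝ) : jacobiAm k (ellipticF k φ) = φ :=
  Function.leftInverse_invFun (strictMono_ellipticF hk).injective φ

theorem strictMono_jacobiAm (hk : k ^ 2 < 1) : StrictMono (jacobiAm k) := fun x y hxy => by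
  rwa [← (strictMono_ellipticF hk).lt_iff_lt, ellipticF_jacobiAm hk, ellipticF_jacobiAm hk]

theorem continuous_jacobiAm (hk : k ^ 2 < 1) : Continuous (jacobiAm k) :=
  (strictMono_jacobiAm hk).monotone.continuous_of_surjective fun φ =>
    ⟨_, jacobiAm_ellipticF hk φ⟩

theorem hasDerivAt_jacobiAm (hk : k ^ 2 < 1) (x : ℝ) :
    HasDerivAt (jacobiAm k) √(1 - k ^ 2 * Real.sin (jacobiAm k x) ^ 2) x := by
  have hp := Real.sqrt_pos.2 (one_sub_sq_mul_sin_sq_pos hk (jacobiAm k x))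
  have := HasDerivAt.of_local_left_inverse (continuous_jacobiAm hk).continuousAt
    (hasDerivAt_ellipticF hk (jacobiAm k x)) (one_div_pos.2 hp).ne'
    (Eventually.of_forall fun y => ellipticF_jacobiAm hk y)
  simpa using this

theorem jacobiAm_zero (hk : k ^ 2 < 1) : jacobiAm k 0 = 0 := by
  rw [← ellipticF_zero (k := k), jacobiAm_ellipticF hk, ellipticF_zero]

theorem jacobiAm_ellipticK (hk : k ^ 2 < 1) : jacobiAm k (ellipticK k) = Real.pi / 2 :=
  jacobiAm_ellipticF hk _

theorem jacobiAm_neg (hk : k ^ 2 < 1) (x : ℝ) : jacobiAm k (-x) = -jacobiAm k x := by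
  apply (strictMono_ellipticF hk).injective
  rw [ellipticF_neg, ellipticF_jacobiAm hk, ellipticF_jacobiAm hk]

theorem jacobiAm_add (hk : k ^ 2 < 1) (x : ℝ) :
    jacobiAm k (x + 2 * ellipticK k) = jacobiAm k x + Real.pi := by
  apply (strictMono_ellipticF hk).injective
  rw [ellipticF_add_pi hk, ellipticF_jacobiAm hk, ellipticF_jacobiAm hk]

theorem ellipticK_pos (hk : k ^ 2 < 1) : 0 < ellipticK k :=
  lt_of_lt_of_le (by positivity) (le_ellipticF hk (by positivity))

/-- Bootstrapping: the derivative of the amplitude is a smooth function of the amplitude, as the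
radicand stays positive. -/
theorem contDiff_jacobiAm (hk : k ^ 2 < 1) : ContDiff ℝ ∞ (jacobiAm k) := by
  refine contDiff_infty.2 fun n => ?_
  induction n with
  | zero => exact contDiff_zero.2 (continuous_jacobiAm hk)
  | succ n ih =>
    have hd : deriv (jacobiAm k) = fun x => √(1 - k ^ 2 * Real.sin (jacobiAm k x) ^ 2) :=
      funext fun x => (hasDerivAt_jacobiAm hk x).deriv
    rw [show ((n + 1 : ℕ) : WithTop ℕ∞) = (n : WithTop ℕ∞) + 1 by norm_cast, contDiff_succ_iff_deriv]
    refine ⟨fun x => (hasDerivAt_jacobiAm hk x).differentiableAt, by simp, ?_⟩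
    rw [hd]
    exact ContDiff.sqrt (contDiff_const.sub (contDiff_const.mul ((Real.contDiff_sin.comp ih).pow 2)))
      fun x => (one_sub_sq_mul_sin_sq_pos hk _).ne'

end Elliptic

/-! ### The normalized cnoidal profile -/

/-- The number `√(k⁴ - k² + 1)`. -/
def modR (k : ℝ) : ℝ := √(k ^ 4 - k ^ 2 + 1)

theorem modR_arg_pos (k : ℝ) : 0 < k ^ 4 - k ^ 2 + 1 := by nlinarith [sq_nonneg (k ^ 2 - 1 / 2)]

theorem modR_pos (k : ℝ) : 0 < modR k := Real.sqrt_pos.2 (modR_arg_pos k)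

theorem modR_sq (k : ℝ) : modR k ^ 2 = k ^ 4 - k ^ 2 + 1 := Real.sq_sqrt (modR_arg_pos k).le

/-- The normalized cnoidal profile. -/
def cnProfile (L k x : ℝ) : ℝ :=
  5 / 12 * (1 + (1 + k ^ 2 - 3 * k ^ 2 * Real.sin (jacobiAm k (2 * ellipticK k / L * x)) ^ 2) /
    modR k)

/-- The derivative of `cnProfile`. -/
def cnProfileDeriv (L k x : ℝ) : ℝ :=
  -(5 * k ^ 2 * ellipticK k / (L * modR k)) *
    (Real.sin (jacobiAm k (2 * ellipticK k / L * x)) *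
      Real.cos (jacobiAm k (2 * ellipticK k / L * x)) *
        √(1 - k ^ 2 * Real.sin (jacobiAm k (2 * ellipticK k / L * x)) ^ 2))

/-- The integration constant of `cnProfile`. -/
def profileConst (k : ℝ) : ℝ :=
  -(25 / 864) * ((modR k - (2 * k ^ 2 - 1)) ^ 2 * (2 * modR k + (2 * k ^ 2 - 1))) / modR k ^ 3

theorem abs_lt_modR {k : ℝ} (hk0 : 0 < k) (hk : k ^ 2 < 1) : |2 * k ^ 2 - 1| < modR k := by
  refine abs_lt_of_sq_lt_sq ?_ (modR_pos k).le
  rw [modR_sq]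
  nlinarith [mul_pos (pow_pos hk0 2) (sub_pos.2 hk)]

/-- The two differential equations become polynomial identities in sin² of the amplitude, using R² =
k⁴ - k² + 1. The negative constant, the positivity of v and the value at L/2 come from |2k² - 1| <
R. The value at 0 comes from R < 1 + k². -/
theorem waveProfile_cnProfile {L k : ℝ} (hL : 0 < L) (hk0 : 0 < k) (hk : k ^ 2 < 1) :
    WaveProfile L (64 * ellipticK k ^ 2 * modR k / L ^ 2) (profileConst k) (cnProfile L k)
      (cnProfileDeriv L k) := by
  have hK := ellipticK_pos hk
  have hR := modR_pos k
  have hR2 := modR_sq k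
  obtain ⟨hR1, hR3⟩ := abs_lt.1 (abs_lt_modR hk0 hk)
  have hy : ∀ x, HasDerivAt (fun x => jacobiAm k (2 * ellipticK k / L * x))
      (√(1 - k ^ 2 * Real.sin (jacobiAm k (2 * ellipticK k / L * x)) ^ 2) *
        (2 * ellipticK k / L)) x := fun x => by
    have h1 : HasDerivAt (fun x => 2 * ellipticK k / L * x) (2 * ellipticK k / L) x := by
      simpa using (hasDerivAt_id' x).const_mul (2 * ellipticK k / L)
    exact (hasDerivAt_jacobiAm hk _).comp x h1
  have hkk : 0 < k ^ 2 := by positivity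
  constructor
  · exact hL
  · positivity
  · unfold profileConst
    have : 0 < (modR k - (2 * k ^ 2 - 1)) ^ 2 * (2 * modR k + (2 * k ^ 2 - 1)) :=
      mul_pos (pow_pos (by linarith) 2) (by linarith)
    rw [neg_mul, neg_div, neg_lt_zero]
    positivity
  · intro x
    have : 2 * ellipticK k / L * (x + L) = 2 * ellipticK k / L * x + 2 * ellipticK k := by
      field_simp
    simp only [cnProfile, this, jacobiAm_add hk, Real.sin_add_pi, neg_sq]
  · intro x
    simp only [cnProfile, mul_neg, jacobiAm_neg hk, Real.sin_neg, neg_sq]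
  · intro x
    unfold cnProfile
    have h1 := Real.sin_sq_le_one (jacobiAm k (2 * ellipticK k / L * x))
    set S := Real.sin (jacobiAm k (2 * ellipticK k / L * x)) ^ 2
    have : 0 < 1 + (1 + k ^ 2 - 3 * k ^ 2 * S) / modR k := by
      have : -1 < (1 + k ^ 2 - 3 * k ^ 2 * S) / modR k := by
        rw [lt_div_iff₀ hR]; nlinarith
      linarith
    positivity
  · intro x
    refine ((((((((hy x).sin).pow 2).const_mul (3 * k ^ 2)).const_sub (1 + k ^ 2)).div_const
      (modR k)).const_add 1).const_mul (5 / 12)).congr_deriv ?_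
    unfold cnProfileDeriv
    push_cast
    field_simp
    ring
  · intro x
    have hp := one_sub_sq_mul_sin_sq_pos hk (jacobiAm k (2 * ellipticK k / L * x))
    have hd := Real.sqrt_pos.2 hp
    have hsq := Real.sq_sqrt hp.le
    have h1 := ((((hy x).sin).pow 2).const_mul (k ^ 2)).const_sub 1
    have h2 := h1.sqrt hp.ne'
    refine ((((hy x).sin.mul (hy x).cos).mul h2).const_mul
      (-(5 * k ^ 2 * ellipticK k / (L * modR k)))).congr_deriv ?_
    unfold cnProfile
    simp only [Pi.mul_apply, Pi.pow_apply]
    have hcs := Real.sin_sq_add_cos_sq (jacobiAm k (2 * ellipticK k / L * x))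
    set s := Real.sin (jacobiAm k (2 * ellipticK k / L * x))
    set c := Real.cos (jacobiAm k (2 * ellipticK k / L * x))
    set d := √(1 - k ^ 2 * s ^ 2)
    set K := ellipticK k
    set R := modR k
    have hc2 : c ^ 2 = 1 - s ^ 2 := by linarith
    have e1 : 64 * K ^ 2 * R / L ^ 2 / 4 * (5 / 12 * (1 + (1 + k ^ 2 - 3 * k ^ 2 * s ^ 2) / R) -
        6 / 5 * (5 / 12 * (1 + (1 + k ^ 2 - 3 * k ^ 2 * s ^ 2) / R)) ^ 2) =
        10 / 3 * K ^ 2 / (L ^ 2 * R) * (R ^ 2 - (1 + k ^ 2 - 3 * k ^ 2 * s ^ 2) ^ 2) := by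
      field_simp; ring
    have e2 : -(5 * k ^ 2 * K / (L * R)) *
        ((c * (d * (2 * K / L)) * c + s * (-s * (d * (2 * K / L)))) * d +
        s * c * (-(k ^ 2 * ((2 : ℕ) * s ^ (2 - 1) * (c * (d * (2 * K / L))))) / (2 * d))) =
        -10 * k ^ 2 * K ^ 2 / (L ^ 2 * R) * ((c ^ 2 - s ^ 2) * d ^ 2 - k ^ 2 * s ^ 2 * c ^ 2) := by
      push_cast; field_simp; ring
    rw [e1, e2, hsq, hc2, hR2]
    ring
  · intro x
    have hp := one_sub_sq_mul_sin_sq_pos hk (jacobiAm k (2 * ellipticK k / L * x))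
    have hsq := Real.sq_sqrt hp.le
    unfold cnProfile cnProfileDeriv profileConst
    have hcs := Real.sin_sq_add_cos_sq (jacobiAm k (2 * ellipticK k / L * x))
    set s := Real.sin (jacobiAm k (2 * ellipticK k / L * x))
    set c := Real.cos (jacobiAm k (2 * ellipticK k / L * x))
    set d := √(1 - k ^ 2 * s ^ 2)
    set R := modR k
    set K := ellipticK k
    have hc2 : c ^ 2 = 1 - s ^ 2 := by linarith
    rw [mul_pow, mul_pow, mul_pow, hsq, hc2]
    field_simp
    linear_combination (-16588800 * (3 * k ^ 2 * (1 - s ^ 2))) * hR2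
  · intro x hx
    have hx1 : 0 < jacobiAm k (2 * ellipticK k / L * x) := by
      rw [← jacobiAm_zero hk]
      have := hx.1
      exact strictMono_jacobiAm hk (by positivity)
    have hx2 : jacobiAm k (2 * ellipticK k / L * x) < Real.pi / 2 := by
      rw [← jacobiAm_ellipticK hk]
      refine strictMono_jacobiAm hk ?_
      rw [div_mul_eq_mul_div, div_lt_iff₀ hL]
      nlinarith [hx.2]
    have hs := Real.sin_pos_of_pos_of_lt_pi hx1 (by linarith [Real.pi_pos])
    have hc := Real.cos_pos_of_mem_Ioo ⟨by linarith [Real.pi_pos], hx2⟩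
    have hd := Real.sqrt_pos.2 (one_sub_sq_mul_sin_sq_pos hk (jacobiAm k (2 * ellipticK k / L * x)))
    unfold cnProfileDeriv
    rw [neg_mul, neg_lt_zero]
    positivity
  · unfold cnProfile
    have : modR k < 1 + k ^ 2 := by
      refine lt_of_pow_lt_pow_left₀ 2 (by positivity) ?_
      rw [hR2]; nlinarith
    have : 1 < (1 + k ^ 2) / modR k := (one_lt_div hR).2 this
    rw [mul_zero, jacobiAm_zero hk, Real.sin_zero, zero_pow two_ne_zero, mul_zero, sub_zero]
    linarith
  · unfold cnProfile
    have e : 2 * ellipticK k / L * (L / 2) = ellipticK k := by field_simp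
    have : (1 + k ^ 2 - 3 * k ^ 2) / modR k < 1 := (div_lt_one hR).2 (by linarith)
    rw [e, jacobiAm_ellipticK hk, Real.sin_pi_div_two, one_pow, mul_one]
    linarith

end

section

/-! ### The critical modulus -/

theorem hasDerivAt_one_div_sqrt {s q : ℝ} (h : 0 < 1 - q * s) :
    HasDerivAt (fun q => 1 / √(1 - q * s)) (s / 2 * (1 / √(1 - q * s) / (1 - q * s))) q := by
  have h1 : HasDerivAt (fun q => 1 - q * s) (-s) q := by
    simpa using ((hasDerivAt_id' q).mul_const s).const_sub 1
  have h2 := Real.sqrt_pos.2 h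
  have h3 := Real.sq_sqrt h.le
  refine ((hasDerivAt_const q (1 : ℝ)).div (h1.sqrt h.ne') h2.ne').congr_deriv ?_
  rw [h3]
  field_simp
  ring

/-- The symmetrized integrand of `K` grows at least like `exp (k² / 4)`. -/
theorem monotoneOn_symm_integrand {s : ℝ} (hs0 : 0 ≤ s) (hs1 : s ≤ 1) :
    MonotoneOn (fun q => (1 / √(1 - q * s) + 1 / √(1 - q * (1 - s))) * Real.exp (-q / 4))
      (Ico 0 1) := by
  have hp : ∀ q ∈ Ico (0 : ℝ) 1, 0 < 1 - q * s ∧ 0 < 1 - q * (1 - s) := fun q hq =>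
    ⟨by nlinarith [hq.1, hq.2], by nlinarith [hq.1, hq.2]⟩
  have hd : ∀ q ∈ Ico (0 : ℝ) 1, HasDerivAt
      (fun q => (1 / √(1 - q * s) + 1 / √(1 - q * (1 - s))) * Real.exp (-q / 4))
      ((s / 2 * (1 / √(1 - q * s) / (1 - q * s)) +
        (1 - s) / 2 * (1 / √(1 - q * (1 - s)) / (1 - q * (1 - s)))) * Real.exp (-q / 4) +
        (1 / √(1 - q * s) + 1 / √(1 - q * (1 - s))) * (Real.exp (-q / 4) * (-1 / 4))) q :=
    fun q hq => ((hasDerivAt_one_div_sqrt (hp q hq).1).add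
      (hasDerivAt_one_div_sqrt (hp q hq).2)).mul (((hasDerivAt_id' q).neg.div_const 4).exp)
  refine monotoneOn_of_hasDerivWithinAt_nonneg (convex_Ico 0 1)
    (fun q hq => (hd q hq).continuousAt.continuousWithinAt)
    (fun q hq => (hd q (interior_subset hq)).hasDerivWithinAt) fun q hq => ?_
  have hq' := interior_subset hq
  obtain ⟨h1, h2⟩ := hp q hq'
  have hA := one_div_pos.2 (Real.sqrt_pos.2 h1)
  have hB := one_div_pos.2 (Real.sqrt_pos.2 h2)
  have hA1 : 1 / √(1 - q * s) ≤ 1 / √(1 - q * s) / (1 - q * s) :=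
    le_div_self hA.le h1 (by nlinarith [hq'.1])
  have hB1 : 1 / √(1 - q * (1 - s)) ≤ 1 / √(1 - q * (1 - s)) / (1 - q * (1 - s)) :=
    le_div_self hB.le h2 (by nlinarith [hq'.1])
  -- Chebyshev's inequality: the larger of the weights s, 1 - s multiplies the larger of the two
  -- quotients, so the weighted mean is at least the plain mean.
  have hcheb : 0 ≤ (s - (1 - s)) * (1 / √(1 - q * s) / (1 - q * s) -
      1 / √(1 - q * (1 - s)) / (1 - q * (1 - s))) := by
    rcases le_total s (1 - s) with h | h
    · have h3 : 1 - q * (1 - s) ≤ 1 - q * s := by nlinarith [hq'.1]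
      refine mul_nonneg_of_nonpos_of_nonpos (by linarith) (sub_nonpos.2 ?_)
      gcongr
    · have h3 : 1 - q * s ≤ 1 - q * (1 - s) := by nlinarith [hq'.1]
      refine mul_nonneg (by linarith) (sub_nonneg.2 ?_)
      gcongr
  set A := 1 / √(1 - q * s)
  set B := 1 / √(1 - q * (1 - s))
  set A' := A / (1 - q * s)
  set B' := B / (1 - q * (1 - s))
  have he := Real.exp_pos (-q / 4)
  have : 0 ≤ (s / 2 * A' + (1 - s) / 2 * B' - (A + B) / 4) * Real.exp (-q / 4) :=
    mul_nonneg (by linarith) he.le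
  linarith

/-- Averaging over θ ↔ π/2 - θ is needed because the integrand alone does not grow like exp(k²/4):
near θ = 0 it is almost constant in k. -/
theorem two_mul_ellipticK {k : ℝ} (hk : k ^ 2 < 1) : 2 * ellipticK k =
    ∫ θ in (0 : ℝ)..Real.pi / 2, (1 / √(1 - k ^ 2 * Real.sin θ ^ 2) +
      1 / √(1 - k ^ 2 * (1 - Real.sin θ ^ 2))) := by
  have hc := continuous_ellipticF_integrand hk
  have h1 := intervalIntegral.integral_comp_sub_left (a := 0) (b := Real.pi / 2)
    (fun θ => 1 / √(1 - k ^ 2 * Real.sin θ ^ 2)) (Real.pi / 2)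
  rw [sub_self, sub_zero] at h1
  have e : ∀ θ, 1 / √(1 - k ^ 2 * (1 - Real.sin θ ^ 2)) =
      1 / √(1 - k ^ 2 * Real.sin (Real.pi / 2 - θ) ^ 2) := fun θ => by
    rw [Real.sin_pi_div_two_sub, Real.cos_sq']
  simp only [e]
  have hc' : Continuous fun θ => 1 / √(1 - k ^ 2 * Real.sin (Real.pi / 2 - θ) ^ 2) :=
    hc.comp (g := fun θ => 1 / √(1 - k ^ 2 * Real.sin θ ^ 2)) (f := fun θ => Real.pi / 2 - θ)
      (by fun_prop)
  rw [intervalIntegral.integral_add (hc.intervalIntegrable _ _) (hc'.intervalIntegrable _ _), h1,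
    two_mul]
  rfl

theorem ellipticK_mul_exp_le {k₁ k₂ : ℝ} (h1 : 0 ≤ k₁) (h12 : k₁ ≤ k₂) (h2 : k₂ < 1) :
    ellipticK k₁ * Real.exp (-k₁ ^ 2 / 4) ≤ ellipticK k₂ * Real.exp (-k₂ ^ 2 / 4) := by
  have hk2 : k₂ ^ 2 < 1 := by nlinarith
  have hk1 : k₁ ^ 2 < 1 := by nlinarith
  have hc : ∀ k : ℝ, k ^ 2 < 1 → Continuous fun θ => (1 / √(1 - k ^ 2 * Real.sin θ ^ 2) +
      1 / √(1 - k ^ 2 * (1 - Real.sin θ ^ 2))) * Real.exp (-k ^ 2 / 4) := fun k hk => by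
    refine ((continuous_ellipticF_integrand hk).add ?_).mul continuous_const
    refine continuous_const.div (by fun_prop) fun θ => (Real.sqrt_pos.2 ?_).ne'
    rw [← Real.cos_sq']
    nlinarith [Real.cos_sq_le_one θ, sq_nonneg k, sq_nonneg (Real.cos θ)]
  have h : 2 * ellipticK k₁ * Real.exp (-k₁ ^ 2 / 4) ≤ 2 * ellipticK k₂ * Real.exp (-k₂ ^ 2 / 4) := by
    rw [two_mul_ellipticK hk1, two_mul_ellipticK hk2, ← intervalIntegral.integral_mul_const,
      ← intervalIntegral.integral_mul_const]
    refine intervalIntegral.integral_mono_on (by positivity) ((hc k₁ hk1).intervalIntegrable _ _)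
      ((hc k₂ hk2).intervalIntegrable _ _) fun θ _ => ?_
    exact monotoneOn_symm_integrand (sq_nonneg _) (Real.sin_sq_le_one θ) ⟨sq_nonneg _, hk1⟩
      ⟨sq_nonneg _, hk2⟩ (pow_le_pow_left₀ h1 h12 2)
  linarith

/-- In q = k² the square is (q² - q + 1)e^q, whose derivative is (q² + q)e^q. -/
theorem modR_mul_exp_lt {k₁ k₂ : ℝ} (h1 : 0 ≤ k₁) (h12 : k₁ < k₂) :
    modR k₁ * Real.exp (k₁ ^ 2 / 2) < modR k₂ * Real.exp (k₂ ^ 2 / 2) := by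
  have hm : StrictMonoOn (fun q : ℝ => (q ^ 2 - q + 1) * Real.exp q) (Ici 0) := by
    have hd : ∀ q : ℝ, HasDerivAt (fun q : ℝ => (q ^ 2 - q + 1) * Real.exp q)
        ((2 * q - 1) * Real.exp q + (q ^ 2 - q + 1) * Real.exp q) q := fun q => by
      have := (((hasDerivAt_pow 2 q).sub (hasDerivAt_id' q)).add_const 1).mul (Real.hasDerivAt_exp q)
      exact this.congr_deriv (by push_cast; simp)
    refine strictMonoOn_of_hasDerivWithinAt_pos (convex_Ici 0)
      (fun q _ => (hd q).continuousAt.continuousWithinAt) (fun q _ => (hd q).hasDerivWithinAt)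
      fun q hq => ?_
    rw [interior_Ici] at hq
    have hq' : 0 < q := hq
    have := Real.exp_pos q
    have : 0 < (q ^ 2 + q) * Real.exp q := by positivity
    linarith
  have h3 := hm (sq_nonneg k₁) (sq_nonneg k₂) (pow_lt_pow_left₀ h12 h1 two_ne_zero)
  refine lt_of_pow_lt_pow_left₀ 2 (mul_pos (modR_pos _) (Real.exp_pos _)).le ?_
  have e : ∀ k : ℝ, (modR k * Real.exp (k ^ 2 / 2)) ^ 2 =
      ((k ^ 2) ^ 2 - k ^ 2 + 1) * Real.exp (k ^ 2) := fun k => by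
    rw [mul_pow, modR_sq, ← Real.exp_nat_mul]
    push_cast
    ring_nf
  rw [e, e]
  exact h3

theorem gFun_eq (k : ℝ) : gFun k = 64 * ellipticK k ^ 2 * modR k := rfl

/-- The factor R decreases while k² < 1/2, so the growth of K must compensate. The exponentials in
(K e^{-k²/4})² (R e^{k²/2}) cancel. The rate 1/4 is the logarithmic derivative of K in k² at 0 and
leaves no slack there. -/
theorem gFun_strictMonoOn : StrictMonoOn gFun (Ico 0 1) := fun k₁ hk₁ k₂ hk₂ h => by
  have h1 := ellipticK_mul_exp_le hk₁.1 h.le hk₂.2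
  have h2 := modR_mul_exp_lt hk₁.1 h
  have hK : 0 < ellipticK k₁ := ellipticK_pos (by nlinarith [hk₁.1, hk₁.2])
  have h3 := pow_le_pow_left₀ (mul_pos hK (Real.exp_pos _)).le h1 2
  have h4 : (ellipticK k₁ * Real.exp (-k₁ ^ 2 / 4)) ^ 2 * (modR k₁ * Real.exp (k₁ ^ 2 / 2)) <
      (ellipticK k₂ * Real.exp (-k₂ ^ 2 / 4)) ^ 2 * (modR k₂ * Real.exp (k₂ ^ 2 / 2)) :=
    mul_lt_mul_of_le_of_lt_of_nonneg_of_pos h3 h2 (mul_pos (modR_pos _) (Real.exp_pos _)).le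
      (lt_of_lt_of_le (by positivity) h3)
  have e : ∀ k : ℝ, (ellipticK k * Real.exp (-k ^ 2 / 4)) ^ 2 * (modR k * Real.exp (k ^ 2 / 2)) =
      ellipticK k ^ 2 * modR k := fun k => by
    have : Real.exp (-k ^ 2 / 4) ^ 2 * Real.exp (k ^ 2 / 2) = 1 := by
      rw [← Real.exp_nat_mul, ← Real.exp_add, ← Real.exp_zero]
      congr 1; push_cast; ring
    linear_combination (ellipticK k ^ 2 * modR k) * this
  rw [e, e] at h4
  rw [gFun_eq, gFun_eq]
  linarith

theorem continuousOn_gFun {ρ : ℝ} (hρ1 : ρ < 1) : ContinuousOn gFun (Icc 0 ρ) := by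
  rcases lt_or_ge ρ 0 with hρ0 | hρ0
  · rw [Icc_eq_empty (not_le.2 hρ0)]; exact continuousOn_empty _
  have hp : 0 < 1 - ρ ^ 2 := by nlinarith
  -- Truncating the radicand from below makes the integrand jointly continuous for all k without
  -- changing it on [0, ρ].
  have hc : Continuous fun k : ℝ => ∫ θ in (0 : ℝ)..Real.pi / 2,
      1 / √(max (1 - ρ ^ 2) (1 - k ^ 2 * Real.sin θ ^ 2)) := by
    refine intervalIntegral.continuous_parametric_intervalIntegral_of_continuous' ?_ _ _
    exact continuous_const.div (by fun_prop) fun x =>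
      (Real.sqrt_pos.2 (lt_max_of_lt_left hp)).ne'
  have hR : Continuous modR := by unfold modR; fun_prop
  refine (((continuous_const (y := (64 : ℝ))).mul (hc.pow 2)).mul hR).continuousOn.congr
    fun k hk => ?_
  rw [gFun_eq]
  simp only [Pi.mul_apply, Pi.pow_apply]
  congr 3
  unfold ellipticK ellipticF
  congr 1; funext θ
  have : 1 - ρ ^ 2 ≤ 1 - k ^ 2 * Real.sin θ ^ 2 := by
    have h1 : k ^ 2 ≤ ρ ^ 2 := pow_le_pow_left₀ hk.1 hk.2 2
    nlinarith [Real.sin_sq_le_one θ, sq_nonneg k, sq_nonneg (Real.sin θ)]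
  rw [max_eq_right this]

/-- `K(k) ≥ log (1 / √(1 - k²))`. -/
theorem neg_log_le_ellipticK {k p : ℝ} (hp : 0 < p) (hkp : k ^ 2 + p ^ 2 = 1) :
    -Real.log p ≤ ellipticK k := by
  have hpi := Real.pi_gt_three
  have hk : k ^ 2 < 1 := by nlinarith
  have hd : ∀ θ ∈ uIcc 0 (Real.pi / 2), HasDerivAt (fun θ => -Real.log (Real.pi / 2 - θ + p))
      (1 / (Real.pi / 2 - θ + p)) θ := fun θ hθ => by
    rw [uIcc_of_le (by positivity)] at hθ
    have h1 : HasDerivAt (fun θ => Real.pi / 2 - θ + p) (-1) θ :=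
      ((hasDerivAt_id' θ).const_sub _).add_const p
    refine (h1.log (by linarith [hθ.2])).neg.congr_deriv (by ring)
  have hci : ContinuousOn (fun θ => 1 / (Real.pi / 2 - θ + p)) (uIcc 0 (Real.pi / 2)) := by
    refine continuousOn_const.div (by fun_prop) fun θ hθ => ?_
    rw [uIcc_of_le (by positivity)] at hθ
    linarith [hθ.2]
  have h1 := intervalIntegral.integral_eq_sub_of_hasDerivAt hd hci.intervalIntegrable
  -- With p² = 1 - k² the radicand is cos²θ + p² sin²θ, whose root is at most cos θ + p ≤ π/2 - θ +
  -- p.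
  have h2 : ∫ θ in (0 : ℝ)..Real.pi / 2, 1 / (Real.pi / 2 - θ + p) ≤ ellipticK k := by
    refine intervalIntegral.integral_mono_on (by positivity) hci.intervalIntegrable
      ((continuous_ellipticF_integrand hk).intervalIntegrable _ _) fun θ hθ => ?_
    have hq := one_sub_sq_mul_sin_sq_pos hk θ
    refine one_div_le_one_div_of_le (Real.sqrt_pos.2 hq) ?_
    rw [Real.sqrt_le_left (by linarith [hθ.2])]
    have hc : Real.cos θ ≤ Real.pi / 2 - θ := by
      rw [← Real.sin_pi_div_two_sub]
      exact Real.sin_le (by linarith [hθ.2])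
    have hc0 : 0 ≤ Real.cos θ := Real.cos_nonneg_of_mem_Icc ⟨by linarith [hθ.1], hθ.2⟩
    have hs := Real.sin_sq_add_cos_sq θ
    have : 1 - k ^ 2 * Real.sin θ ^ 2 = Real.cos θ ^ 2 + p ^ 2 * Real.sin θ ^ 2 := by
      have : k ^ 2 = 1 - p ^ 2 := by linarith
      rw [this]; linarith
    rw [this]
    have h3 : p ^ 2 * Real.sin θ ^ 2 ≤ p ^ 2 :=
      mul_le_of_le_one_right (sq_nonneg _) (Real.sin_sq_le_one θ)
    nlinarith [mul_nonneg hc0 hp.le]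
  rw [h1, sub_self, zero_add, sub_zero] at h2
  have h3 : 0 ≤ Real.log (Real.pi / 2 + p) := Real.log_nonneg (by linarith)
  linarith

theorem gFun_zero : gFun 0 = 16 * Real.pi ^ 2 := by
  have h1 : ellipticK 0 = Real.pi / 2 := by simp [ellipticK, ellipticF]
  have h2 : modR 0 = 1 := by simp [modR]
  rw [gFun_eq, h1, h2]; ring

theorem exists_lt_gFun {L : ℝ} (hL : 0 < L) : ∃ ρ ∈ Ioo (0 : ℝ) 1, L ^ 2 < gFun ρ := by
  -- The logarithmic lower bound then gives K ≥ L, and with R ≥ 1/2 the value of `gFun` is at least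
  -- 32L².
  set p := Real.exp (-L) with hp
  have hp0 : 0 < p := Real.exp_pos _
  have hp1 : p < 1 := by rw [hp, Real.exp_lt_one_iff]; linarith
  have hq : 0 < 1 - p ^ 2 := by nlinarith
  have hs := Real.sq_sqrt hq.le
  have h1 := neg_log_le_ellipticK (k := √(1 - p ^ 2)) hp0 (by rw [hs]; ring)
  rw [hp, Real.log_exp, neg_neg, ← hp] at h1
  refine ⟨√(1 - p ^ 2), ⟨Real.sqrt_pos.2 hq, ?_⟩, ?_⟩
  · rw [Real.sqrt_lt' one_pos]; nlinarith
  · set k := √(1 - p ^ 2)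
    have hR : 1 / 2 ≤ modR k := by
      refine le_of_pow_le_pow_left₀ two_ne_zero (modR_pos k).le ?_
      rw [modR_sq]; nlinarith [sq_nonneg (k ^ 2 - 1 / 2)]
    rw [gFun_eq]
    have h2 := pow_le_pow_left₀ hL.le h1 2
    have h3 : 0 < L ^ 2 := by positivity
    nlinarith

/-- The hypothesis L > 4π says exactly that L² exceeds the value 16π² of `gFun` at 0. -/
theorem existsUnique_isCriticalModulus {L : ℝ} (hL : 4 * Real.pi < L) :
    ∃! kL : ℝ, IsCriticalModulus L kL := by
  have hpi := Real.pi_pos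
  obtain ⟨ρ, hρ, hg⟩ := exists_lt_gFun (L := L) (by linarith)
  have h0 : gFun 0 < L ^ 2 := by rw [gFun_zero]; nlinarith
  obtain ⟨k, hk, hgk⟩ := intermediate_value_Ioo hρ.1.le (continuousOn_gFun hρ.2) ⟨h0, hg⟩
  refine ⟨k, ⟨⟨hk.1, hk.2.trans hρ.2⟩, hgk⟩, fun k' hk' => ?_⟩
  exact gFun_strictMonoOn.injOn ⟨hk'.1.1.le, hk'.1.2⟩ ⟨hk.1.le, hk.2.trans hρ.2⟩
    (hk'.2.trans hgk.symm)

theorem mTilde_pos {L kL k : ℝ} (hkL : IsCriticalModulus L kL) (hk : k ∈ Ioo 0 kL) :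
    0 < mTilde L k := by
  have h := gFun_strictMonoOn ⟨hk.1.le, hk.2.trans hkL.1.2⟩ ⟨hkL.1.1.le, hkL.1.2⟩ hk.2
  rw [hkL.2] at h
  exact sub_pos.2 h

/-! ### The cnoidal waves -/

section Wave

variable {L k : ℝ}

/-- The number `c(k) - 1`. -/
def waveExcess (L k : ℝ) : ℝ := 64 * ellipticK k ^ 2 * modR k / mTilde L k

theorem mTilde_eq (L k : ℝ) : mTilde L k = L ^ 2 - 64 * ellipticK k ^ 2 * modR k := rfl

theorem waveSpeed_eq (hm : mTilde L k ≠ 0) : waveSpeed L k = waveExcess L k + 1 := by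
  rw [waveSpeed, waveExcess, div_add_one hm]
  congr 1
  rw [mTilde_eq]; ring

theorem waveConst_eq (hm : mTilde L k ≠ 0) :
    waveConst L k = waveExcess L k ^ 3 * profileConst k := by
  have hR := (modR_pos k).ne'
  rw [waveConst, waveExcess, profileConst, ← modR]
  field_simp
  ring

theorem cnoidalWave_eq (hm : mTilde L k ≠ 0) :
    cnoidalWave L k = fun x => (waveExcess L k * cnProfile L k x) ^ 2 := by
  funext x
  have hR := (modR_pos k).ne'
  rw [cnoidalWave, waveExcess, cnProfile, jacobiCN, Real.cos_sq']
  congr 1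
  field_simp
  rw [mTilde_eq]
  ring

theorem contDiff_cnoidalWave (hk : k ^ 2 < 1) (L : ℝ) : ContDiff ℝ ∞ (cnoidalWave L k) := by
  have h1 : ContDiff ℝ ∞ fun x => jacobiAm k (2 * ellipticK k / L * x) :=
    (contDiff_jacobiAm hk).comp (contDiff_const.mul contDiff_id)
  unfold cnoidalWave jacobiCN
  exact (contDiff_const.add (contDiff_const.mul ((Real.contDiff_cos.comp h1).pow 2))).pow 2

theorem waveExcess_mul (hL : 0 < L) (hm : mTilde L k ≠ 0) :
    64 * ellipticK k ^ 2 * modR k / L ^ 2 * (waveExcess L k + 1) = waveExcess L k := by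
  rw [← waveSpeed_eq hm, waveSpeed, waveExcess]
  field_simp

theorem isPeriodicWaveProfile_cnoidalWave (hL : 0 < L) (hk0 : 0 < k) (hk : k ^ 2 < 1)
    (hm : 0 < mTilde L k) :
    IsPeriodicWaveProfile L (waveSpeed L k) (waveConst L k) (cnoidalWave L k) := by
  have hw := waveProfile_cnProfile hL hk0 hk
  have hlam := waveExcess_mul hL hm.ne'
  have hσ : 0 < waveExcess L k :=
    div_pos (mul_pos (mul_pos (by norm_num) (pow_pos (ellipticK_pos hk) 2)) (modR_pos k)) hm
  set σ := waveExcess L k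
  set v := cnProfile L k
  have hφ1 := hw.c1Per_sq.const_smul (σ ^ 2)
  have hφ2 := hw.c1Per_sq_deriv.const_smul (σ ^ 2)
  have e : cnoidalWave L k = fun x => σ ^ 2 * v x ^ 2 := by
    rw [cnoidalWave_eq hm.ne']; funext x; ring
  refine ⟨?_, contDiff_cnoidalWave hk L, ?_, fun x => ?_, fun x => ?_⟩
  · rw [waveSpeed_eq hm.ne']; linarith
  · rw [e]; exact hφ1.per
  · rw [e]
    have := hw.pos x
    positivity
  · have h1 : deriv (cnoidalWave L k) = fun x => σ ^ 2 * (2 * v x * cnProfileDeriv L k x) := by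
      rw [e]; exact funext fun x => (hφ1.deriv x).deriv
    have h2 : cnoidalWave L k x ^ (3 / 2 : ℝ) = (σ * v x) ^ 3 := by
      rw [cnoidalWave_eq hm.ne']
      exact rpow_three_halves (mul_pos hσ (hw.pos x)).le
    rw [h1, (hφ2.deriv x).deriv, h2, e, waveSpeed_eq hm.ne', waveConst_eq hm.ne']
    linear_combination (-σ ^ 2 * (v x ^ 2 - v x ^ 3 + profileConst k)) * hlam

theorem orbitallyStable_cnoidalWave (hL : 0 < L) (hk0 : 0 < k) (hk : k ^ 2 < 1)
    (hm : 0 < mTilde L k) : OrbitallyStable L (cnoidalWave L k) := by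
  rw [cnoidalWave_eq hm.ne']
  exact (waveProfile_cnProfile hL hk0 hk).orbitallyStable
    (div_pos (mul_pos (mul_pos (by norm_num) (pow_pos (ellipticK_pos hk) 2)) (modR_pos k)) hm)
    (waveExcess_mul hL hm.ne')

end Wave

end

end PeriodicBBM

end

theorem theorem5p2 (L : ℝ) (hL : 4 * Real.pi < L) :
    (∃! kL : ℝ, IsCriticalModulus L kL) ∧
      ∀ kL : ℝ, IsCriticalModulus L kL → ∀ k ∈ Ioo 0 kL,
        IsPeriodicWaveProfile L (waveSpeed L k) (waveConst L k) (cnoidalWave L k) ∧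
          OrbitallyStable L (cnoidalWave L k) := by
  refine ⟨PeriodicBBM.existsUnique_isCriticalModulus hL, fun kL hkL k hk => ?_⟩
  have hL0 : 0 < L := by linarith [Real.pi_pos]
  have hk1 : k ^ 2 < 1 := by nlinarith [hk.1, hk.2.trans hkL.1.2]
  have hm := PeriodicBBM.mTilde_pos hkL hk
  exact ⟨PeriodicBBM.isPeriodicWaveProfile_cnoidalWave hL0 hk.1 hk1 hm,
    PeriodicBBM.orbitallyStable_cnoidalWave hL0 hk.1 hk1 hm⟩
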